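/- Let $|\theta|<1$ and $\sigma_1,\sigma_2>0$. Consider the heteroscedastic AR(1) model \[X_t=\theta X_{t-1}+Z_t,\qquad Z_t=\tau_t\epsilon_t,\qquad t=1,2,\ldots,\] where $\tau_t=\sigma_1$ for odd $t$ and $\tau_t=\sigma_2$ for even $t$, the $\epsilon_t$ are i.i.d. with mean $0$, variance $1$ and $E\epsilon_t^4<\infty$, $\epsilon_t$ is independent of $(X_0,\ldots,X_{t-1})$ for every $t\ge1$, and $X_0$ has all moments finite. Let $\{w_{nt}:1\le t\le n,\ n\ge1\}$ be a triangular array of square integrable random weights, exchangeable within each row, such that each row is independent of the process $\{X_t\}$. Put $\sigma_n^2=\mathrm{Var}(w_{n1})$ and $W_{nt}=\sigma_n^{-1}(w_{nt}-1)$, and assume: - (A1) $E w_{n1}=1$ for all $n\ge1$; - (A2) there is $k>0$ with $\sigma_n^2>k$ for all large $n$, and $\sigma_n^2=o(n)$; - (A3) $\mathrm{Cov}(w_{n1},w_{n2})=O(n^{-1})$; - (A4) for all large $n$ and all $1\le j\le n$, $EW_{nj}=0$ and $EW_{nj}^2=1$; moreover $\frac1n\sum_{j=1}^nW_{nj}^2\to1$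 in probability, and $\lim_{k\to\infty}\limsup_{n\to\infty}\sqrt{E\big(W_{n1}^2\mathbf 1_{\{|W_{n1}|>k\}}\big)}=0$. Let \[\hat\theta_n=\frac{\sum_{t=2}^nX_tX_{t-1}}{\sum_{t=2}^nX_{t-1}^2},\qquad \hat\theta_n^*=\frac{\sum_{t=2}^nw_{nt}X_tX_{t-1}}{\sum_{t=2}^nw_{nt}X_{t-1}^2}\] be the least squares estimator and the weighted bootstrap estimator. Then for every $x\in\mathbb R$, as $n\to\infty$, \[P\big[\sqrt n\,\sigma_n^{-1}(\hat\theta_n^*-\hat\theta_n)\le x\,\big|\,X_1,\ldots,X_n\big]-P[Y\le x]=o_P(1),\] where \[Y\sim N\left(0,\;4\,\frac{1-\theta^2}{1+\theta^2}\cdot\frac{\sigma_1^2\sigma_2^2+\theta^2(\sigma_1^4+\sigma_2^4)/2}{(\sigma_1^2+\sigma_2^2)^2}\right).\] -/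

import Mathlib

open MeasureTheory ProbabilityTheory Filter Topology Asymptotics

noncomputable section

namespace WeightedBootstrapAR

variable {Ω : Type*} [MeasurableSpace Ω]

/-- The heteroscedastic AR(1) model
`X t = θ * X (t-1) + Z t`, `Z t = τ t * ε t` for `t = 1, 2, …`, with `|θ| < 1`, constants `τ t > 0`,
i.i.d. errors `ε t` (`t ≥ 1`) of mean `0`, variance `1` and finite fourth moment, `ε t` independent
of the past `X 0, …, X (t-1)`, and an initial value `X 0` all of whose moments are finite.
The value `ε 0` plays no role. -/
structure IsHeteroscedasticAR1 (μ : Measure Ω) (θ : ℝ) (τ : ℕ → ℝ) (X ε : ℕ → Ω → ℝ) : Prop where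
  abs_theta_lt_one : |θ| < 1
  tau_pos : ∀ t, 1 ≤ t → 0 < τ t
  measurable_X : ∀ t, Measurable (X t)
  measurable_eps : ∀ t, 1 ≤ t → Measurable (ε t)
  recursion : ∀ t, 1 ≤ t → ∀ ω, X t ω = θ * X (t - 1) ω + τ t * ε t ω
  initial_moments : ∀ p : ℕ, MemLp (X 0) p μ
  eps_indep : iIndepFun (fun t : ℕ => ε (t + 1)) μ
  eps_identDistrib : ∀ t, 1 ≤ t → IdentDistrib (ε t) (ε 1) μ μ
  eps_mean : ∫ ω, ε 1 ω ∂μ = 0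
  eps_variance : Var[ε 1; μ] = 1
  eps_fourth : MemLp (ε 1) 4 μ
  eps_indep_past : ∀ t, 1 ≤ t → IndepFun (ε t) (fun ω (s : Fin t) => X s ω) μ

/-- Error standard deviations alternating between `σ₁` (odd times) and `σ₂` (even times). -/
def alternating (σ₁ σ₂ : ℝ) (t : ℕ) : ℝ := if Odd t then σ₁ else σ₂

/-- The least squares estimator `∑_{t=2}^n X_t X_{t-1} / ∑_{t=2}^n X_{t-1}^2`. -/
def lse (X : ℕ → Ω → ℝ) (n : ℕ) (ω : Ω) : ℝ :=
  (∑ t ∈ Finset.Icc 2 n, X t ω * X (t - 1) ω) / ∑ t ∈ Finset.Icc 2 n, X (t - 1) ω ^ 2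

/-- The weighted bootstrap estimator
`∑_{t=2}^n w_{nt} X_t X_{t-1} / ∑_{t=2}^n w_{nt} X_{t-1}^2`. -/
def wbLse (w : ℕ → ℕ → Ω → ℝ) (X : ℕ → Ω → ℝ) (n : ℕ) (ω : Ω) : ℝ :=
  (∑ t ∈ Finset.Icc 2 n, w n t ω * X t ω * X (t - 1) ω) /
    ∑ t ∈ Finset.Icc 2 n, w n t ω * X (t - 1) ω ^ 2

/-- The standard deviation `σ_n` of the weights in row `n`. As the weights are independent of the
data and exchangeable, this is also their conditional standard deviation given the data. -/
def weightSD (μ : Measure Ω) (w : ℕ → ℕ → Ω → ℝ) (n : ℕ) : ℝ := √(Var[w n 1; μ])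

/-- The standardized weights `W_{nt} = σ_n⁻¹ (w_{nt} - 1)`. -/
def stdWeight (μ : Measure Ω) (w : ℕ → ℕ → Ω → ℝ) (n t : ℕ) (ω : Ω) : ℝ :=
  (weightSD μ w n)⁻¹ * (w n t ω - 1)

/-- The array `w n t`, `1 ≤ t ≤ n`, consists of square integrable random variables, and is
row-exchangeable: permuting a row does not change its joint law.
Entries outside `1 ≤ t ≤ n` play no role. -/
structure IsExchangeableArray (μ : Measure Ω) (w : ℕ → ℕ → Ω → ℝ) : Prop where
  measurable : ∀ n, ∀ t ∈ Finset.Icc 1 n, Measurable (w n t)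
  memLp_two : ∀ n, ∀ t ∈ Finset.Icc 1 n, MemLp (w n t) 2 μ
  exchangeable : ∀ (n : ℕ) (π : Equiv.Perm (Finset.Icc 1 n)),
    IdentDistrib (fun ω (i : Finset.Icc 1 n) => w n (π i) ω)
      (fun ω (i : Finset.Icc 1 n) => w n i ω) μ μ

/-- The conditions on the multiplier array `U n j`, `1 ≤ j ≤ n`, in the exchangeable
central limit theorem of Praestgaard and Wellner. By exchangeability the tail condition may be
stated for `j = 1`. -/
structure PWConditions (μ : Measure Ω) (U : ℕ → ℕ → Ω → ℝ) : Prop where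
  mean_zero : ∀ᶠ n : ℕ in atTop, ∀ j ∈ Finset.Icc 1 n, ∫ ω, U n j ω ∂μ = 0
  second_moment : ∀ᶠ n : ℕ in atTop, ∀ j ∈ Finset.Icc 1 n, ∫ ω, U n j ω ^ 2 ∂μ = 1
  mean_sq : TendstoInMeasure μ
    (fun (n : ℕ) ω => (1 / (n : ℝ)) * ∑ j ∈ Finset.Icc 1 n, U n j ω ^ 2) atTop (fun _ => 1)
  tail : Tendsto
    (fun k : ℝ => limsup (fun n : ℕ => √(∫ ω in {ω | k < |U n 1 ω|}, U n 1 ω ^ 2 ∂μ)) atTop)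
    atTop (𝓝 0)

/-- The conditions (A1)–(A4) on the row-exchangeable bootstrap weights. -/
structure WeightConditions (μ : Measure Ω) (w : ℕ → ℕ → Ω → ℝ) : Prop where
  array : IsExchangeableArray μ w
  A1 : ∀ n, 1 ≤ n → ∫ ω, w n 1 ω ∂μ = 1
  A2_lower : ∃ k : ℝ, 0 < k ∧ ∀ᶠ n : ℕ in atTop, k < weightSD μ w n ^ 2
  A2_upper : (fun n : ℕ => weightSD μ w n ^ 2) =o[atTop] (fun n : ℕ => (n : ℝ))
  A3 : (fun n : ℕ => cov[w n 1, w n 2; μ]) =O[atTop] (fun n : ℕ => ((n : ℝ))⁻¹)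
  A4 : PWConditions μ (stdWeight μ w)

/-- The σ-algebra generated by the data `X_1, …, X_n`. -/
abbrev dataSigma (X : ℕ → Ω → ℝ) (n : ℕ) : MeasurableSpace Ω :=
  ⨆ t ∈ Finset.Icc 1 n, MeasurableSpace.comap (X t) inferInstance

/-- The bootstrap distribution function
`P_B(√n σ_n⁻¹ (θ̂*_n - θ̂_n) ≤ x) = P(√n σ_n⁻¹ (θ̂*_n - θ̂_n) ≤ x | X_1, …, X_n)`. -/
def bootstrapCDF (μ : Measure Ω) (w : ℕ → ℕ → Ω → ℝ) (X : ℕ → Ω → ℝ) (x : ℝ) (n : ℕ) : Ω → ℝ :=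
  μ⟦{ω | √(n : ℝ) * (weightSD μ w n)⁻¹ * (wbLse w X n ω - lse X n ω) ≤ x} | dataSigma X n⟧

/-- The variance of the limiting normal law. -/
def limitVar (θ σ₁ σ₂ : ℝ) : ℝ :=
  4 * ((1 - θ ^ 2) / (1 + θ ^ 2)) *
    ((σ₁ ^ 2 * σ₂ ^ 2 + θ ^ 2 * (σ₁ ^ 4 + σ₂ ^ 4) / 2) / (σ₁ ^ 2 + σ₂ ^ 2) ^ 2)

end WeightedBootstrapAR

end

/-! The weights are independent of the data, so the conditional distribution function is found by
freezing the path `x = X(ω)` and integrating over the weights alone (`bootstrapCDF_ae_eq`). For a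
frozen path the root equals `S / A` where `A > 0` (`root_eq_div`), with `S = ∑ α_t W_{nt}`, `α_t =
x_{t-1} (x_t - θ̂_n x_{t-1}) / √n` and `A = n⁻¹ ∑ w_{nt} x_{t-1}²`. The normal equations of least
squares say that `∑ α_t = 0`.

The central limit theorem for `S` is proved by Stein's method of exchangeable pairs. Swapping `W_i`
and `W_j` preserves the joint law and lowers `S` by `D_{ij} = (α_i - α_j)(W_i - W_j)`, whence `E[S
f(S)] = (4n)⁻¹ ∑ E[D_{ij} (f(S) - f(S - D_{ij}))]` (`Exchangeable.integral_linear_smul`). For `f(s)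
= exp(its)` a Taylor expansion turns this into `φ'(t) + b t φ(t) ≈ 0`, the differential equation of
the characteristic function of `N(0, b)`, provided that `(4n)⁻¹ ∑ D_{ij}²` concentrates at `b = lim
∑ α_t²` (`integral_abs_pairVar_sub_le`). This uses `∑ α_t⁴ → 0` and the conditions on the weights.
The denominator tends to a constant `a` in `L¹`, because `σ_n² / n → 0` and the covariances vanish.
Hence `S - c A` is asymptotically `N(-c a, b)`, and the root has limit law `N(0, b / a²)`
(`tendsto_measureReal_root_le`).

The path must satisfy laws of large numbers for `X_{t-1}²` (limit `a`) and `X_{t-1}² Z_t²` (limit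
`b`), plus some negligibility conditions. They hold in `L¹`: centred functions of `ε_t` times
functions of `X_{t-1}` are orthogonal, and summation by parts with two-periodic weights reduces
averages of squares to such sums (`l1Null_mean_weighted_sq`). Every subsequence therefore has a
further subsequence along which almost every path qualifies, and this gives convergence in
probability. -/

noncomputable section

namespace WeightedBootstrapAR

variable {Ω : Type*} [MeasurableSpace Ω]

/-! ### Cauchy–Schwarz for integrals. -/

section CauchySchwarz

variable {μ : Measure Ω}

/-- The quadratic `r ↦ ∫ (|f| - r |g|)²` is nonnegative, so its discriminant is not positive. -/
theorem integral_abs_mul_le_sqrt {f g : Ω → ℝ} (hf : MemLp f 2 μ) (hg : MemLp g 2 μ) :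
    ∫ ω, |f ω * g ω| ∂μ ≤ √(∫ ω, f ω ^ 2 ∂μ) * √(∫ ω, g ω ^ 2 ∂μ) := by
  have hf2 := hf.integrable_sq
  have hg2 := hg.integrable_sq
  have hfg : Integrable (fun ω => |f ω * g ω|) μ := (hf.integrable_mul hg).abs
  have key : ∀ r : ℝ, 0 ≤ (∫ ω, g ω ^ 2 ∂μ) * (r * r) + (-2 * ∫ ω, |f ω * g ω| ∂μ) * r
      + ∫ ω, f ω ^ 2 ∂μ := by
    intro r
    have h : ∫ ω, (|f ω| - r * |g ω|) ^ 2 ∂μ =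
        (∫ ω, g ω ^ 2 ∂μ) * (r * r) + (-2 * ∫ ω, |f ω * g ω| ∂μ) * r + ∫ ω, f ω ^ 2 ∂μ := by
      rw [← integral_mul_const, ← integral_const_mul, ← integral_mul_const, ← integral_add,
        ← integral_add]
      · congr 1 with ω
        rw [abs_mul, ← sq_abs (f ω), ← sq_abs (g ω)]
        ring
      · exact (hg2.mul_const _).add ((hfg.const_mul _).mul_const _)
      · exact hf2
      · exact hg2.mul_const _
      · exact (hfg.const_mul _).mul_const _
    rw [← h]
    exact integral_nonneg fun ω => sq_nonneg _
  have hd := discrim_le_zero key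
  rw [discrim] at hd
  rw [← Real.sqrt_mul (integral_nonneg fun ω => sq_nonneg _)]
  refine Real.le_sqrt_of_sq_le ?_
  nlinarith

theorem integral_abs_le_sqrt [IsProbabilityMeasure μ] {f : Ω → ℝ} (hf : MemLp f 2 μ) :
    ∫ ω, |f ω| ∂μ ≤ √(∫ ω, f ω ^ 2 ∂μ) := by
  simpa using integral_abs_mul_le_sqrt hf (memLp_const (1 : ℝ))

end CauchySchwarz

/-! ### Exchangeable families and second moments of their linear statistics. -/

section Exchangeable

variable {ι : Type*} {μ : Measure Ω}

/-- Exchangeability of a finite family of real random variables. -/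
def Exchangeable (μ : Measure Ω) (W : ι → Ω → ℝ) : Prop :=
  ∀ π : Equiv.Perm ι, IdentDistrib (fun ω i => W (π i) ω) (fun ω i => W i ω) μ μ

theorem Exchangeable.comp {W : ι → Ω → ℝ} (h : Exchangeable μ W) {φ : ℝ → ℝ}
    (hφ : Measurable φ) : Exchangeable μ (fun i ω => φ (W i ω)) := by
  intro π
  exact (h π).comp (u := fun v : ι → ℝ => fun i => φ (v i)) (by fun_prop)

theorem Exchangeable.integral_eq {E : Type*} [NormedAddCommGroup E] [NormedSpace ℝ E]
    [MeasurableSpace E] [BorelSpace E]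
    {W : ι → Ω → ℝ} (h : Exchangeable μ W) (π : Equiv.Perm ι) {F : (ι → ℝ) → E}
    (hF : Measurable F) : ∫ ω, F (fun i => W (π i) ω) ∂μ = ∫ ω, F (fun i => W i ω) ∂μ :=
  ((h π).comp hF).integral_eq

theorem Exchangeable.integral_single_eq {W : ι → Ω → ℝ} (h : Exchangeable μ W) (i j : ι)
    {F : ℝ → ℝ} (hF : Measurable F) : ∫ ω, F (W i ω) ∂μ = ∫ ω, F (W j ω) ∂μ := by
  classical
  have := h.integral_eq (Equiv.swap i j) (F := fun v : ι → ℝ => F (v j)) (by fun_prop)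
  simpa using this

theorem Exchangeable.integral_mul_eq {W : ι → Ω → ℝ} (h : Exchangeable μ W) {i j k l : ι}
    (hij : i ≠ j) (hkl : k ≠ l) :
    ∫ ω, W i ω * W j ω ∂μ = ∫ ω, W k ω * W l ω ∂μ := by
  classical
  obtain ⟨π, hk, hl⟩ : ∃ π : Equiv.Perm ι, π k = i ∧ π l = j := by
    -- The first transposition sends `k` to `i` and `l` to some index other than `i`; the second
    -- moves that index to `j` and fixes `i`.
    refine ⟨Equiv.swap j (Equiv.swap k i l) * Equiv.swap k i, ?_, ?_⟩
    · have h1 : i ≠ Equiv.swap k i l := by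
        intro h0
        have := congrArg (Equiv.swap k i) h0
        simp at this
        exact hkl this
      simp [Equiv.swap_apply_of_ne_of_ne hij h1]
    · simp
  have := h.integral_eq π (F := fun v : ι → ℝ => v k * v l) (by fun_prop)
  simpa [hk, hl] using this

variable [Fintype ι]

theorem sum_mul_swap [DecidableEq ι] (α v : ι → ℝ) (i j : ι) :
    ∑ k, α k * v (Equiv.swap i j k) = ∑ k, α k * v k - (α i - α j) * (v i - v j) := by
  have h : ∀ k, α k * v (Equiv.swap i j k) = α k * v k +
      ((if k = i then α k * (v j - v i) else 0) + if k = j then α k * (v i - v j) else 0) := by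
    intro k
    by_cases hi : k = i
    · subst hi
      by_cases hj : k = j
      · subst hj; simp
      · simp [hj]; ring
    · by_cases hj : k = j
      · subst hj; simp [hi]; ring
      · simp [hi, hj, Equiv.swap_apply_of_ne_of_ne hi hj]
  simp_rw [h, Finset.sum_add_distrib]
  simp
  ring

/-- Expanding the product, the mixed terms carry a factor `∑ α = 0`; the two diagonal terms remain,
each summed over an idle index. -/
theorem sum_sum_sub_mul_sub {α : ι → ℝ} (hα : ∑ i, α i = 0) (v : ι → ℝ) :
    ∑ i, ∑ j, (α i - α j) * (v i - v j) = 2 * Fintype.card ι * ∑ i, α i * v i := by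
  have h : ∀ i j, (α i - α j) * (v i - v j) =
      α i * v i - α i * v j - α j * v i + α j * v j := fun i j => by ring
  simp_rw [h, Finset.sum_add_distrib, Finset.sum_sub_distrib, ← Finset.mul_sum, ← Finset.sum_mul,
    hα]
  simp only [Finset.sum_const, Finset.card_univ, nsmul_eq_mul, zero_mul, sub_zero,
    mul_zero, mul_assoc, mul_left_comm _ (Fintype.card ι : ℝ)]
  rw [← Finset.mul_sum]
  ring

theorem sum_sum_sub_sq {α : ι → ℝ} (hα : ∑ i, α i = 0) :
    ∑ i, ∑ j, (α i - α j) ^ 2 = 2 * Fintype.card ι * ∑ i, α i ^ 2 := by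
  simpa [sq] using sum_sum_sub_mul_sub hα α

/-- The exchangeable pair identity for a linear statistic with zero-sum coefficients. -/
theorem Exchangeable.integral_linear_smul {E : Type*} [NormedAddCommGroup E] [NormedSpace ℝ E]
    [MeasurableSpace E] [BorelSpace E] [SecondCountableTopology E] [Nonempty ι]
    {W : ι → Ω → ℝ} (h : Exchangeable μ W) {α : ι → ℝ} (hα : ∑ i, α i = 0)
    {f : ℝ → E} (hf : Measurable f)
    (hint : ∀ i j, Integrable
      (fun ω => ((α i - α j) * (W i ω - W j ω)) • f (∑ k, α k * W k ω)) μ) :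
    ∫ ω, (∑ k, α k * W k ω) • f (∑ k, α k * W k ω) ∂μ =
      (4 * Fintype.card ι : ℝ)⁻¹ • ∑ i, ∑ j, ∫ ω, ((α i - α j) * (W i ω - W j ω)) •
        (f (∑ k, α k * W k ω) - f (∑ k, α k * W k ω - (α i - α j) * (W i ω - W j ω))) ∂μ := by
  classical
  have hn : (Fintype.card ι : ℝ) ≠ 0 := by simp
  have hF : ∀ i j, Measurable fun v : ι → ℝ =>
      ((α i - α j) * (v i - v j)) • f (∑ k, α k * v k) := by
    intro i j
    have h1 : Measurable fun v : ι → ℝ => f (∑ k, α k * v k) := hf.comp (by fun_prop)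
    have h2 : Measurable fun v : ι → ℝ => (α i - α j) * (v i - v j) := by fun_prop
    exact h2.smul h1
  -- Under the swap the increment `D` changes sign and the statistic `S` becomes `S - D`.
  have hid : ∀ i j, (fun ω => ((α i - α j) * (W (Equiv.swap i j i) ω - W (Equiv.swap i j j) ω)) •
      f (∑ k, α k * W (Equiv.swap i j k) ω)) = fun ω => -(((α i - α j) * (W i ω - W j ω)) •
        f (∑ k, α k * W k ω - (α i - α j) * (W i ω - W j ω))) := by
    intro i j
    funext ω
    rw [sum_mul_swap α (fun k => W k ω), ← neg_smul]
    simp only [Equiv.swap_apply_left, Equiv.swap_apply_right]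
    congr 1
    ring
  have hint' : ∀ i j, Integrable (fun ω => ((α i - α j) * (W i ω - W j ω)) •
        f (∑ k, α k * W k ω - (α i - α j) * (W i ω - W j ω))) μ := by
    intro i j
    have := ((h (Equiv.swap i j)).comp (hF i j)).symm.integrable_snd (hint i j)
    have h3 : Integrable (fun ω => ((α i - α j) * (W (Equiv.swap i j i) ω -
      W (Equiv.swap i j j) ω)) • f (∑ k, α k * W (Equiv.swap i j k) ω)) μ := this
    rw [hid] at h3
    simpa using h3.neg
  have hpair : ∀ i j, ∫ ω, ((α i - α j) * (W i ω - W j ω)) •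
        (f (∑ k, α k * W k ω) - f (∑ k, α k * W k ω - (α i - α j) * (W i ω - W j ω))) ∂μ =
      (2 : ℝ) • ∫ ω, ((α i - α j) * (W i ω - W j ω)) • f (∑ k, α k * W k ω) ∂μ := by
    intro i j
    simp_rw [smul_sub]
    rw [integral_sub (hint i j) (hint' i j)]
    have := h.integral_eq (Equiv.swap i j) (hF i j)
    rw [hid, integral_neg] at this
    rw [sub_eq_add_neg, this, two_smul]
  simp_rw [hpair, ← Finset.smul_sum]
  simp_rw [← integral_finsetSum _ fun j _ => hint _ j]
  rw [← integral_finsetSum _ fun i _ => integrable_finsetSum _ fun j _ => hint i j]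
  simp_rw [← Finset.sum_smul, sum_sum_sub_mul_sub hα, mul_smul]
  rw [integral_smul, integral_smul, smul_smul, smul_smul, smul_smul]
  -- One factor `2` comes from `hpair`, the factor `2 * card` from `sum_sum_sub_mul_sub`.
  rw [show (4 * Fintype.card ι : ℝ)⁻¹ * 2 * 2 * Fintype.card ι = 1 by field_simp; norm_num,
    one_smul]

/-- The second moment of a linear statistic with zero-sum coefficients. -/
theorem Exchangeable.integral_linear_sq_le [Nonempty ι] {W : ι → Ω → ℝ} (h : Exchangeable μ W)
    (hL : ∀ i, MemLp (W i) 2 μ) {α : ι → ℝ} (hα : ∑ i, α i = 0) {C : ℝ}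
    (hC : ∀ i j, ∫ ω, (W i ω - W j ω) ^ 2 ∂μ ≤ C) :
    ∫ ω, (∑ k, α k * W k ω) ^ 2 ∂μ ≤ C / 2 * ∑ i, α i ^ 2 := by
  have hn : (0 : ℝ) < Fintype.card ι := by exact_mod_cast Fintype.card_pos
  have hS : MemLp (fun ω => ∑ k, α k * W k ω) 2 μ :=
    memLp_finsetSum _ fun k _ => (hL k).const_mul _
  -- With the identity function as `f`, the difference `f S - f (S - D)` is `D`, so the pair
  -- identity computes `E[S²]` from the `E[D²]`.
  have key := h.integral_linear_smul hα (f := fun s : ℝ => s) measurable_id (fun i j =>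
    (((hL i).sub (hL j)).const_mul (α i - α j)).integrable_mul hS)
  simp only [smul_eq_mul, sub_sub_cancel] at key
  have h2 : ∀ i j, ∫ ω, (α i - α j) * (W i ω - W j ω) * ((α i - α j) * (W i ω - W j ω)) ∂μ =
      (α i - α j) ^ 2 * ∫ ω, (W i ω - W j ω) ^ 2 ∂μ := by
    intro i j
    rw [← integral_const_mul]
    congr 1 with ω
    ring
  simp_rw [sq (∑ k, α k * W k _)]
  rw [key]
  simp_rw [h2]
  calc (4 * Fintype.card ι : ℝ)⁻¹ * ∑ i, ∑ j, (α i - α j) ^ 2 * ∫ ω, (W i ω - W j ω) ^ 2 ∂μ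
      ≤ (4 * Fintype.card ι : ℝ)⁻¹ * ∑ i, ∑ j, (α i - α j) ^ 2 * C := by
        gcongr with i _ j _
        exact hC i j
    _ = C / 2 * ∑ i, α i ^ 2 := by
        simp_rw [← Finset.sum_mul]
        rw [sum_sum_sub_sq hα]
        field_simp
        norm_num

theorem integral_sub_sq_le {f g : Ω → ℝ} (hf : MemLp f 2 μ) (hg : MemLp g 2 μ) :
    ∫ ω, (f ω - g ω) ^ 2 ∂μ ≤ 2 * ∫ ω, f ω ^ 2 ∂μ + 2 * ∫ ω, g ω ^ 2 ∂μ := by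
  rw [← integral_const_mul, ← integral_const_mul,
    ← integral_add (hf.integrable_sq.const_mul _) (hg.integrable_sq.const_mul _)]
  refine integral_mono (hf.sub hg).integrable_sq
    ((hf.integrable_sq.const_mul _).add (hg.integrable_sq.const_mul _)) fun ω => ?_
  simp only
  nlinarith [sq_nonneg (f ω + g ω)]

/-- The second moment of the mean of exchangeable variables. -/
theorem Exchangeable.integral_mean_sq_le [Nonempty ι] {W : ι → Ω → ℝ} (h : Exchangeable μ W)
    (hL : ∀ i, MemLp (W i) 2 μ) (h1 : ∀ i, ∫ ω, W i ω ^ 2 ∂μ = 1) {k l : ι} (hkl : k ≠ l) :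
    ∫ ω, ((Fintype.card ι : ℝ)⁻¹ * ∑ i, W i ω) ^ 2 ∂μ ≤
      (Fintype.card ι : ℝ)⁻¹ + |∫ ω, W k ω * W l ω ∂μ| := by
  classical
  have hn : (0 : ℝ) < Fintype.card ι := by exact_mod_cast Fintype.card_pos
  have hint : ∀ i j, Integrable (fun ω => W i ω * W j ω) μ := fun i j =>
    (hL i).integrable_mul (hL j)
  set c := |∫ ω, W k ω * W l ω ∂μ| with hc
  have hb : ∀ i j, ∫ ω, W i ω * W j ω ∂μ ≤ (if i = j then 1 else 0) + c := by
    intro i j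
    by_cases hij : i = j
    · subst hij
      simp only [← sq, h1, if_true]
      linarith [abs_nonneg (∫ ω, W k ω * W l ω ∂μ)]
    · rw [h.integral_mul_eq hij hkl]
      simp only [hij, if_false, zero_add]
      exact le_abs_self _
  have he : ∫ ω, ((Fintype.card ι : ℝ)⁻¹ * ∑ i, W i ω) ^ 2 ∂μ =
      (Fintype.card ι : ℝ)⁻¹ ^ 2 * ∑ i, ∑ j, ∫ ω, W i ω * W j ω ∂μ := by
    simp_rw [← integral_finsetSum _ fun j _ => hint _ j]
    rw [← integral_finsetSum _ fun i _ => integrable_finsetSum _ fun j _ => hint i j,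
      ← integral_const_mul]
    congr 1 with ω
    rw [mul_pow, sq (∑ i, W i ω), Finset.sum_mul_sum]
  rw [he]
  calc (Fintype.card ι : ℝ)⁻¹ ^ 2 * ∑ i, ∑ j, ∫ ω, W i ω * W j ω ∂μ
      ≤ (Fintype.card ι : ℝ)⁻¹ ^ 2 * ∑ i : ι, ∑ j, ((if i = j then 1 else 0) + c) := by
        gcongr with i _ j _
        exact hb i j
    _ = (Fintype.card ι : ℝ)⁻¹ + c := by
        simp [Finset.sum_add_distrib]
        field_simp

end Exchangeable

/-! ### Taylor remainder and concentration of the pair variance. -/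

section SteinBound

/-- Taylor's bound serves `|y| ≤ 1`, the triangle inequality the rest. This quadratic bound is meant
for truncated weights; the linear one below is for their tails, where only second moments are
available. -/
theorem norm_exp_mul_I_sub_le_sq (y : ℝ) :
    ‖Complex.exp (y * Complex.I) - 1 - y * Complex.I‖ ≤ 2 * y ^ 2 := by
  have hn : ‖(y : ℂ) * Complex.I‖ = |y| := by simp
  rcases le_or_gt |y| 1 with h | h
  · have := Complex.norm_exp_sub_one_sub_id_le (x := (y : ℂ) * Complex.I) (by rwa [hn])
    rw [hn, sq_abs] at this
    nlinarith [sq_nonneg y]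
  · have h1 : ‖Complex.exp (y * Complex.I) - 1‖ ≤ |y| := by
      rw [mul_comm]
      exact Real.norm_exp_I_mul_ofReal_sub_one_le
    have h2 := norm_sub_le (Complex.exp (y * Complex.I) - 1) (y * Complex.I)
    rw [hn] at h2
    nlinarith [sq_abs y]

theorem norm_exp_mul_I_sub_le_abs (y : ℝ) :
    ‖Complex.exp (y * Complex.I) - 1 - y * Complex.I‖ ≤ 2 * |y| := by
  have h1 : ‖Complex.exp (y * Complex.I) - 1‖ ≤ |y| := by
    rw [mul_comm]
    exact Real.norm_exp_I_mul_ofReal_sub_one_le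
  have h2 := norm_sub_le (Complex.exp (y * Complex.I) - 1) (y * Complex.I)
  have hn : ‖(y : ℂ) * Complex.I‖ = |y| := by simp
  rw [hn] at h2
  linarith

/-- The square truncated from below: `x ^ 2` where `K < |x|`, and `0` elsewhere. -/
def tailSq (K x : ℝ) : ℝ := if K < |x| then x ^ 2 else 0

theorem measurable_tailSq (K : ℝ) : Measurable (tailSq K) := by
  unfold tailSq
  exact Measurable.ite (measurableSet_lt measurable_const measurable_id.abs)
    (by fun_prop) measurable_const

theorem tailSq_nonneg (K x : ℝ) : 0 ≤ tailSq K x := by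
  unfold tailSq; split_ifs <;> positivity

theorem tailSq_le (K x : ℝ) : tailSq K x ≤ x ^ 2 := by
  unfold tailSq; split_ifs; exacts [le_rfl, sq_nonneg x]

theorem sq_sub_tailSq_le (K x : ℝ) : x ^ 2 - tailSq K x ≤ K ^ 2 := by
  unfold tailSq
  split_ifs with h
  · simp; positivity
  · rw [sub_zero, ← sq_abs]
    exact pow_le_pow_left₀ (abs_nonneg x) (not_lt.1 h) 2

/-- The pointwise remainder in the exchangeable pair expansion. -/
theorem norm_pair_remainder_le {K M : ℝ} (hK : 0 ≤ K) (t s a a' x y : ℝ)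
    (ha : |a| ≤ M) (ha' : |a'| ≤ M) :
    ‖Complex.I * (((a - a') * (x - y)) • (Complex.exp (t * s * Complex.I) -
        Complex.exp (t * (s - (a - a') * (x - y) : ℝ) * Complex.I))) +
        t * (((a - a') * (x - y)) ^ 2 • Complex.exp (t * s * Complex.I))‖ ≤
      (a - a') ^ 2 * (16 * K * M * t ^ 2 * (x ^ 2 + y ^ 2) +
        8 * |t| * (tailSq K x + tailSq K y)) := by
  set D := (a - a') * (x - y) with hD
  have hM : 0 ≤ M := (abs_nonneg a).trans ha
  -- The term `t D² exp(its)` is minus the first-order Taylor term, so what is left is a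
  -- second-order remainder of `exp(-itD)`.
  have he : Complex.I * (D • (Complex.exp (t * s * Complex.I) -
        Complex.exp (t * (s - D : ℝ) * Complex.I))) +
        t * (D ^ 2 • Complex.exp (t * s * Complex.I)) =
      -(Complex.I * D * Complex.exp ((t * s : ℝ) * Complex.I)) *
        (Complex.exp ((-(t * D) : ℝ) * Complex.I) - 1 - (-(t * D) : ℝ) * Complex.I) := by
    have : Complex.exp (t * (s - D : ℝ) * Complex.I) =
        Complex.exp ((t * s : ℝ) * Complex.I) * Complex.exp ((-(t * D) : ℝ) * Complex.I) := by
      rw [← Complex.exp_add]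
      congr 1
      push_cast
      ring
    rw [this]
    simp only [Complex.real_smul]
    push_cast
    linear_combination (t * D ^ 2 * Complex.exp (t * s * Complex.I)) * Complex.I_sq
  have hnorm : ‖-(Complex.I * D * Complex.exp ((t * s : ℝ) * Complex.I))‖ = |D| := by
    rw [norm_neg, norm_mul, norm_mul, Complex.norm_exp_ofReal_mul_I]
    simp
  rw [he, norm_mul, hnorm]
  have hsq : (x - y) ^ 2 ≤ 2 * (x ^ 2 + y ^ 2) := by nlinarith [sq_nonneg (x + y)]
  have hD2 : D ^ 2 ≤ (a - a') ^ 2 * (2 * (x ^ 2 + y ^ 2)) := by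
    rw [hD, mul_pow]
    gcongr
  have htx := tailSq_nonneg K x
  have hty := tailSq_nonneg K y
  -- If both weights are at most `K`, the remainder is of order `|D|³` and one factor `|D| ≤ 4KM` is
  -- small with the largest coefficient. Otherwise the larger weight exceeds `K`, and `D²` is
  -- absorbed by the tails.
  by_cases hxy : |x| ≤ K ∧ |y| ≤ K
  · have hDle : |D| ≤ 4 * K * M := by
      rw [hD, abs_mul]
      have h1 : |a - a'| ≤ 2 * M := (abs_sub a a').trans (by linarith)
      have h2 : |x - y| ≤ 2 * K := (abs_sub x y).trans (by linarith [hxy.1, hxy.2])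
      calc |a - a'| * |x - y| ≤ (2 * M) * (2 * K) := by gcongr
        _ = 4 * K * M := by ring
    calc |D| * ‖_‖ ≤ |D| * (2 * (-(t * D)) ^ 2) := by
          gcongr
          exact norm_exp_mul_I_sub_le_sq _
      _ = 2 * t ^ 2 * |D| * D ^ 2 := by ring
      _ ≤ 2 * t ^ 2 * (4 * K * M) * ((a - a') ^ 2 * (2 * (x ^ 2 + y ^ 2))) := by gcongr
      _ = (a - a') ^ 2 * (16 * K * M * t ^ 2 * (x ^ 2 + y ^ 2)) := by ring
      _ ≤ _ := by
          gcongr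
          simp only [le_add_iff_nonneg_right]
          positivity
  · have htail : 2 * (x ^ 2 + y ^ 2) ≤ 4 * (tailSq K x + tailSq K y) := by
      unfold tailSq
      rw [not_and_or, not_le, not_le] at hxy
      split_ifs with h1 h2 h2
      · nlinarith [sq_nonneg x, sq_nonneg y]
      · have : y ^ 2 ≤ x ^ 2 := sq_le_sq.2 ((not_lt.1 h2).trans h1.le)
        linarith
      · have : x ^ 2 ≤ y ^ 2 := sq_le_sq.2 ((not_lt.1 h1).trans h2.le)
        linarith
      · tauto
    calc |D| * ‖_‖ ≤ |D| * (2 * |(-(t * D))|) := by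
          gcongr
          exact norm_exp_mul_I_sub_le_abs _
      _ = 2 * |t| * D ^ 2 := by
          rw [abs_neg, abs_mul t, ← sq_abs D]
          ring
      _ ≤ 2 * |t| * ((a - a') ^ 2 * (4 * (tailSq K x + tailSq K y))) := by
          gcongr
          exact hD2.trans (by gcongr)
      _ = (a - a') ^ 2 * (8 * |t| * (tailSq K x + tailSq K y)) := by ring
      _ ≤ _ := by
          gcongr
          simp only [le_add_iff_nonneg_left]
          positivity

variable {ι : Type*} [Fintype ι] {μ : Measure Ω}

/-- The conditional variance proxy `(4 n)⁻¹ ∑ i j, ((α i - α j) (v i - v j)) ^ 2`. -/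
def pairVar (α v : ι → ℝ) : ℝ :=
  (4 * Fintype.card ι : ℝ)⁻¹ * ∑ i, ∑ j, ((α i - α j) * (v i - v j)) ^ 2

/-- The main term is `∑ α²` times the mean of the `v²`. The others are errors: a quadratic form with
zero-sum coefficients, a multiple of the mean of `v`, and the square of the linear statistic divided
by the number of weights. -/
theorem pairVar_eq [Nonempty ι] {α : ι → ℝ} (hα : ∑ i, α i = 0) (v : ι → ℝ) :
    pairVar α v = 1 / 2 * ∑ i, (α i ^ 2 - (Fintype.card ι : ℝ)⁻¹ * ∑ j, α j ^ 2) * v i ^ 2 +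
      (∑ i, α i ^ 2) * ((Fintype.card ι : ℝ)⁻¹ * ∑ i, v i ^ 2) -
      (∑ i, α i ^ 2 * v i) * ((Fintype.card ι : ℝ)⁻¹ * ∑ i, v i) +
      (Fintype.card ι : ℝ)⁻¹ * (∑ i, α i * v i) ^ 2 := by
  have hn : (Fintype.card ι : ℝ) ≠ 0 := by simp
  have h : ∀ i j, ((α i - α j) * (v i - v j)) ^ 2 =
      α i ^ 2 * v i ^ 2 * 1 + α i ^ 2 * v j ^ 2 + v i ^ 2 * α j ^ 2 + 1 * (α j ^ 2 * v j ^ 2)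
      + (-2 * (α i ^ 2 * v i)) * v j + (-2 * v i) * (α j ^ 2 * v j)
      + (-2 * (α i * v i ^ 2)) * α j + (-2 * α i) * (α j * v j ^ 2)
      + (4 * (α i * v i)) * (α j * v j) := fun i j => by ring
  unfold pairVar
  simp_rw [h, Finset.sum_add_distrib, ← Finset.mul_sum, ← Finset.sum_mul, ← Finset.mul_sum, hα,
    sub_mul, Finset.sum_sub_distrib, mul_assoc, ← Finset.mul_sum]
  simp only [Finset.sum_const, Finset.card_univ, nsmul_eq_mul]
  field_simp
  ring

/-- Fourth moments of the weights need not exist, so squares are truncated. The truncated squares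
are exchangeable and bounded by `K²`, which allows the second moment bound for zero-sum
coefficients; the discarded tails are estimated in `L¹`. -/
theorem integral_sum_mul_tailSq_le [IsProbabilityMeasure μ] [Nonempty ι] {W : ι → Ω → ℝ}
    (h : Exchangeable μ W) (hm : ∀ i, Measurable (W i)) (hL : ∀ i, MemLp (W i) 2 μ)
    {K T : ℝ} (hT : ∀ i, ∫ ω, tailSq K (W i ω) ∂μ ≤ T)
    {q : ι → ℝ} (hq : ∑ i, q i = 0) :
    ∫ ω, |∑ i, q i * W i ω ^ 2| ∂μ ≤ √(K ^ 4 / 2 * ∑ i, q i ^ 2) + (∑ i, |q i|) * T := by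
  have htm : ∀ i, Measurable fun ω => tailSq K (W i ω) := fun i =>
    (measurable_tailSq K).comp (hm i)
  have hti : ∀ i, Integrable (fun ω => tailSq K (W i ω)) μ := fun i =>
    (hL i).integrable_sq.mono' (htm i).aestronglyMeasurable (ae_of_all _ fun ω => by
      rw [Real.norm_eq_abs, abs_of_nonneg (tailSq_nonneg _ _)]; exact tailSq_le _ _)
  have hYb : ∀ x, 0 ≤ x ^ 2 - tailSq K x ∧ x ^ 2 - tailSq K x ≤ K ^ 2 := fun x =>
    ⟨sub_nonneg.2 (tailSq_le K x), sq_sub_tailSq_le K x⟩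
  set Y : ι → Ω → ℝ := fun i ω => W i ω ^ 2 - tailSq K (W i ω) with hY
  have hYe : Exchangeable μ Y := h.comp (φ := fun x => x ^ 2 - tailSq K x)
    ((measurable_id.pow_const 2).sub (measurable_tailSq K))
  have hYL : ∀ i, MemLp (Y i) 2 μ := fun i => by
    refine MemLp.of_bound (((hm i).pow_const 2).sub (htm i)).aestronglyMeasurable (K ^ 2)
      (ae_of_all _ fun ω => ?_)
    rw [Real.norm_eq_abs, abs_of_nonneg (hYb _).1]
    exact (hYb _).2
  have hsum : MemLp (fun ω => ∑ i, q i * Y i ω) 2 μ :=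
    memLp_finsetSum _ fun k _ => (hYL k).const_mul _
  have h1 : ∫ ω, (∑ i, q i * Y i ω) ^ 2 ∂μ ≤ K ^ 4 / 2 * ∑ i, q i ^ 2 := by
    refine hYe.integral_linear_sq_le hYL hq fun i j => ?_
    calc ∫ ω, (Y i ω - Y j ω) ^ 2 ∂μ ≤ ∫ _, K ^ 4 ∂μ := by
          refine integral_mono ((hYL i).sub (hYL j)).integrable_sq (integrable_const _)
            fun ω => ?_
          have := hYb (W i ω)
          have := hYb (W j ω)
          have h2 : |Y i ω - Y j ω| ≤ K ^ 2 := by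
            rw [abs_le]; simp only [hY]; constructor <;> linarith
          calc (Y i ω - Y j ω) ^ 2 = |Y i ω - Y j ω| ^ 2 := (sq_abs _).symm
            _ ≤ (K ^ 2) ^ 2 := by gcongr
            _ = K ^ 4 := by ring
      _ = K ^ 4 := by simp
  have hI1 : Integrable (fun ω => |∑ i, q i * Y i ω|) μ :=
    (hsum.integrable one_le_two).abs
  have hI2 : Integrable (fun ω => ∑ i, |q i| * tailSq K (W i ω)) μ :=
    integrable_finsetSum _ fun i _ => (hti i).const_mul _
  calc ∫ ω, |∑ i, q i * W i ω ^ 2| ∂μ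
      ≤ ∫ ω, (|∑ i, q i * Y i ω| + ∑ i, |q i| * tailSq K (W i ω)) ∂μ := by
        refine integral_mono (integrable_finsetSum _ fun i _ =>
          (hL i).integrable_sq.const_mul _).abs (hI1.add hI2) fun ω => ?_
        have : ∑ i, q i * W i ω ^ 2 = ∑ i, q i * Y i ω + ∑ i, q i * tailSq K (W i ω) := by
          rw [← Finset.sum_add_distrib]
          exact Finset.sum_congr rfl fun i _ => by simp only [hY]; ring
        simp only [this]
        refine (abs_add_le _ _).trans ?_
        gcongr
        refine (Finset.abs_sum_le_sum_abs _ _).trans (le_of_eq ?_)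
        exact Finset.sum_congr rfl fun i _ => by rw [abs_mul, abs_of_nonneg (tailSq_nonneg _ _)]
    _ = ∫ ω, |∑ i, q i * Y i ω| ∂μ + ∑ i, |q i| * ∫ ω, tailSq K (W i ω) ∂μ := by
        rw [integral_add hI1 hI2, integral_finsetSum _ fun i _ => (hti i).const_mul _]
        simp_rw [integral_const_mul]
    _ ≤ _ := by
        rw [Finset.sum_mul]
        refine add_le_add ?_ (Finset.sum_le_sum fun i _ =>
          mul_le_mul_of_nonneg_left (hT i) (abs_nonneg _))
        exact (integral_abs_le_sqrt hsum).trans (Real.sqrt_le_sqrt h1)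

/-- The pairwise variance proxy concentrates at the target variance. -/
theorem integral_abs_pairVar_sub_le [IsProbabilityMeasure μ] [Nonempty ι] {W : ι → Ω → ℝ}
    (h : Exchangeable μ W) (hm : ∀ i, Measurable (W i)) (hL : ∀ i, MemLp (W i) 2 μ)
    (h1 : ∀ i, ∫ ω, W i ω ^ 2 ∂μ = 1)
    {K T : ℝ} (hT : ∀ i, ∫ ω, tailSq K (W i ω) ∂μ ≤ T)
    {α : ι → ℝ} (hα : ∑ i, α i = 0) (b : ℝ) :
    ∫ ω, |pairVar α (fun i => W i ω) - b| ∂μ ≤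
      √(K ^ 4 / 2 * ∑ i, α i ^ 4) + 2 * (∑ i, α i ^ 2) * T +
      (∑ i, α i ^ 2) * ∫ ω, |(Fintype.card ι : ℝ)⁻¹ * ∑ i, W i ω ^ 2 - 1| ∂μ +
      |∑ i, α i ^ 2 - b| +
      (∑ i, α i ^ 2) * √(∫ ω, ((Fintype.card ι : ℝ)⁻¹ * ∑ i, W i ω) ^ 2 ∂μ) +
      2 * (∑ i, α i ^ 2) * (Fintype.card ι : ℝ)⁻¹ := by
  have hn : (0 : ℝ) < Fintype.card ι := by exact_mod_cast Fintype.card_pos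
  set N : ℝ := (Fintype.card ι : ℝ)⁻¹ with hN
  have hNpos : 0 < N := by positivity
  set A := ∑ i, α i ^ 2 with hA
  have hA0 : 0 ≤ A := Finset.sum_nonneg fun i _ => sq_nonneg _
  -- Centring makes the squared coefficients zero-sum, while `∑ q²` and `∑ |q|` stay below `∑ α⁴`
  -- and `2A`.
  set q : ι → ℝ := fun i => α i ^ 2 - N * A with hq
  have hqs : ∑ i, q i = 0 := by
    simp [hq, Finset.sum_sub_distrib, ← hA, hN]
  have hq2 : ∑ i, q i ^ 2 ≤ ∑ i, α i ^ 4 := by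
    have : ∀ i, q i ^ 2 = α i ^ 4 - 2 * N * A * α i ^ 2 + (N * A) ^ 2 := fun i => by
      simp only [hq]; ring
    simp_rw [this, Finset.sum_add_distrib, Finset.sum_sub_distrib, ← Finset.mul_sum, ← hA]
    simp only [Finset.sum_const, Finset.card_univ, nsmul_eq_mul]
    have h3 : (Fintype.card ι : ℝ) * (N * A) ^ 2 = N * A ^ 2 := by
      rw [hN]; field_simp
    rw [h3]
    nlinarith [mul_nonneg hNpos.le (sq_nonneg A)]
  have hqabs : ∑ i, |q i| ≤ 2 * A := by
    calc ∑ i, |q i| ≤ ∑ i, (α i ^ 2 + N * A) := by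
          refine Finset.sum_le_sum fun i _ => ?_
          refine (abs_sub _ _).trans (le_of_eq ?_)
          rw [abs_of_nonneg (sq_nonneg _), abs_of_nonneg (by positivity)]
      _ = 2 * A := by
          rw [Finset.sum_add_distrib, ← hA]
          simp only [Finset.sum_const, Finset.card_univ, nsmul_eq_mul, hN]
          field_simp
          norm_num
  have hT0 : 0 ≤ T := (integral_nonneg fun ω => tailSq_nonneg K _).trans
    (hT (Classical.arbitrary ι))
  have hS : MemLp (fun ω => ∑ k, α k * W k ω) 2 μ :=
    memLp_finsetSum _ fun k _ => (hL k).const_mul _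
  have hP : MemLp (fun ω => ∑ k, α k ^ 2 * W k ω) 2 μ :=
    memLp_finsetSum _ fun k _ => (hL k).const_mul _
  have hB : MemLp (fun ω => N * ∑ k, W k ω) 2 μ :=
    (memLp_finsetSum _ fun k _ => hL k).const_mul _
  have hi1 : Integrable (fun ω => |∑ i, q i * W i ω ^ 2|) μ :=
    (integrable_finsetSum _ fun i _ => (hL i).integrable_sq.const_mul _).abs
  have hi2 : Integrable (fun ω => |N * ∑ i, W i ω ^ 2 - 1|) μ :=
    (((integrable_finsetSum _ fun i _ => (hL i).integrable_sq).const_mul _).sub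
      (integrable_const _)).abs
  have hi3 : Integrable (fun ω => |(∑ k, α k ^ 2 * W k ω) * (N * ∑ k, W k ω)|) μ :=
    (hP.integrable_mul hB).abs
  have hi4 := hS.integrable_sq
  have e1 := integral_sum_mul_tailSq_le h hm hL hT hqs
  -- Cauchy–Schwarz with the weights `α²`, of total mass `A`, gives `(∑ α² W)² ≤ A ∑ α² W²`, of
  -- integral `A²`.
  have e3 : ∫ ω, |(∑ k, α k ^ 2 * W k ω) * (N * ∑ k, W k ω)| ∂μ ≤
      A * √(∫ ω, (N * ∑ i, W i ω) ^ 2 ∂μ) := by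
    refine (integral_abs_mul_le_sqrt hP hB).trans ?_
    gcongr
    refine Real.sqrt_le_iff.2 ⟨hA0, ?_⟩
    calc ∫ ω, (∑ k, α k ^ 2 * W k ω) ^ 2 ∂μ ≤ ∫ ω, A * ∑ k, α k ^ 2 * W k ω ^ 2 ∂μ := by
          refine integral_mono hP.integrable_sq ((integrable_finsetSum _ fun i _ =>
            (hL i).integrable_sq.const_mul _).const_mul _) fun ω => ?_
          exact Finset.sum_sq_le_sum_mul_sum_of_sq_le_mul _ (fun i _ => sq_nonneg _)
            (fun i _ => by positivity) fun i _ => le_of_eq (by ring)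
      _ = A ^ 2 := by
          rw [integral_const_mul, integral_finsetSum _ fun i _ =>
            (hL i).integrable_sq.const_mul _]
          simp_rw [integral_const_mul, h1, mul_one, ← hA, sq]
  have e4 : ∫ ω, (∑ k, α k * W k ω) ^ 2 ∂μ ≤ 2 * A := by
    have := h.integral_linear_sq_le hL hα (C := 4) fun i j => by
      refine (integral_sub_sq_le (hL i) (hL j)).trans ?_
      rw [h1, h1]; norm_num
    linarith
  have hpv : ∀ ω, |pairVar α (fun i => W i ω) - b| ≤ 1 / 2 * |∑ i, q i * W i ω ^ 2| +
      A * |N * ∑ i, W i ω ^ 2 - 1| + |A - b| + |(∑ k, α k ^ 2 * W k ω) * (N * ∑ k, W k ω)| +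
      N * (∑ k, α k * W k ω) ^ 2 := by
    intro ω
    rw [pairVar_eq hα]
    have : 1 / 2 * ∑ i, q i * W i ω ^ 2 + A * (N * ∑ i, W i ω ^ 2) -
        (∑ i, α i ^ 2 * W i ω) * (N * ∑ i, W i ω) + N * (∑ i, α i * W i ω) ^ 2 - b =
        1 / 2 * ∑ i, q i * W i ω ^ 2 + A * (N * ∑ i, W i ω ^ 2 - 1) + (A - b) +
        -((∑ i, α i ^ 2 * W i ω) * (N * ∑ i, W i ω)) + N * (∑ i, α i * W i ω) ^ 2 := by ring
    rw [this]
    refine (abs_add_le _ _).trans (add_le_add ((abs_add_le _ _).trans (add_le_add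
      ((abs_add_le _ _).trans (add_le_add ((abs_add_le _ _).trans (add_le_add ?_ ?_)) le_rfl))
      ?_)) ?_)
    · rw [abs_mul, abs_of_pos (by norm_num : (0 : ℝ) < 1 / 2)]
    · rw [abs_mul, abs_of_nonneg hA0]
    · rw [abs_neg]
    · rw [abs_of_nonneg (by positivity)]
  have hi5 := ((((hi1.const_mul (1 / 2)).add (hi2.const_mul A)).add
    (integrable_const |A - b|)).add hi3).add (hi4.const_mul N)
  have hmono := integral_mono_of_nonneg (ae_of_all μ fun ω => abs_nonneg
    (pairVar α (fun i => W i ω) - b)) hi5 (ae_of_all μ hpv)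
  refine hmono.trans ?_
  simp only [Pi.add_apply]
  rw [integral_add _ (hi4.const_mul N), integral_add _ hi3, integral_add _ (integrable_const _),
    integral_add (hi1.const_mul _) (hi2.const_mul _), integral_const_mul, integral_const_mul,
    integral_const_mul, integral_const]
  · simp only [probReal_univ, smul_eq_mul, one_mul]
    have e0 : √(K ^ 4 / 2 * ∑ i, q i ^ 2) ≤ √(K ^ 4 / 2 * ∑ i, α i ^ 4) := by
      gcongr
    have e5 : (∑ i, |q i|) * T ≤ 2 * A * T := by gcongr
    have e6 : N * ∫ ω, (∑ k, α k * W k ω) ^ 2 ∂μ ≤ N * (2 * A) := by gcongr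
    have e7 := Real.sqrt_nonneg (K ^ 4 / 2 * ∑ i, α i ^ 4)
    have e8 : 0 ≤ 2 * A * T := by positivity
    linarith
  · exact (hi1.const_mul _).add (hi2.const_mul _)
  · exact ((hi1.const_mul _).add (hi2.const_mul _)).add (integrable_const _)
  · exact (((hi1.const_mul _).add (hi2.const_mul _)).add (integrable_const _)).add hi3

end SteinBound

/-! ### Characteristic functions of zero-sum linear statistics. -/

section CharFunBound

/-- A function satisfying the differential equation of the Gaussian characteristic function up to
`δ` is `δ |t|`-close to it. -/
theorem norm_sub_exp_le_of_deriv {φ φ' : ℝ → ℂ} {b δ t : ℝ} (hb : 0 ≤ b)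
    (h0 : φ 0 = 1) (hφ : ∀ s, HasDerivAt φ (φ' s) s)
    (hδ : ∀ s, |s| ≤ |t| → ‖φ' s + b * s * φ s‖ ≤ δ) :
    ‖φ t - Complex.exp (-(b * t ^ 2 / 2) : ℝ)‖ ≤ δ * |t| := by
  have hE : ∀ s : ℝ, HasDerivAt (fun s : ℝ => Complex.exp ((b * s ^ 2 / 2 : ℝ)))
      (Complex.exp ((b * s ^ 2 / 2 : ℝ)) * (b * s : ℝ)) s := by
    intro s
    have h1 : HasDerivAt (fun s : ℝ => b * s ^ 2 / 2) (b * s) s :=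
      (((hasDerivAt_pow 2 s).const_mul b).div_const 2).congr_deriv (by simp; ring)
    exact h1.ofReal_comp.cexp
  -- `exp(bs²/2)` is the integrating factor of the equation `φ' + b s φ = 0`; at the end its value
  -- at `t` cancels against the bound on the derivative.
  have hd : ∀ s, HasDerivAt (fun s : ℝ => φ s * Complex.exp ((b * s ^ 2 / 2 : ℝ)))
      ((φ' s + b * s * φ s) * Complex.exp ((b * s ^ 2 / 2 : ℝ))) s := by
    intro s
    exact ((hφ s).mul (hE s)).congr_deriv (by push_cast; ring)
  have hEn : ∀ s : ℝ, ‖Complex.exp ((b * s ^ 2 / 2 : ℝ))‖ = Real.exp (b * s ^ 2 / 2) := by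
    intro s
    rw [Complex.norm_exp, Complex.ofReal_re]
  have hbound : ∀ s ∈ Set.Icc (-|t|) |t|,
      ‖(φ' s + b * s * φ s) * Complex.exp ((b * s ^ 2 / 2 : ℝ))‖ ≤
        δ * Real.exp (b * t ^ 2 / 2) := by
    intro s hs
    have hs' : |s| ≤ |t| := abs_le.2 hs
    rw [norm_mul, hEn]
    have h2 : s ^ 2 ≤ t ^ 2 := sq_le_sq.2 hs'
    have h3 : 0 ≤ δ := (norm_nonneg _).trans (hδ s hs')
    exact mul_le_mul (hδ s hs') (by gcongr) (Real.exp_nonneg _) h3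
  have hmv := (convex_Icc (-|t|) |t|).norm_image_sub_le_of_norm_hasDerivWithin_le
    (fun s _ => (hd s).hasDerivWithinAt) hbound
    (x := 0) (y := t) (by simp) ⟨neg_abs_le t, le_abs_self t⟩
  simp only [h0] at hmv
  have hfac : φ t - Complex.exp (-(b * t ^ 2 / 2) : ℝ) =
      (φ t * Complex.exp ((b * t ^ 2 / 2 : ℝ)) - 1 * Complex.exp ((b * 0 ^ 2 / 2 : ℝ))) *
        Complex.exp (-(b * t ^ 2 / 2) : ℝ) := by
    have : Complex.exp ((b * t ^ 2 / 2 : ℝ)) * Complex.exp (-(b * t ^ 2 / 2) : ℝ) = 1 := by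
      rw [← Complex.exp_add]; simp
    rw [sub_mul, mul_assoc, this]
    simp
  rw [hfac, norm_mul, Complex.norm_exp, Complex.ofReal_re]
  calc _ ≤ (δ * Real.exp (b * t ^ 2 / 2) * ‖t - 0‖) * Real.exp (-(b * t ^ 2 / 2)) := by
        gcongr
    _ = δ * |t| * (Real.exp (b * t ^ 2 / 2) * Real.exp (-(b * t ^ 2 / 2))) := by
        rw [sub_zero, Real.norm_eq_abs]; ring
    _ = δ * |t| := by rw [← Real.exp_add]; simp

variable {μ : Measure Ω} [IsProbabilityMeasure μ]

theorem hasDerivAt_integral_exp {S : Ω → ℝ} (hSm : Measurable S) (hS : Integrable S μ) (t : ℝ) :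
    HasDerivAt (fun t : ℝ => ∫ ω, Complex.exp (t * S ω * Complex.I) ∂μ)
      (Complex.I * ∫ ω, S ω • Complex.exp (t * S ω * Complex.I) ∂μ) t := by
  rw [← integral_const_mul]
  have hnorm : ∀ (s : ℝ) ω, ‖Complex.exp (s * S ω * Complex.I)‖ = 1 := fun s ω => by
    rw [← Complex.ofReal_mul, Complex.norm_exp_ofReal_mul_I]
  have hmeas : ∀ s : ℝ, Measurable fun ω => Complex.exp (s * S ω * Complex.I) := fun s => by
    fun_prop
  refine (hasDerivAt_integral_of_dominated_loc_of_deriv_le (s := Set.univ)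
    (F := fun (s : ℝ) ω => Complex.exp (s * S ω * Complex.I))
    (F' := fun (s : ℝ) ω => Complex.I * S ω • Complex.exp (s * S ω * Complex.I))
    (bound := fun ω => |S ω|) Filter.univ_mem
    (Eventually.of_forall fun s => (hmeas s).aestronglyMeasurable)
    ((integrable_const (1 : ℝ)).mono' (hmeas t).aestronglyMeasurable
      (ae_of_all _ fun ω => (hnorm t ω).le)) ?_ ?_ hS.abs ?_).2
  · have : Measurable fun ω => Complex.I * S ω • Complex.exp (t * S ω * Complex.I) := by
      have h := hmeas t
      exact measurable_const.mul (hSm.smul h)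
    exact this.aestronglyMeasurable
  · refine ae_of_all _ fun ω s _ => ?_
    rw [norm_mul, norm_smul, hnorm]
    simp
  · refine ae_of_all _ fun ω s _ => ?_
    have h1 : HasDerivAt (fun s : ℝ => (s : ℂ) * S ω * Complex.I) (1 * S ω * Complex.I) s :=
      ((Complex.ofRealCLM.hasDerivAt (x := s)).mul_const _).mul_const _
    exact h1.cexp.congr_deriv (by rw [Complex.real_smul]; ring)

variable {ι : Type*} [Fintype ι]

/-- The first summand is the derivative of the characteristic function. The pair identity rewrites
it as a double sum, and adding the `pairVar` term leaves exactly the remainders of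
`norm_pair_remainder_le`. -/
theorem norm_linear_charFun_deriv_le [Nonempty ι] {W : ι → Ω → ℝ}
    (h : Exchangeable μ W) (hm : ∀ i, Measurable (W i)) (hL : ∀ i, MemLp (W i) 2 μ)
    (h1 : ∀ i, ∫ ω, W i ω ^ 2 ∂μ = 1)
    {K T M : ℝ} (hK : 0 ≤ K) (hT : ∀ i, ∫ ω, tailSq K (W i ω) ∂μ ≤ T)
    {α : ι → ℝ} (hα : ∑ i, α i = 0) (hM : ∀ i, |α i| ≤ M) (t : ℝ) :
    ‖Complex.I * (∫ ω, (∑ k, α k * W k ω) •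
        Complex.exp (t * (∑ k, α k * W k ω : ℝ) * Complex.I) ∂μ) +
      t * ∫ ω, pairVar α (fun i => W i ω) •
        Complex.exp (t * (∑ k, α k * W k ω : ℝ) * Complex.I) ∂μ‖ ≤
      (∑ i, α i ^ 2) * (16 * K * M * t ^ 2 + 8 * |t| * T) := by
  have hn : (0 : ℝ) < Fintype.card ι := by exact_mod_cast Fintype.card_pos
  set f : ℝ → ℂ := fun s => Complex.exp (t * s * Complex.I) with hf
  have hfm : Measurable f := by fun_prop
  have hfn : ∀ s, ‖f s‖ = 1 := fun s => by
    simp only [hf]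
    rw [← Complex.ofReal_mul, Complex.norm_exp_ofReal_mul_I]
  set S : Ω → ℝ := fun ω => ∑ k, α k * W k ω with hSdef
  have hSm : Measurable S := by fun_prop
  have hbi : ∀ {g : Ω → ℝ} {u : Ω → ℝ}, Integrable g μ → Measurable u →
      Integrable (fun ω => g ω • f (u ω)) μ := by
    intro g u hg hu
    refine hg.norm.mono' (hg.aestronglyMeasurable.smul
      (hfm.comp hu).aestronglyMeasurable) (ae_of_all _ fun ω => ?_)
    rw [norm_smul, hfn, mul_one]
  set D : ι → ι → Ω → ℝ := fun i j ω => (α i - α j) * (W i ω - W j ω) with hD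
  have hDm : ∀ i j, Measurable (D i j) := fun i j => by fun_prop
  have hDL : ∀ i j, MemLp (D i j) 2 μ := fun i j => ((hL i).sub (hL j)).const_mul _
  have hDi : ∀ i j, Integrable (D i j) μ := fun i j => (hDL i j).integrable one_le_two
  have hti : ∀ i, Integrable (fun ω => tailSq K (W i ω)) μ := fun i =>
    (hL i).integrable_sq.mono' ((measurable_tailSq K).comp (hm i)).aestronglyMeasurable
      (ae_of_all _ fun ω => by
      rw [Real.norm_eq_abs, abs_of_nonneg (tailSq_nonneg _ _)]; exact tailSq_le _ _)
  have key : ∫ ω, S ω • f (S ω) ∂μ = _ :=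
    h.integral_linear_smul hα hfm (fun i j => hbi (hDi i j) hSm)
  have hV : ∫ ω, pairVar α (fun i => W i ω) • f (S ω) ∂μ =
      (4 * Fintype.card ι : ℝ)⁻¹ • ∑ i, ∑ j, ∫ ω, D i j ω ^ 2 • f (S ω) ∂μ := by
    simp_rw [← integral_finsetSum _ fun j _ => hbi (hDL _ j).integrable_sq hSm]
    rw [← integral_finsetSum _ fun i _ => integrable_finsetSum _ fun j _ =>
      hbi (hDL i j).integrable_sq hSm, ← integral_smul]
    simp_rw [pairVar, mul_smul, Finset.sum_smul, hD]
  have hi1 : ∀ i j, Integrable (fun ω => D i j ω • (f (S ω) - f (S ω - D i j ω))) μ := by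
    intro i j
    simp_rw [smul_sub]
    exact (hbi (hDi i j) hSm).sub (hbi (hDi i j) (hSm.sub (hDm i j)))
  change ‖Complex.I * (∫ ω, S ω • f (S ω) ∂μ) +
    t * ∫ ω, pairVar α (fun i => W i ω) • f (S ω) ∂μ‖ ≤ _
  rw [key, hV, mul_smul_comm, mul_smul_comm, ← smul_add, Finset.mul_sum, Finset.mul_sum,
    ← Finset.sum_add_distrib]
  simp_rw [Finset.mul_sum, ← Finset.sum_add_distrib]
  rw [norm_smul, Real.norm_eq_abs, abs_of_nonneg (by positivity)]
  have hterm : ∀ i j, ‖Complex.I * ∫ ω, D i j ω • (f (S ω) - f (S ω - D i j ω)) ∂μ +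
      t * ∫ ω, D i j ω ^ 2 • f (S ω) ∂μ‖ ≤
      (α i - α j) ^ 2 * (32 * K * M * t ^ 2 + 16 * |t| * T) := by
    intro i j
    rw [← integral_const_mul, ← integral_const_mul,
      ← integral_add ((hi1 i j).const_mul _) ((hbi (hDL i j).integrable_sq hSm).const_mul _)]
    have hg1 : Integrable (fun ω => 16 * K * M * t ^ 2 * (W i ω ^ 2 + W j ω ^ 2)) μ :=
      ((hL i).integrable_sq.add (hL j).integrable_sq).const_mul _
    have hg2 : Integrable (fun ω => 8 * |t| * (tailSq K (W i ω) + tailSq K (W j ω))) μ :=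
      ((hti i).add (hti j)).const_mul _
    refine (norm_integral_le_of_norm_le ((hg1.add hg2).const_mul ((α i - α j) ^ 2))
      (ae_of_all _ fun ω => norm_pair_remainder_le hK t (S ω) (α i) (α j) (W i ω) (W j ω)
        (hM i) (hM j))).trans ?_
    simp only [Pi.add_apply]
    rw [integral_const_mul, integral_add hg1 hg2, integral_const_mul, integral_const_mul,
      integral_add (hL i).integrable_sq (hL j).integrable_sq, integral_add (hti i) (hti j),
      h1, h1]
    have hTT : 8 * |t| * (∫ ω, tailSq K (W i ω) ∂μ + ∫ ω, tailSq K (W j ω) ∂μ) ≤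
        8 * |t| * (T + T) :=
      mul_le_mul_of_nonneg_left (add_le_add (hT i) (hT j)) (by positivity)
    exact mul_le_mul_of_nonneg_left (by linarith) (sq_nonneg _)
  -- The double sum of `(α i - α j)²` is `2 * card * ∑ α²`, so the prefactor leaves one half: `32`
  -- and `16` become `16` and `8`.
  calc _ ≤ (4 * Fintype.card ι : ℝ)⁻¹ * ∑ i, ∑ j,
        (α i - α j) ^ 2 * (32 * K * M * t ^ 2 + 16 * |t| * T) := by
        gcongr
        refine (norm_sum_le _ _).trans (Finset.sum_le_sum fun i _ =>
          (norm_sum_le _ _).trans (Finset.sum_le_sum fun j _ => hterm i j))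
    _ = _ := by
        simp_rw [← Finset.sum_mul]
        rw [sum_sum_sub_sq hα]
        field_simp
        ring

/-- Quantitative central limit theorem for exchangeable weights. -/
theorem norm_charFun_sub_exp_le [Nonempty ι] {W : ι → Ω → ℝ}
    (h : Exchangeable μ W) (hm : ∀ i, Measurable (W i)) (hL : ∀ i, MemLp (W i) 2 μ)
    (h1 : ∀ i, ∫ ω, W i ω ^ 2 ∂μ = 1)
    {K T M : ℝ} (hK : 0 ≤ K) (hT : ∀ i, ∫ ω, tailSq K (W i ω) ∂μ ≤ T)
    {α : ι → ℝ} (hα : ∑ i, α i = 0) (hM : ∀ i, |α i| ≤ M) {b : ℝ} (hb : 0 ≤ b) (t : ℝ) :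
    ‖(∫ ω, Complex.exp (t * (∑ k, α k * W k ω : ℝ) * Complex.I) ∂μ) -
        Complex.exp (-(b * t ^ 2 / 2) : ℝ)‖ ≤
      ((∑ i, α i ^ 2) * (16 * K * M * t ^ 2 + 8 * |t| * T) +
        |t| * ∫ ω, |pairVar α (fun i => W i ω) - b| ∂μ) * |t| := by
  set S : Ω → ℝ := fun ω => ∑ k, α k * W k ω with hSdef
  have hSm : Measurable S := by fun_prop
  have hS : Integrable S μ :=
    integrable_finsetSum _ fun k _ => ((hL k).integrable one_le_two).const_mul _
  have hT0 : 0 ≤ T := (integral_nonneg fun ω => tailSq_nonneg K _).trans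
    (hT (Classical.arbitrary ι))
  have hM0 : 0 ≤ M := (abs_nonneg _).trans (hM (Classical.arbitrary ι))
  have hVi : Integrable (fun ω => pairVar α (fun i => W i ω)) μ :=
    (integrable_finsetSum _ fun i _ => integrable_finsetSum _ fun j _ =>
      (((hL i).sub (hL j)).const_mul (α i - α j)).integrable_sq).const_mul _
  refine norm_sub_exp_le_of_deriv hb (by simp) (fun s => hasDerivAt_integral_exp hSm hS s)
    fun s hs => ?_
  have hen : ∀ ω, ‖Complex.exp (s * S ω * Complex.I)‖ = 1 := fun ω => by
    rw [← Complex.ofReal_mul, Complex.norm_exp_ofReal_mul_I]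
  have hem : Measurable fun ω => Complex.exp (s * S ω * Complex.I) := by fun_prop
  have hei : Integrable (fun ω => Complex.exp (s * S ω * Complex.I)) μ :=
    (integrable_const (1 : ℝ)).mono' hem.aestronglyMeasurable (ae_of_all _ fun ω => (hen ω).le)
  have hVe : Integrable (fun ω => pairVar α (fun i => W i ω) •
      Complex.exp (s * S ω * Complex.I)) μ :=
    hVi.norm.mono' (hVi.aestronglyMeasurable.smul hem.aestronglyMeasurable)
      (ae_of_all _ fun ω => by rw [norm_smul, hen, mul_one])
  -- Replacing the random pair variance by the constant `b` costs `|s| E|V - b|`.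
  have hsplit : Complex.I * (∫ ω, S ω • Complex.exp (s * S ω * Complex.I) ∂μ) +
        b * s * ∫ ω, Complex.exp (s * S ω * Complex.I) ∂μ =
      (Complex.I * (∫ ω, S ω • Complex.exp (s * S ω * Complex.I) ∂μ) +
        s * ∫ ω, pairVar α (fun i => W i ω) • Complex.exp (s * S ω * Complex.I) ∂μ) -
      s * ∫ ω, (pairVar α (fun i => W i ω) - b) • Complex.exp (s * S ω * Complex.I) ∂μ := by
    have hbe : Integrable (fun ω => b • Complex.exp (s * S ω * Complex.I)) μ := hei.smul b
    simp_rw [sub_smul]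
    rw [integral_sub hVe hbe, integral_smul, Complex.real_smul]
    ring
  rw [hsplit]
  refine (norm_sub_le _ _).trans (add_le_add ?_ ?_)
  · refine (norm_linear_charFun_deriv_le h hm hL h1 hK hT hα hM s).trans ?_
    have : s ^ 2 ≤ t ^ 2 := sq_le_sq.2 hs
    have : 0 ≤ ∑ i, α i ^ 2 := Finset.sum_nonneg fun i _ => sq_nonneg _
    gcongr
  · rw [norm_mul, Complex.norm_real, Real.norm_eq_abs]
    gcongr
    refine norm_integral_le_of_norm_le (hVi.sub (integrable_const b)).abs
      (ae_of_all _ fun ω => ?_)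
    rw [norm_smul, hen, mul_one, Real.norm_eq_abs]

end CharFunBound

/-! ### The central limit theorem for exchangeable weights. -/

section ExchangeableCLT

variable {μ : Measure Ω}

/-- A sequence of exchangeable families of weights which satisfies the assumptions of the
exchangeable central limit theorem. -/
structure AsymptoticWeights (μ : Measure Ω) {ι : ℕ → Type*} [∀ k, Fintype (ι k)]
    (W : ∀ k, ι k → Ω → ℝ) : Prop where
  exch : ∀ k, Exchangeable μ (W k)
  meas : ∀ k i, Measurable (W k i)
  memLp : ∀ k i, MemLp (W k i) 2 μ
  card : Tendsto (fun k => (Fintype.card (ι k) : ℝ)) atTop atTop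
  second : ∀ᶠ k in atTop, ∀ i, ∫ ω, W k i ω ^ 2 ∂μ = 1
  mean : Tendsto (fun k => ∫ ω, ((Fintype.card (ι k) : ℝ)⁻¹ * ∑ i, W k i ω) ^ 2 ∂μ) atTop (𝓝 0)
  meanSq : Tendsto (fun k => ∫ ω, |(Fintype.card (ι k) : ℝ)⁻¹ * ∑ i, W k i ω ^ 2 - 1| ∂μ)
    atTop (𝓝 0)
  tail : ∀ δ : ℝ, 0 < δ → ∃ K : ℝ, 0 ≤ K ∧
    ∀ᶠ k in atTop, ∀ i, ∫ ω, tailSq K (W k i ω) ∂μ ≤ δ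

theorem AsymptoticWeights.comp {ι : ℕ → Type*} [∀ k, Fintype (ι k)] {W : ∀ k, ι k → Ω → ℝ}
    (h : AsymptoticWeights μ W) {n : ℕ → ℕ} (hn : Tendsto n atTop atTop) :
    AsymptoticWeights μ (fun k => W (n k)) where
  exch k := h.exch (n k)
  meas k := h.meas (n k)
  memLp k := h.memLp (n k)
  card := h.card.comp hn
  second := hn.eventually h.second
  mean := h.mean.comp hn
  meanSq := h.meanSq.comp hn
  tail δ hδ := by
    obtain ⟨K, hK, h1⟩ := h.tail δ hδ
    exact ⟨K, hK, hn.eventually h1⟩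

variable {ι : ℕ → Type*} [∀ k, Fintype (ι k)] {W : ∀ k, ι k → Ω → ℝ}

theorem AsymptoticWeights.eventually_nonempty (h : AsymptoticWeights μ W) :
    ∀ᶠ k in atTop, Nonempty (ι k) := by
  filter_upwards [h.card.eventually_gt_atTop 0] with k hk
  exact Fintype.card_pos_iff.1 (by exact_mod_cast hk)

variable [IsProbabilityMeasure μ]

/-- The central limit theorem for exchangeable weights, in terms of characteristic functions. -/
theorem AsymptoticWeights.tendsto_charFun (h : AsymptoticWeights μ W) {α : ∀ k, ι k → ℝ}
    {b : ℝ} (hα : ∀ᶠ k in atTop, ∑ i, α k i = 0)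
    (hα2 : Tendsto (fun k => ∑ i, α k i ^ 2) atTop (𝓝 b))
    (hα4 : Tendsto (fun k => ∑ i, α k i ^ 4) atTop (𝓝 0)) (t : ℝ) :
    Tendsto (fun k => ∫ ω, Complex.exp (t * (∑ i, α k i * W k i ω : ℝ) * Complex.I) ∂μ) atTop
      (𝓝 (Complex.exp (-(b * t ^ 2 / 2) : ℝ))) := by
  have hb : 0 ≤ b := ge_of_tendsto' hα2 fun k => Finset.sum_nonneg fun i _ => sq_nonneg _
  rw [tendsto_iff_norm_sub_tendsto_zero, Metric.tendsto_nhds]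
  intro ε hε
  -- This is the limit of the error bound when the truncated second moment is at most `δ`. The order
  -- of choice is `δ`, then the truncation level `K`, then `k → ∞`.
  obtain ⟨δ, hδ, hδε⟩ : ∃ δ : ℝ, 0 < δ ∧ (b * (8 * |t| * δ) + |t| * (2 * b * δ)) * |t| < ε := by
    have hlim : Tendsto (fun δ : ℝ => (b * (8 * |t| * δ) + |t| * (2 * b * δ)) * |t|) (𝓝[>] 0)
        (𝓝 ((b * (8 * |t| * 0) + |t| * (2 * b * 0)) * |t|)) :=
      (Continuous.tendsto (by fun_prop) 0).mono_left nhdsWithin_le_nhds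
    simp only [mul_zero, add_zero, zero_mul] at hlim
    obtain ⟨δ, h1, h2⟩ := ((hlim.eventually_lt_const hε).and self_mem_nhdsWithin).exists
    exact ⟨δ, h2, h1⟩
  obtain ⟨K, hK, htail⟩ := h.tail δ hδ
  have hinv : Tendsto (fun k => (Fintype.card (ι k) : ℝ)⁻¹) atTop (𝓝 0) :=
    tendsto_inv_atTop_zero.comp h.card
  -- The largest coefficient is at most `(∑ α⁴)^{1/4}`, so no separate condition on the maximum is
  -- needed.
  have hM : Tendsto (fun k => √(√(∑ i, α k i ^ 4))) atTop (𝓝 0) := by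
    simpa using hα4.sqrt.sqrt
  have hE : Tendsto (fun k => √(K ^ 4 / 2 * ∑ i, α k i ^ 4) + 2 * (∑ i, α k i ^ 2) * δ +
      (∑ i, α k i ^ 2) * ∫ ω, |(Fintype.card (ι k) : ℝ)⁻¹ * ∑ i, W k i ω ^ 2 - 1| ∂μ +
      |∑ i, α k i ^ 2 - b| +
      (∑ i, α k i ^ 2) * √(∫ ω, ((Fintype.card (ι k) : ℝ)⁻¹ * ∑ i, W k i ω) ^ 2 ∂μ) +
      2 * (∑ i, α k i ^ 2) * (Fintype.card (ι k) : ℝ)⁻¹) atTop (𝓝 (2 * b * δ)) := by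
    have := ((((((hα4.const_mul (K ^ 4 / 2)).sqrt).add ((hα2.const_mul 2).mul_const δ)).add
      (hα2.mul h.meanSq)).add (hα2.sub_const b).abs).add (hα2.mul h.mean.sqrt)).add
      ((hα2.const_mul 2).mul hinv)
    simpa using this
  have hB := ((hα2.mul (((hM.const_mul (16 * K)).mul_const (t ^ 2)).add_const
    (8 * |t| * δ))).add (hE.const_mul |t|)).mul_const |t|
  simp only [mul_zero, zero_mul, zero_add] at hB
  filter_upwards [hB.eventually_lt_const hδε, h.eventually_nonempty, hα, htail, h.second] with
    k hk _ hαk htk h1k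
  rw [dist_zero_right, norm_norm]
  refine lt_of_le_of_lt ?_ hk
  refine (norm_charFun_sub_exp_le (h.exch k) (h.meas k) (h.memLp k) h1k hK htk hαk
    (M := √(√(∑ i, α k i ^ 4))) (fun i => ?_) hb t).trans ?_
  · refine Real.le_sqrt_of_sq_le (Real.le_sqrt_of_sq_le ?_)
    have : (|α k i| ^ 2) ^ 2 = α k i ^ 4 := by rw [sq_abs]; ring
    rw [this]
    exact Finset.single_le_sum (f := fun i => α k i ^ 4) (fun i _ => by positivity)
      (Finset.mem_univ i)
  · have := integral_abs_pairVar_sub_le (h.exch k) (h.meas k) (h.memLp k) h1k htk hαk b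
    gcongr

end ExchangeableCLT

/-! ### From characteristic functions to distribution functions of ratios. -/

section Ratio

variable {μ : Measure Ω} [IsProbabilityMeasure μ]

/-- For `Y ~ N(0, b / a²)`, the event `Y ≤ c` is `a Y - c a ≤ 0`. -/
theorem gaussianReal_Iic_eq {a b : ℝ} (ha : 0 < a) (hb : 0 < b) (c : ℝ) :
    gaussianReal (-(c * a)) b.toNNReal (Set.Iic 0) =
      gaussianReal 0 (b / a ^ 2).toNNReal (Set.Iic c) := by
  have h := gaussianReal_map_const_mul (μ := 0) (v := (b / a ^ 2).toNNReal) a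
  have h2 := gaussianReal_map_add_const (μ := a * 0)
    (v := .mk (a ^ 2) (sq_nonneg a) * (b / a ^ 2).toNNReal) (-(c * a))
  have hv : (.mk (a ^ 2) (sq_nonneg a) * (b / a ^ 2).toNNReal : NNReal) = b.toNNReal := by
    ext
    rw [NNReal.coe_mul, Real.coe_toNNReal _ (by positivity), Real.coe_toNNReal _ hb.le]
    simp only [NNReal.coe_mk]
    field_simp
  rw [← h, hv, mul_zero, zero_add, Measure.map_map (by fun_prop) (by fun_prop)] at h2
  rw [← h2, Measure.map_apply (by fun_prop) measurableSet_Iic]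
  congr 1
  ext x
  simp only [Set.mem_preimage, Function.comp, Set.mem_Iic]
  constructor
  · intro h; nlinarith
  · intro h; nlinarith

/-- Distribution functions of ratios with asymptotically Gaussian numerator and asymptotically
constant denominator. -/
theorem tendsto_measureReal_ratio_le {S A : ℕ → Ω → ℝ} {E : ℕ → Set Ω} {a b c : ℝ} (ha : 0 < a)
    (hb : 0 < b) (hS : ∀ k, Measurable (S k)) (hA : ∀ k, Measurable (A k))
    (hAi : ∀ k, Integrable (A k) μ)
    (hphi : ∀ t : ℝ, Tendsto (fun k => ∫ ω, Complex.exp (t * S k ω * Complex.I) ∂μ) atTop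
      (𝓝 (Complex.exp (-(b * t ^ 2 / 2) : ℝ))))
    (hAa : Tendsto (fun k => ∫ ω, |A k ω - a| ∂μ) atTop (𝓝 0))
    (hE : ∀ᶠ k in atTop, ∀ ω, 0 < A k ω → (ω ∈ E k ↔ S k ω ≤ c * A k ω)) :
    Tendsto (fun k => μ.real (E k)) atTop
      (𝓝 ((gaussianReal 0 (b / a ^ 2).toNNReal).real (Set.Iic c))) := by
  -- For a positive denominator the ratio event is `S - c A ≤ 0`, so convergence in law of one real
  -- variable suffices.
  have hUm : ∀ k, Measurable fun ω => S k ω - c * A k ω := fun k => (hS k).sub ((hA k).const_mul c)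
  let P : ℕ → ProbabilityMeasure ℝ := fun k =>
    ⟨μ.map (fun ω => S k ω - c * A k ω), Measure.isProbabilityMeasure_map (hUm k).aemeasurable⟩
  let G : ProbabilityMeasure ℝ := ⟨gaussianReal (-(c * a)) b.toNNReal, inferInstance⟩
  have hen : ∀ r : ℝ, ‖Complex.exp (r * Complex.I)‖ = 1 := Complex.norm_exp_ofReal_mul_I
  have hei : ∀ {g : Ω → ℝ}, Measurable g →
      Integrable (fun ω => Complex.exp (g ω * Complex.I)) μ := by
    intro g hg
    have : Measurable fun ω => Complex.exp (g ω * Complex.I) := by fun_prop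
    exact (integrable_const (1 : ℝ)).mono' this.aestronglyMeasurable
      (ae_of_all _ fun ω => (hen _).le)
  have hPG : Tendsto P atTop (𝓝 G) := by
    refine ProbabilityMeasure.tendsto_of_tendsto_charFun fun t => ?_
    have hG : charFun (G : Measure ℝ) t =
        Complex.exp ((-(t * c * a) : ℝ) * Complex.I) * Complex.exp (-(b * t ^ 2 / 2) : ℝ) := by
      change charFun (gaussianReal (-(c * a)) b.toNNReal) t = _
      rw [charFun_gaussianReal, ← Complex.exp_add, Real.coe_toNNReal _ hb.le]
      congr 1
      push_cast
      ring
    have hP : ∀ k, charFun (P k : Measure ℝ) t =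
        ∫ ω, Complex.exp ((t * (S k ω - c * A k ω) : ℝ) * Complex.I) ∂μ := by
      intro k
      change charFun (μ.map (fun ω => S k ω - c * A k ω)) t = _
      rw [charFun_apply_real, integral_map (hUm k).aemeasurable (by fun_prop)]
      push_cast
      rfl
    simp_rw [hP, hG]
    -- Replacing `A` by its limit in the exponent costs at most `|t c| E|A - a|`.
    have hdiff : Tendsto (fun k => ∫ ω, Complex.exp ((t * (S k ω - c * A k ω) : ℝ) * Complex.I) ∂μ -
        Complex.exp ((-(t * c * a) : ℝ) * Complex.I) *
          ∫ ω, Complex.exp (t * S k ω * Complex.I) ∂μ) atTop (𝓝 0) := by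
      refine squeeze_zero_norm (a := fun k => |t * c| * ∫ ω, |A k ω - a| ∂μ) (fun k => ?_)
        (by simpa using hAa.const_mul |t * c|)
      rw [← integral_const_mul, ← integral_const_mul,
        ← integral_sub (hei (((hUm k).const_mul t)))
        (by simpa using (hei ((hS k).const_mul t)).const_mul _)]
      refine norm_integral_le_of_norm_le
        (((hAi k).sub (integrable_const a)).abs.const_mul _) (ae_of_all _ fun ω => ?_)
      have hfac : Complex.exp ((t * (S k ω - c * A k ω) : ℝ) * Complex.I) -
          Complex.exp ((-(t * c * a) : ℝ) * Complex.I) * Complex.exp (t * S k ω * Complex.I) =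
          Complex.exp ((t * S k ω - t * c * a : ℝ) * Complex.I) *
            (Complex.exp (Complex.I * (-(t * c * (A k ω - a)) : ℝ)) - 1) := by
        rw [mul_sub (Complex.exp _), ← Complex.exp_add, ← Complex.exp_add, mul_one]
        congr 2 <;> · push_cast; ring
      rw [hfac, norm_mul, hen, one_mul]
      refine Real.norm_exp_I_mul_ofReal_sub_one_le.trans (le_of_eq ?_)
      rw [norm_neg, Real.norm_eq_abs, abs_mul]
    have := hdiff.add ((hphi t).const_mul (Complex.exp ((-(t * c * a) : ℝ) * Complex.I)))
    simpa using this
  have hfr : (G : Measure ℝ) (frontier (Set.Iic 0)) = 0 := by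
    rw [frontier_Iic]
    change gaussianReal (-(c * a)) b.toNNReal {0} = 0
    have : NullSingletonClass (gaussianReal (-(c * a)) b.toNNReal) :=
      nullSingletonClass_gaussianReal (by simpa using hb)
    exact measure_singleton _
  have hmain := ProbabilityMeasure.tendsto_measure_of_null_frontier_of_tendsto' hPG hfr
  have hmain2 : Tendsto (fun k => μ.real {ω | S k ω ≤ c * A k ω}) atTop
      (𝓝 ((gaussianReal 0 (b / a ^ 2).toNNReal).real (Set.Iic c))) := by
    have h3 := (ENNReal.tendsto_toReal (measure_ne_top (G : Measure ℝ) _)).comp hmain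
    have h4 : ((G : Measure ℝ) (Set.Iic 0)).toReal =
        (gaussianReal 0 (b / a ^ 2).toNNReal).real (Set.Iic c) := by
      rw [Measure.real, ← gaussianReal_Iic_eq ha hb]
      rfl
    rw [← h4]
    refine h3.congr fun k => ?_
    simp only [Function.comp, Measure.real]
    change (μ.map (fun ω => S k ω - c * A k ω) (Set.Iic 0)).toReal = _
    rw [Measure.map_apply (hUm k) measurableSet_Iic]
    congr 2
    ext ω
    simp
  have hsmall : Tendsto (fun k => μ.real {ω | A k ω ≤ 0}) atTop (𝓝 0) := by
    refine squeeze_zero (g := fun k => a⁻¹ * ∫ ω, |A k ω - a| ∂μ) (fun k => measureReal_nonneg)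
      (fun k => ?_) (by simpa using hAa.const_mul a⁻¹)
    rw [inv_mul_eq_div, le_div_iff₀ ha, mul_comm]
    refine le_trans (mul_le_mul_of_nonneg_left (measureReal_mono fun ω hω => ?_) ha.le)
      (mul_meas_ge_le_integral_of_nonneg (ae_of_all _ fun ω => abs_nonneg _)
        ((hAi k).sub (integrable_const a)).abs a)
    change A k ω ≤ 0 at hω
    change a ≤ |A k ω - a|
    rw [abs_sub_comm, abs_of_nonneg (by linarith)]
    linarith
  -- The two events can differ only where `A ≤ 0`, which has vanishing probability by Markov's
  -- inequality.
  have hclose : Tendsto (fun k => μ.real (E k) - μ.real {ω | S k ω ≤ c * A k ω}) atTop (𝓝 0) := by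
    refine squeeze_zero_norm' ?_ hsmall
    filter_upwards [hE] with k hk
    have h1 : E k ⊆ {ω | S k ω ≤ c * A k ω} ∪ {ω | A k ω ≤ 0} := fun ω hω => by
      rcases le_or_gt (A k ω) 0 with h | h
      · exact Or.inr h
      · exact Or.inl ((hk ω h).1 hω)
    have h2 : {ω | S k ω ≤ c * A k ω} ⊆ E k ∪ {ω | A k ω ≤ 0} := fun ω hω => by
      rcases le_or_gt (A k ω) 0 with h | h
      · exact Or.inr h
      · exact Or.inl ((hk ω h).2 hω)
    have h3 := (measureReal_mono (μ := μ) h1).trans (measureReal_union_le _ _)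
    have h4 := (measureReal_mono (μ := μ) h2).trans (measureReal_union_le _ _)
    rw [Real.norm_eq_abs, abs_le]
    constructor <;> linarith
  simpa using hclose.add hmain2

end Ratio

/-! ### Verification of the weight conditions. -/

section Weights

variable {μ : Measure Ω} {w : ℕ → ℕ → Ω → ℝ}

/-- The `n`-th row of standardized weights. -/
def stdRow (μ : Measure Ω) (w : ℕ → ℕ → Ω → ℝ) (n : ℕ) (i : Finset.Icc 1 n) : Ω → ℝ :=
  stdWeight μ w n i

theorem card_Icc_one (n : ℕ) : (Fintype.card (Finset.Icc 1 n) : ℝ) = n := by simp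

theorem sum_Icc_coe (n : ℕ) (f : ℕ → ℝ) :
    ∑ i : Finset.Icc 1 n, f i = ∑ i ∈ Finset.Icc 1 n, f i := Finset.sum_coe_sort _ f

theorem WeightConditions.exchangeable_stdRow (hw : WeightConditions μ w) (n : ℕ) :
    Exchangeable μ (stdRow μ w n) := by
  have h : Exchangeable μ (fun (i : Finset.Icc 1 n) ω => w n i ω) := hw.array.exchangeable n
  exact h.comp (φ := fun x => (weightSD μ w n)⁻¹ * (x - 1)) (by fun_prop)

theorem WeightConditions.measurable_stdRow (hw : WeightConditions μ w) (n : ℕ)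
    (i : Finset.Icc 1 n) : Measurable (stdRow μ w n i) :=
  ((hw.array.measurable n i i.2).sub_const 1).const_mul _

theorem WeightConditions.eventually_weightSD_pos (hw : WeightConditions μ w) :
    ∀ᶠ n in atTop, 0 < weightSD μ w n := by
  obtain ⟨k, hk, h⟩ := hw.A2_lower
  filter_upwards [h] with n hn
  have h0 : 0 ≤ weightSD μ w n := Real.sqrt_nonneg _
  rcases h0.eq_or_lt with h1 | h1
  · rw [← h1] at hn; norm_num at hn; linarith
  · exact h1

variable [IsProbabilityMeasure μ]

theorem WeightConditions.memLp_stdRow (hw : WeightConditions μ w) (n : ℕ)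
    (i : Finset.Icc 1 n) : MemLp (stdRow μ w n i) 2 μ :=
  ((hw.array.memLp_two n i i.2).sub (memLp_const 1)).const_mul _

/-- Scheffé's lemma for nonnegative functions of mean one which converge to one in measure. -/
theorem tendsto_integral_abs_sub_one {m : ℕ → Ω → ℝ} (hm : ∀ n, Integrable (m n) μ)
    (hmeas : ∀ n, Measurable (m n)) (h0 : ∀ n ω, 0 ≤ m n ω)
    (h1 : ∀ᶠ n in atTop, ∫ ω, m n ω ∂μ = 1)
    (hlim : TendstoInMeasure μ m atTop fun _ => 1) :
    Tendsto (fun n => ∫ ω, |m n ω - 1| ∂μ) atTop (𝓝 0) := by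
  rw [Metric.tendsto_nhds]
  intro ε hε
  have hset := (tendstoInMeasure_iff_measureReal_norm.1 hlim) (ε / 4) (by positivity)
  filter_upwards [h1, hset.eventually_lt_const (show (0 : ℝ) < ε / 4 by positivity)] with n hn hs
  have hB : MeasurableSet {ω | ε / 4 ≤ ‖m n ω - 1‖} :=
    measurableSet_le measurable_const ((hmeas n).sub_const 1).norm
  -- Write `|m - 1|` as `m - 1` plus twice the negative part. The first term integrates to zero;
  -- since `m ≥ 0`, the negative part is at most `1`, and below `ε / 4` off the exceptional set.
  have hle : ∀ ω, |m n ω - 1| ≤ (m n ω - 1) + 2 * (ε / 4 +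
      Set.indicator {ω | ε / 4 ≤ ‖m n ω - 1‖} (fun _ => (1 : ℝ)) ω) := by
    intro ω
    have := h0 n ω
    by_cases h : ω ∈ {ω | ε / 4 ≤ ‖m n ω - 1‖}
    · rw [Set.indicator_of_mem h, abs_le]
      constructor <;> linarith
    · rw [Set.indicator_of_notMem h]
      replace h : |m n ω - 1| < ε / 4 := by simpa using h
      have := abs_lt.1 h
      rw [abs_le]
      constructor <;> linarith
  have hI1 : Integrable (fun ω => m n ω - 1) μ := (hm n).sub (integrable_const 1)
  have hI2 : Integrable (Set.indicator {ω | ε / 4 ≤ ‖m n ω - 1‖} fun _ => (1 : ℝ)) μ :=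
    (integrable_const 1).indicator hB
  have hI3 := ((integrable_const (μ := μ) (ε / 4)).add hI2).const_mul 2
  have hint := integral_mono hI1.abs (hI1.add hI3) hle
  simp only [Pi.add_apply] at hint
  rw [integral_add hI1 (by simpa using hI3), integral_const_mul,
    integral_add (integrable_const _) hI2,
    integral_sub (hm n) (integrable_const 1), hn, integral_indicator_const _ hB] at hint
  simp only [integral_const, probReal_univ, smul_eq_mul, one_mul, sub_self, zero_add,
    mul_one] at hint
  rw [Real.dist_eq, sub_zero, abs_of_nonneg (integral_nonneg fun ω => abs_nonneg _)]
  linarith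

/-- The second moment of the mean standardized weight is negligible, even after multiplication
by the variance of the weights. -/
theorem WeightConditions.tendsto_sq_mul_mean (hw : WeightConditions μ w) :
    Tendsto (fun n : ℕ => weightSD μ w n ^ 2 *
      ∫ ω, ((Fintype.card (Finset.Icc 1 n) : ℝ)⁻¹ * ∑ i, stdRow μ w n i ω) ^ 2 ∂μ)
      atTop (𝓝 0) := by
  have hcov : Tendsto (fun n : ℕ => cov[w n 1, w n 2; μ]) atTop (𝓝 0) :=
    hw.A3.trans_tendsto tendsto_inv_atTop_nhds_zero_nat
  have hsig : Tendsto (fun n : ℕ => weightSD μ w n ^ 2 / n) atTop (𝓝 0) :=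
    hw.A2_upper.tendsto_div_nhds_zero
  have hsum : Tendsto (fun n : ℕ => weightSD μ w n ^ 2 / n + |cov[w n 1, w n 2; μ]|) atTop
      (𝓝 0) := by simpa using hsig.add hcov.abs
  refine squeeze_zero' (Eventually.of_forall fun n => mul_nonneg (sq_nonneg _)
    (integral_nonneg fun ω => sq_nonneg _)) ?_ hsum
  filter_upwards [hw.eventually_weightSD_pos, hw.A4.mean_zero, hw.A4.second_moment,
    eventually_ge_atTop 2] with n hpos hmean hsec hn
  have m1 : 1 ∈ Finset.Icc 1 n := Finset.mem_Icc.2 ⟨le_rfl, by omega⟩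
  have m2 : 2 ∈ Finset.Icc 1 n := Finset.mem_Icc.2 ⟨by omega, hn⟩
  have : Nonempty (Finset.Icc 1 n) := ⟨⟨1, m1⟩⟩
  have hb := (hw.exchangeable_stdRow n).integral_mean_sq_le (hw.memLp_stdRow n)
    (fun i => hsec i i.2) (k := ⟨1, m1⟩) (l := ⟨2, m2⟩) (by simp)
  have hc : ∫ ω, stdRow μ w n ⟨1, m1⟩ ω * stdRow μ w n ⟨2, m2⟩ ω ∂μ =
      (weightSD μ w n ^ 2)⁻¹ * cov[w n 1, w n 2; μ] := by
    have e1 := covariance_eq_sub (hw.memLp_stdRow n ⟨1, m1⟩) (hw.memLp_stdRow n ⟨2, m2⟩)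
    have z1 : ∫ ω, stdRow μ w n ⟨1, m1⟩ ω ∂μ = 0 := hmean 1 m1
    rw [z1, zero_mul, sub_zero] at e1
    have e2 : cov[stdRow μ w n ⟨1, m1⟩, stdRow μ w n ⟨2, m2⟩; μ] =
        (weightSD μ w n)⁻¹ * ((weightSD μ w n)⁻¹ * cov[w n 1, w n 2; μ]) := by
      change cov[fun ω => (weightSD μ w n)⁻¹ * (w n 1 ω - 1),
        fun ω => (weightSD μ w n)⁻¹ * (w n 2 ω - 1); μ] = _
      rw [covariance_const_mul_left, covariance_const_mul_right,
        covariance_sub_const_left ((hw.array.memLp_two n 1 m1).integrable one_le_two),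
        covariance_sub_const_right ((hw.array.memLp_two n 2 m2).integrable one_le_two)]
    change μ[stdRow μ w n ⟨1, m1⟩ * stdRow μ w n ⟨2, m2⟩] = _
    rw [← e1, e2, ← mul_assoc, sq, mul_inv]
  rw [hc, card_Icc_one, abs_mul, abs_of_pos (by positivity)] at hb
  rw [card_Icc_one]
  -- Multiplication by the variance turns the covariance of standardized weights back into that of
  -- the original weights, and leaves `σ_n² / n + |cov|`.
  calc _ ≤ weightSD μ w n ^ 2 * ((n : ℝ)⁻¹ + (weightSD μ w n ^ 2)⁻¹ * |cov[w n 1, w n 2; μ]|) := by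
        gcongr
    _ = _ := by field_simp

theorem WeightConditions.asymptoticWeights (hw : WeightConditions μ w) :
    AsymptoticWeights μ (stdRow μ w) where
  exch := hw.exchangeable_stdRow
  meas := hw.measurable_stdRow
  memLp := hw.memLp_stdRow
  card := by
    simp_rw [card_Icc_one]
    exact tendsto_natCast_atTop_atTop
  second := by
    filter_upwards [hw.A4.second_moment] with n hn i
    exact hn i i.2
  mean := by
    -- As the variances stay above `k`, the factor `σ_n²` in `tendsto_sq_mul_mean` can be dropped.
    obtain ⟨k, hk, h⟩ := hw.A2_lower
    refine squeeze_zero' (Eventually.of_forall fun n => integral_nonneg fun ω => sq_nonneg _) ?_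
      (mul_zero k⁻¹ ▸ hw.tendsto_sq_mul_mean.const_mul k⁻¹)
    filter_upwards [h] with n hn
    rw [← mul_assoc]
    refine le_mul_of_one_le_left (integral_nonneg fun ω => sq_nonneg _) ?_
    rw [inv_mul_eq_div, one_le_div hk]
    exact hn.le
  meanSq := by
    have hsum : ∀ (n : ℕ) ω, (1 / (n : ℝ)) * ∑ j ∈ Finset.Icc 1 n, stdWeight μ w n j ω ^ 2 =
        (Fintype.card (Finset.Icc 1 n) : ℝ)⁻¹ * ∑ i, stdRow μ w n i ω ^ 2 := fun n ω => by
      rw [card_Icc_one, one_div]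
      congr 1
      exact (sum_Icc_coe n fun j => stdWeight μ w n j ω ^ 2).symm
    have hlim := hw.A4.mean_sq
    simp_rw [hsum] at hlim
    refine tendsto_integral_abs_sub_one (fun n => ?_) (fun n => ?_) (fun n ω => ?_)
      ?_ hlim
    · exact (integrable_finsetSum _ fun i _ => (hw.memLp_stdRow n i).integrable_sq).const_mul _
    · have := hw.measurable_stdRow n
      fun_prop
    · exact mul_nonneg (by positivity) (Finset.sum_nonneg fun i _ => sq_nonneg _)
    · filter_upwards [hw.A4.second_moment, eventually_ge_atTop 1] with n hn h1
      rw [integral_const_mul, integral_finsetSum _ fun i _ => (hw.memLp_stdRow n i).integrable_sq]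
      have : ∀ i, ∫ ω, stdRow μ w n i ω ^ 2 ∂μ = 1 := fun i => hn i i.2
      simp_rw [this]
      have h0 : (n : ℝ) ≠ 0 := by positivity
      simp [h0]
  tail δ hδ := by
    set g : ℝ → ℕ → ℝ := fun K n => √(∫ ω in {ω | K < |stdWeight μ w n 1 ω|},
      stdWeight μ w n 1 ω ^ 2 ∂μ) with hg
    have hev := (hw.A4.tail.eventually_lt_const (Real.sqrt_pos.2 hδ)).and (eventually_ge_atTop 0)
    obtain ⟨K, hK, hK0⟩ := hev.exists
    refine ⟨K, hK0, ?_⟩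
    -- A real `limsup` bounds the eventual values only if the sequence is bounded above; the unit
    -- second moments ensure this.
    have hbdd : IsBoundedUnder (· ≤ ·) atTop (g K) := by
      refine ⟨1, ?_⟩
      rw [eventually_map]
      filter_upwards [hw.A4.second_moment, eventually_ge_atTop 1] with n hn h1
      have m1 : 1 ∈ Finset.Icc 1 n := Finset.mem_Icc.2 ⟨le_rfl, h1⟩
      simp only [hg]
      rw [Real.sqrt_le_one, ← hn 1 m1]
      exact setIntegral_le_integral (hw.memLp_stdRow n ⟨1, m1⟩).integrable_sq
        (ae_of_all _ fun ω => sq_nonneg _)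
    filter_upwards [eventually_lt_of_limsup_lt hK hbdd, eventually_ge_atTop 1] with n hn h1 i
    have m1 : 1 ∈ Finset.Icc 1 n := Finset.mem_Icc.2 ⟨le_rfl, h1⟩
    rw [(hw.exchangeable_stdRow n).integral_single_eq i ⟨1, m1⟩ (measurable_tailSq K)]
    have hmeas : MeasurableSet {ω | K < |stdWeight μ w n 1 ω|} :=
      measurableSet_lt measurable_const (hw.measurable_stdRow n ⟨1, m1⟩).abs
    have heq : ∫ ω, tailSq K (stdRow μ w n ⟨1, m1⟩ ω) ∂μ =
        ∫ ω in {ω | K < |stdWeight μ w n 1 ω|}, stdWeight μ w n 1 ω ^ 2 ∂μ := by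
      rw [← integral_indicator hmeas]
      congr 1
    rw [heq]
    exact ((Real.sqrt_lt_sqrt_iff_of_pos hδ).1 hn).le

end Weights

/-! ### The bootstrap root along a fixed path. -/

section FixedPath

/-- The least squares estimator of a real path. -/
def pathLse (x : ℕ → ℝ) (n : ℕ) : ℝ :=
  (∑ t ∈ Finset.Icc 2 n, x t * x (t - 1)) / ∑ t ∈ Finset.Icc 2 n, x (t - 1) ^ 2

/-- The summands `X_{t-1} (X_t - θ̂_n X_{t-1}) / √n` of the normalized score, indexed by
`1 ≤ t ≤ n`, with a zero summand at `t = 1`. -/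
def pathScore (x : ℕ → ℝ) (n t : ℕ) : ℝ :=
  if 2 ≤ t then x (t - 1) * (x t - pathLse x n * x (t - 1)) / √n else 0

/-- The squares `X_{t-1} ^ 2`, indexed by `1 ≤ t ≤ n`, with a zero at `t = 1`. -/
def pathSq (x : ℕ → ℝ) (t : ℕ) : ℝ := if 2 ≤ t then x (t - 1) ^ 2 else 0

theorem sum_Icc_one_eq_sum_Icc_two (n : ℕ) {f g : ℕ → ℝ} (h0 : ∀ t, t < 2 → f t = 0)
    (h : ∀ t, 2 ≤ t → f t = g t) :
    ∑ i : Finset.Icc 1 n, f i = ∑ t ∈ Finset.Icc 2 n, g t := by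
  rw [sum_Icc_coe]
  symm
  refine (Finset.sum_congr rfl fun t ht => (h t (Finset.mem_Icc.1 ht).1).symm).trans ?_
  refine Finset.sum_subset (Finset.Icc_subset_Icc_left one_le_two) fun t _ ht2 => h0 t ?_
  by_contra hlt
  simp only [Finset.mem_Icc, not_and, not_le] at *
  omega

/-- These are the normal equations of least squares. If the denominator of `pathLse` vanishes, every
`x (t - 1)` in the range is zero and so is each summand. -/
theorem sum_pathScore (x : ℕ → ℝ) (n : ℕ) : ∑ i : Finset.Icc 1 n, pathScore x n i = 0 := by
  rw [sum_Icc_one_eq_sum_Icc_two n (f := pathScore x n)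
    (g := fun t => (x t * x (t - 1) - pathLse x n * x (t - 1) ^ 2) / √n)
    (fun t ht => by simp [pathScore, not_le.2 ht]) (fun t ht => by simp [pathScore, ht]; ring),
    ← Finset.sum_div, Finset.sum_sub_distrib, ← Finset.mul_sum]
  by_cases hD : ∑ t ∈ Finset.Icc 2 n, x (t - 1) ^ 2 = 0
  · have hx := (Finset.sum_eq_zero_iff_of_nonneg fun t _ => sq_nonneg (x (t - 1))).1 hD
    rw [hD, Finset.sum_eq_zero fun t ht => by rw [pow_eq_zero_iff two_ne_zero |>.1 (hx t ht),
      mul_zero]]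
    simp
  · rw [pathLse, div_mul_cancel₀ _ hD]
    simp

variable {μ : Measure Ω}

/-- The normalized bootstrap root as a ratio of linear statistics of the weights. -/
theorem root_eq_div {w : ℕ → ℕ → Ω → ℝ} (x : ℕ → ℝ) {n : ℕ} (hn : 0 < n)
    (hσ : 0 < weightSD μ w n) {ω : Ω}
    (hA : 0 < (n : ℝ)⁻¹ * ∑ t ∈ Finset.Icc 2 n, w n t ω * x (t - 1) ^ 2) :
    √(n : ℝ) * (weightSD μ w n)⁻¹ * (wbLse w (fun t _ => x t) n ω - lse (fun t _ => x t) n ω) =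
      (∑ i : Finset.Icc 1 n, pathScore x n i * stdRow μ w n i ω) /
        ((n : ℝ)⁻¹ * ∑ t ∈ Finset.Icc 2 n, w n t ω * x (t - 1) ^ 2) := by
  have hn' : (0 : ℝ) < n := by exact_mod_cast hn
  have hsn : 0 < √(n : ℝ) := Real.sqrt_pos.2 hn'
  have hss : √(n : ℝ) * √(n : ℝ) = n := Real.mul_self_sqrt hn'.le
  set D := ∑ t ∈ Finset.Icc 2 n, w n t ω * x (t - 1) ^ 2 with hD
  have hDpos : 0 < D := by
    by_contra h
    exact absurd hA (not_lt.2 (mul_nonpos_of_nonneg_of_nonpos (by positivity) (not_lt.1 h)))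
  have hlse : lse (fun t (_ : Ω) => x t) n ω = pathLse x n := rfl
  have hwb : wbLse w (fun t _ => x t) n ω =
      (∑ t ∈ Finset.Icc 2 n, w n t ω * x t * x (t - 1)) / D := rfl
  have hzero := sum_pathScore x n
  have hS : ∑ i : Finset.Icc 1 n, pathScore x n i * stdRow μ w n i ω =
      (weightSD μ w n)⁻¹ * (√(n : ℝ))⁻¹ * ((∑ t ∈ Finset.Icc 2 n, w n t ω * x t * x (t - 1)) -
        pathLse x n * D) := by
    -- Since the scores sum to zero, the centring of the weights drops out.
    have h1 : ∑ i : Finset.Icc 1 n, pathScore x n i * stdRow μ w n i ω =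
        (weightSD μ w n)⁻¹ * ∑ i : Finset.Icc 1 n, pathScore x n i * w n i ω := by
      have : ∀ i : Finset.Icc 1 n, pathScore x n i * stdRow μ w n i ω =
          (weightSD μ w n)⁻¹ * (pathScore x n i * w n i ω) -
          (weightSD μ w n)⁻¹ * pathScore x n i := fun i => by
        rw [stdRow, stdWeight]; ring
      simp_rw [this]
      rw [Finset.sum_sub_distrib, ← Finset.mul_sum, ← Finset.mul_sum, hzero, mul_zero, sub_zero]
    rw [h1, sum_Icc_one_eq_sum_Icc_two n (f := fun t => pathScore x n t * w n t ω)
      (g := fun t => (√(n : ℝ))⁻¹ * (w n t ω * x t * x (t - 1) -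
        pathLse x n * (w n t ω * x (t - 1) ^ 2)))
      (fun t ht => by simp [pathScore, not_le.2 ht])
      (fun t ht => by simp only [pathScore, ht, if_true]; ring),
      ← Finset.mul_sum, Finset.sum_sub_distrib, ← Finset.mul_sum, mul_assoc]
  rw [hS, hlse, hwb, div_sub' hDpos.ne']
  generalize ∑ t ∈ Finset.Icc 2 n, w n t ω * x t * x (t - 1) = N
  rw [mul_div_assoc', div_eq_div_iff hDpos.ne' hA.ne']
  field_simp
  linear_combination (N - D * pathLse x n) * (hss)

/-- The coefficients split into a zero-sum part, covered by `integral_linear_sq_le`, and a constant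
part that multiplies the mean weight. -/
theorem Exchangeable.integral_linear_sq_le_add {ι : Type*} [Fintype ι] [Nonempty ι]
    {W : ι → Ω → ℝ} (h : Exchangeable μ W)
    (hL : ∀ i, MemLp (W i) 2 μ) (h1 : ∀ i, ∫ ω, W i ω ^ 2 ∂μ = 1) (y : ι → ℝ) :
    ∫ ω, (∑ i, y i * W i ω) ^ 2 ∂μ ≤ 4 * ∑ i, y i ^ 2 +
      2 * (∑ i, y i) ^ 2 * ∫ ω, ((Fintype.card ι : ℝ)⁻¹ * ∑ i, W i ω) ^ 2 ∂μ := by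
  have hn : (0 : ℝ) < Fintype.card ι := by exact_mod_cast Fintype.card_pos
  set N : ℝ := (Fintype.card ι : ℝ)⁻¹ with hN
  set q : ι → ℝ := fun i => y i - N * ∑ j, y j with hq
  have hqs : ∑ i, q i = 0 := by
    simp [hq, Finset.sum_sub_distrib, hN]
  have hq2 : ∑ i, q i ^ 2 ≤ ∑ i, y i ^ 2 := by
    have : ∀ i, q i ^ 2 = y i ^ 2 - (2 * N * ∑ j, y j) * y i + (N * ∑ j, y j) ^ 2 := fun i => by
      simp only [hq]; ring
    simp_rw [this, Finset.sum_add_distrib, Finset.sum_sub_distrib, ← Finset.mul_sum]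
    simp only [Finset.sum_const, Finset.card_univ, nsmul_eq_mul]
    have h3 : (Fintype.card ι : ℝ) * (N * ∑ j, y j) ^ 2 = N * (∑ j, y j) ^ 2 := by
      rw [hN]; field_simp
    rw [h3]
    have : 0 ≤ N * (∑ j, y j) ^ 2 := by positivity
    linarith
  have hS : MemLp (fun ω => ∑ i, q i * W i ω) 2 μ :=
    memLp_finsetSum _ fun k _ => (hL k).const_mul _
  have hY : MemLp (fun ω => ∑ i, y i * W i ω) 2 μ :=
    memLp_finsetSum _ fun k _ => (hL k).const_mul _
  have hB : MemLp (fun ω => N * ∑ k, W k ω) 2 μ :=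
    (memLp_finsetSum _ fun k _ => hL k).const_mul _
  have hS2 : ∫ ω, (∑ i, q i * W i ω) ^ 2 ∂μ ≤ 4 / 2 * ∑ i, q i ^ 2 :=
    h.integral_linear_sq_le hL hqs fun i j => by
      refine (integral_sub_sq_le (hL i) (hL j)).trans ?_
      rw [h1, h1]; norm_num
  calc ∫ ω, (∑ i, y i * W i ω) ^ 2 ∂μ
      ≤ ∫ ω, (2 * (∑ i, q i * W i ω) ^ 2 + 2 * (∑ i, y i) ^ 2 * (N * ∑ i, W i ω) ^ 2) ∂μ := by
        refine integral_mono hY.integrable_sq ((hS.integrable_sq.const_mul _).add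
          (hB.integrable_sq.const_mul _)) fun ω => ?_
        have : ∑ i, y i * W i ω = ∑ i, q i * W i ω + (∑ j, y j) * (N * ∑ i, W i ω) := by
          simp only [hq, sub_mul, Finset.sum_sub_distrib, ← Finset.mul_sum]
          ring
        simp only [this]
        nlinarith [sq_nonneg (∑ i, q i * W i ω - (∑ j, y j) * (N * ∑ i, W i ω))]
    _ = 2 * ∫ ω, (∑ i, q i * W i ω) ^ 2 ∂μ +
        2 * (∑ i, y i) ^ 2 * ∫ ω, (N * ∑ i, W i ω) ^ 2 ∂μ := by
        rw [integral_add (hS.integrable_sq.const_mul _) (hB.integrable_sq.const_mul _),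
          integral_const_mul, integral_const_mul]
    _ ≤ _ := add_le_add (by linarith) le_rfl

variable [IsProbabilityMeasure μ]

/-- The bootstrap denominator concentrates around the data denominator. -/
theorem WeightConditions.integral_abs_denominator_sub_le {w : ℕ → ℕ → Ω → ℝ}
    (hw : WeightConditions μ w) (x : ℕ → ℝ) (a : ℝ) {n : ℕ} (hn : 0 < n)
    (hσ : 0 < weightSD μ w n) (hsec : ∀ j ∈ Finset.Icc 1 n, ∫ ω, stdWeight μ w n j ω ^ 2 ∂μ = 1) :
    ∫ ω, |(n : ℝ)⁻¹ * ∑ t ∈ Finset.Icc 2 n, w n t ω * x (t - 1) ^ 2 - a| ∂μ ≤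
      |(n : ℝ)⁻¹ * ∑ t ∈ Finset.Icc 2 n, x (t - 1) ^ 2 - a| +
      √(4 * (weightSD μ w n ^ 2 / n * ((n : ℝ)⁻¹ * ∑ t ∈ Finset.Icc 2 n, x (t - 1) ^ 4)) +
        2 * ((n : ℝ)⁻¹ * ∑ t ∈ Finset.Icc 2 n, x (t - 1) ^ 2) ^ 2 * (weightSD μ w n ^ 2 *
          ∫ ω, ((Fintype.card (Finset.Icc 1 n) : ℝ)⁻¹ * ∑ i, stdRow μ w n i ω) ^ 2 ∂μ)) := by
  have hn' : (0 : ℝ) < n := by exact_mod_cast hn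
  have : Nonempty (Finset.Icc 1 n) := ⟨⟨1, Finset.mem_Icc.2 ⟨le_rfl, hn⟩⟩⟩
  set σ := weightSD μ w n with hσdef
  have hLin := (hw.exchangeable_stdRow n).integral_linear_sq_le_add (hw.memLp_stdRow n)
    (fun i => hsec i i.2) fun i : Finset.Icc 1 n => pathSq x i
  have hy1 : ∑ i : Finset.Icc 1 n, pathSq x i = ∑ t ∈ Finset.Icc 2 n, x (t - 1) ^ 2 :=
    sum_Icc_one_eq_sum_Icc_two n (fun t ht => by simp [pathSq, not_le.2 ht])
      fun t ht => by simp [pathSq, ht]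
  have hy2 : ∑ i : Finset.Icc 1 n, pathSq x i ^ 2 = ∑ t ∈ Finset.Icc 2 n, x (t - 1) ^ 4 :=
    sum_Icc_one_eq_sum_Icc_two n (f := fun t => pathSq x t ^ 2)
      (fun t ht => by simp [pathSq, not_le.2 ht])
      fun t ht => by simp [pathSq, ht]; ring
  rw [hy1, hy2] at hLin
  have hY : MemLp (fun ω => σ * (n : ℝ)⁻¹ * ∑ i : Finset.Icc 1 n, pathSq x i * stdRow μ w n i ω)
      2 μ := (memLp_finsetSum _ fun k _ => (hw.memLp_stdRow n k).const_mul _).const_mul _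
  -- With `w = 1 + σ W`, the denominator is the data average plus a linear statistic of the
  -- standardized weights.
  have hsum : ∀ ω, (n : ℝ)⁻¹ * ∑ t ∈ Finset.Icc 2 n, w n t ω * x (t - 1) ^ 2 - a =
      ((n : ℝ)⁻¹ * ∑ t ∈ Finset.Icc 2 n, x (t - 1) ^ 2 - a) +
        σ * (n : ℝ)⁻¹ * ∑ i : Finset.Icc 1 n, pathSq x i * stdRow μ w n i ω := by
    intro ω
    simp only [stdRow]
    rw [sum_Icc_one_eq_sum_Icc_two n (f := fun t => pathSq x t * stdWeight μ w n t ω)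
      (g := fun t => σ⁻¹ * (w n t ω * x (t - 1) ^ 2 - x (t - 1) ^ 2))
      (fun t ht => by simp [pathSq, not_le.2 ht])
      (fun t ht => by simp only [pathSq, ht, if_true, stdWeight, ← hσdef]; ring),
      ← Finset.mul_sum, Finset.sum_sub_distrib]
    field_simp
    ring
  calc _ ≤ ∫ ω, (|(n : ℝ)⁻¹ * ∑ t ∈ Finset.Icc 2 n, x (t - 1) ^ 2 - a| +
        |σ * (n : ℝ)⁻¹ * ∑ i : Finset.Icc 1 n, pathSq x i * stdRow μ w n i ω|) ∂μ := by
        refine integral_mono_of_nonneg (ae_of_all _ fun ω => abs_nonneg _)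
          ((integrable_const _).add (hY.integrable one_le_two).abs) (ae_of_all _ fun ω => ?_)
        simp only [hsum]
        exact abs_add_le _ _
    _ = |(n : ℝ)⁻¹ * ∑ t ∈ Finset.Icc 2 n, x (t - 1) ^ 2 - a| +
        ∫ ω, |σ * (n : ℝ)⁻¹ * ∑ i : Finset.Icc 1 n, pathSq x i * stdRow μ w n i ω| ∂μ := by
        rw [integral_add (integrable_const _) (hY.integrable one_le_two).abs]
        simp
    _ ≤ _ := by
        gcongr
        refine (integral_abs_le_sqrt hY).trans (Real.sqrt_le_sqrt ?_)
        simp_rw [mul_pow _ (∑ i : Finset.Icc 1 n, pathSq x i * stdRow μ w n i _)]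
        rw [integral_const_mul]
        refine (mul_le_mul_of_nonneg_left hLin (sq_nonneg _)).trans (le_of_eq ?_)
        field_simp

/-- The conditional limit theorem for the weighted bootstrap given a fixed path, along a sequence
of sample sizes. -/
theorem WeightConditions.tendsto_measureReal_root_le {w : ℕ → ℕ → Ω → ℝ}
    (hw : WeightConditions μ w) {x : ℕ → ℝ} {n : ℕ → ℕ} (hn : Tendsto n atTop atTop) {a b : ℝ}
    (ha : 0 < a) (hb : 0 < b)
    (h2 : Tendsto (fun k => (n k : ℝ)⁻¹ * ∑ t ∈ Finset.Icc 2 (n k), x (t - 1) ^ 2) atTop (𝓝 a))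
    (h4 : Tendsto (fun k => weightSD μ w (n k) ^ 2 / n k *
      ((n k : ℝ)⁻¹ * ∑ t ∈ Finset.Icc 2 (n k), x (t - 1) ^ 4)) atTop (𝓝 0))
    (hs2 : Tendsto (fun k => ∑ i : Finset.Icc 1 (n k), pathScore x (n k) i ^ 2) atTop (𝓝 b))
    (hs4 : Tendsto (fun k => ∑ i : Finset.Icc 1 (n k), pathScore x (n k) i ^ 4) atTop (𝓝 0))
    (c : ℝ) :
    Tendsto (fun k => μ.real {ω | √(n k : ℝ) * (weightSD μ w (n k))⁻¹ *
        (wbLse w (fun t _ => x t) (n k) ω - lse (fun t _ => x t) (n k) ω) ≤ c}) atTop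
      (𝓝 ((gaussianReal 0 (b / a ^ 2).toNNReal).real (Set.Iic c))) := by
  have hLp : ∀ m, ∀ t ∈ Finset.Icc 2 m, MemLp (w m t) 2 μ := fun m t ht =>
    hw.array.memLp_two m t (Finset.Icc_subset_Icc_left one_le_two ht)
  refine tendsto_measureReal_ratio_le
    (S := fun k ω => ∑ i : Finset.Icc 1 (n k), pathScore x (n k) i * stdRow μ w (n k) i ω)
    (A := fun k ω => (n k : ℝ)⁻¹ * ∑ t ∈ Finset.Icc 2 (n k), w (n k) t ω * x (t - 1) ^ 2)
    ha hb (fun k => ?_) (fun k => ?_) (fun k => ?_)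
    ((hw.asymptoticWeights.comp hn).tendsto_charFun
      (α := fun k (i : Finset.Icc 1 (n k)) => pathScore x (n k) i)
      (Eventually.of_forall fun k => sum_pathScore x (n k)) hs2 hs4) ?_ ?_
  · have := hw.measurable_stdRow (n k)
    fun_prop
  · refine (Finset.measurable_fun_sum _ fun t ht => ?_).const_mul _
    exact (hw.array.measurable _ t (Finset.Icc_subset_Icc_left one_le_two ht)).mul_const _
  · exact (integrable_finsetSum _ fun t ht =>
      ((hLp _ t ht).integrable one_le_two).mul_const _).const_mul _
  · have hm := hw.tendsto_sq_mul_mean.comp hn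
    have hlim := (h2.sub_const a).abs.add
      (((h4.const_mul 4).add (((h2.pow 2).const_mul 2).mul hm)).sqrt)
    simp only [sub_self, abs_zero, mul_zero, add_zero, Real.sqrt_zero] at hlim
    refine squeeze_zero' (Eventually.of_forall fun k => integral_nonneg fun ω => abs_nonneg _)
      ?_ hlim
    filter_upwards [hn.eventually hw.eventually_weightSD_pos,
      hn.eventually hw.A4.second_moment, hn.eventually_gt_atTop 0] with k hσ hsec hk
    exact hw.integral_abs_denominator_sub_le x a hk hσ hsec
  · filter_upwards [hn.eventually hw.eventually_weightSD_pos, hn.eventually_gt_atTop 0] with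
      k hσ hk ω hA
    rw [root_eq_div x hk hσ hA, div_le_iff₀ hA]

end FixedPath

/-! ### Sums of powers of the scores. -/

section PathScore

/-- The residual is the error `x_t - θ x_{t-1}` minus `(θ̂ - θ) x_{t-1}`; the square is expanded in
`θ̂ - θ`. -/
theorem sum_pathScore_sq (x : ℕ → ℝ) (θ : ℝ) (n : ℕ) :
    ∑ i : Finset.Icc 1 n, pathScore x n i ^ 2 =
      (n : ℝ)⁻¹ * ∑ t ∈ Finset.Icc 2 n, x (t - 1) ^ 2 * (x t - θ * x (t - 1)) ^ 2 -
      2 * ((pathLse x n - θ) *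
        ((n : ℝ)⁻¹ * ∑ t ∈ Finset.Icc 2 n, x (t - 1) ^ 3 * (x t - θ * x (t - 1)))) +
      (pathLse x n - θ) ^ 2 * ((n : ℝ)⁻¹ * ∑ t ∈ Finset.Icc 2 n, x (t - 1) ^ 4) := by
  have hs : √(n : ℝ) ^ 2 = n := Real.sq_sqrt n.cast_nonneg
  rw [sum_Icc_one_eq_sum_Icc_two n (f := fun t => pathScore x n t ^ 2)
    (g := fun t => (n : ℝ)⁻¹ * (x (t - 1) ^ 2 * (x t - θ * x (t - 1)) ^ 2 -
      2 * (pathLse x n - θ) * (x (t - 1) ^ 3 * (x t - θ * x (t - 1))) +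
      (pathLse x n - θ) ^ 2 * x (t - 1) ^ 4))
    (fun t ht => by simp [pathScore, not_le.2 ht])
    (fun t ht => by simp only [pathScore, ht, if_true, div_pow, hs]; ring),
    ← Finset.mul_sum, Finset.sum_add_distrib, Finset.sum_sub_distrib, ← Finset.mul_sum,
    ← Finset.mul_sum]
  ring

/-- The eighth powers of the path are bounded through `∑ y² ≤ (∑ y)²` for `y = x_{t-1}⁴ ≥ 0`, so
that fourth moments suffice. -/
theorem sum_pathScore_four_le (x : ℕ → ℝ) (θ : ℝ) (n : ℕ) :
    ∑ i : Finset.Icc 1 n, pathScore x n i ^ 4 ≤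
      8 * ((n : ℝ)⁻¹ ^ 2 * ∑ t ∈ Finset.Icc 2 n, x (t - 1) ^ 4 * (x t - θ * x (t - 1)) ^ 4) +
      8 * ((pathLse x n - θ) ^ 2 * ((n : ℝ)⁻¹ * ∑ t ∈ Finset.Icc 2 n, x (t - 1) ^ 4)) ^ 2 := by
  have hs : √(n : ℝ) ^ 4 = n ^ 2 := by
    rw [show (4 : ℕ) = 2 * 2 from rfl, pow_mul, Real.sq_sqrt n.cast_nonneg]
  have h8 : ∑ t ∈ Finset.Icc 2 n, (x (t - 1) ^ 4) ^ 2 ≤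
      (∑ t ∈ Finset.Icc 2 n, x (t - 1) ^ 4) ^ 2 := by
    rw [sq (∑ t ∈ Finset.Icc 2 n, x (t - 1) ^ 4), Finset.sum_mul]
    refine Finset.sum_le_sum fun t ht => ?_
    rw [sq]
    exact mul_le_mul_of_nonneg_left (Finset.single_le_sum (f := fun t => x (t - 1) ^ 4)
      (fun i _ => by positivity) ht) (by positivity)
  have hc : ∀ u v : ℝ, (u - v) ^ 4 ≤ 8 * u ^ 4 + 8 * v ^ 4 := fun u v => by
    nlinarith [sq_nonneg (u + v), sq_nonneg (u - v), sq_nonneg (u ^ 2 - v ^ 2),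
      sq_nonneg ((u + v) ^ 2), mul_nonneg (sq_nonneg (u + v)) (sq_nonneg (u - v)),
      mul_nonneg (sq_nonneg (u + v)) (sq_nonneg u), mul_nonneg (sq_nonneg (u + v)) (sq_nonneg v)]
  rw [sum_Icc_one_eq_sum_Icc_two n (f := fun t => pathScore x n t ^ 4)
    (g := fun t => (n : ℝ)⁻¹ ^ 2 * (x (t - 1) ^ 4 * ((x t - θ * x (t - 1)) -
      (pathLse x n - θ) * x (t - 1)) ^ 4))
    (fun t ht => by simp [pathScore, not_le.2 ht])
    (fun t ht => by simp only [pathScore, ht, if_true, div_pow, hs]; ring)]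
  calc _ ≤ ∑ t ∈ Finset.Icc 2 n, (n : ℝ)⁻¹ ^ 2 * (x (t - 1) ^ 4 *
        (8 * (x t - θ * x (t - 1)) ^ 4 + 8 * ((pathLse x n - θ) * x (t - 1)) ^ 4)) := by
        gcongr with t _
        exact hc _ _
    _ = 8 * ((n : ℝ)⁻¹ ^ 2 * ∑ t ∈ Finset.Icc 2 n, x (t - 1) ^ 4 * (x t - θ * x (t - 1)) ^ 4) +
        8 * ((pathLse x n - θ) ^ 4 * (n : ℝ)⁻¹ ^ 2 *
          ∑ t ∈ Finset.Icc 2 n, (x (t - 1) ^ 4) ^ 2) := by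
        simp_rw [Finset.mul_sum, ← Finset.sum_add_distrib]
        exact Finset.sum_congr rfl fun t _ => by ring
    _ ≤ 8 * ((n : ℝ)⁻¹ ^ 2 * ∑ t ∈ Finset.Icc 2 n, x (t - 1) ^ 4 * (x t - θ * x (t - 1)) ^ 4) +
        8 * ((pathLse x n - θ) ^ 4 * (n : ℝ)⁻¹ ^ 2 *
          (∑ t ∈ Finset.Icc 2 n, x (t - 1) ^ 4) ^ 2) := by gcongr
    _ = _ := by ring

/-- The sums of squares and of fourth powers of the scores along a path whose errors
`X_t - θ X_{t-1}` satisfy the relevant laws of large numbers. -/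
theorem tendsto_sum_pathScore {x : ℕ → ℝ} {θ a b : ℝ} {n : ℕ → ℕ} (hn : Tendsto n atTop atTop)
    (ha : 0 < a)
    (h2 : Tendsto (fun k => (n k : ℝ)⁻¹ * ∑ t ∈ Finset.Icc 2 (n k), x (t - 1) ^ 2) atTop (𝓝 a))
    (h22 : Tendsto (fun k => (n k : ℝ)⁻¹ * ∑ t ∈ Finset.Icc 2 (n k),
      x (t - 1) ^ 2 * (x t - θ * x (t - 1)) ^ 2) atTop (𝓝 b))
    (h11 : Tendsto (fun k => √(n k : ℝ) * ((n k : ℝ)⁻¹ * ∑ t ∈ Finset.Icc 2 (n k),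
      x (t - 1) * (x t - θ * x (t - 1))) ^ 2) atTop (𝓝 0))
    (h44 : Tendsto (fun k => (n k : ℝ)⁻¹ ^ 2 * ∑ t ∈ Finset.Icc 2 (n k),
      x (t - 1) ^ 4 * (x t - θ * x (t - 1)) ^ 4) atTop (𝓝 0))
    (h4 : Tendsto (fun k => (√(n k : ℝ))⁻¹ * ((n k : ℝ)⁻¹ * ∑ t ∈ Finset.Icc 2 (n k),
      x (t - 1) ^ 4)) atTop (𝓝 0)) :
    Tendsto (fun k => ∑ i : Finset.Icc 1 (n k), pathScore x (n k) i ^ 2) atTop (𝓝 b) ∧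
    Tendsto (fun k => ∑ i : Finset.Icc 1 (n k), pathScore x (n k) i ^ 4) atTop (𝓝 0) := by
  have hd : Tendsto (fun k => (pathLse x (n k) - θ) ^ 2 *
      ((n k : ℝ)⁻¹ * ∑ t ∈ Finset.Icc 2 (n k), x (t - 1) ^ 4)) atTop (𝓝 0) := by
    -- `(θ̂ - θ)²` is the squared mean score over the squared mean of `x²`. The factor `√n` is
    -- shared between score and fourth powers, so the mean fourth power need not converge.
    have hlim := (h11.mul h4).div (h2.pow 2) (by positivity)
    rw [mul_zero, zero_div] at hlim
    refine hlim.congr' ?_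
    filter_upwards [h2.eventually_const_lt ha, hn.eventually_gt_atTop 0] with k hk hnk
    have hnk' : (0 : ℝ) < n k := by exact_mod_cast hnk
    have hsn : √(n k : ℝ) ≠ 0 := (Real.sqrt_pos.2 hnk').ne'
    have hD : ∑ t ∈ Finset.Icc 2 (n k), x (t - 1) ^ 2 ≠ 0 := by
      rintro h
      rw [h, mul_zero] at hk
      exact lt_irrefl _ hk
    have hdiff : pathLse x (n k) - θ = ((n k : ℝ)⁻¹ * ∑ t ∈ Finset.Icc 2 (n k),
        x (t - 1) * (x t - θ * x (t - 1))) /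
        ((n k : ℝ)⁻¹ * ∑ t ∈ Finset.Icc 2 (n k), x (t - 1) ^ 2) := by
      have e : ∑ t ∈ Finset.Icc 2 (n k), x (t - 1) * (x t - θ * x (t - 1)) =
          (∑ t ∈ Finset.Icc 2 (n k), x t * x (t - 1)) -
            θ * ∑ t ∈ Finset.Icc 2 (n k), x (t - 1) ^ 2 := by
        rw [Finset.mul_sum, ← Finset.sum_sub_distrib]
        exact Finset.sum_congr rfl fun t _ => by ring
      rw [e, pathLse, mul_div_mul_left _ _ (inv_ne_zero hnk'.ne')]
      field_simp
    simp only [Pi.div_apply]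
    rw [hdiff, div_pow]
    generalize ∑ t ∈ Finset.Icc 2 (n k), x (t - 1) * (x t - θ * x (t - 1)) = s
    field_simp
  constructor
  -- By Cauchy–Schwarz the square of the cross term is at most the product of the quantities in `hd`
  -- and `h22`.
  · have hcross : Tendsto (fun k => (pathLse x (n k) - θ) * ((n k : ℝ)⁻¹ *
        ∑ t ∈ Finset.Icc 2 (n k), x (t - 1) ^ 3 * (x t - θ * x (t - 1)))) atTop (𝓝 0) := by
      have hlim := (hd.mul h22).sqrt
      rw [zero_mul, Real.sqrt_zero] at hlim
      refine squeeze_zero_norm (fun k => ?_) hlim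
      rw [Real.norm_eq_abs, ← Real.sqrt_sq_eq_abs]
      refine Real.sqrt_le_sqrt ?_
      have hcs : (∑ t ∈ Finset.Icc 2 (n k), x (t - 1) ^ 3 * (x t - θ * x (t - 1))) ^ 2 ≤
          (∑ t ∈ Finset.Icc 2 (n k), x (t - 1) ^ 4) *
            ∑ t ∈ Finset.Icc 2 (n k), x (t - 1) ^ 2 * (x t - θ * x (t - 1)) ^ 2 :=
        Finset.sum_sq_le_sum_mul_sum_of_sq_le_mul _ (fun t _ => by positivity)
          (fun t _ => by positivity) fun t _ => le_of_eq (by ring)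
      calc _ = (pathLse x (n k) - θ) ^ 2 * (n k : ℝ)⁻¹ ^ 2 *
            (∑ t ∈ Finset.Icc 2 (n k), x (t - 1) ^ 3 * (x t - θ * x (t - 1))) ^ 2 := by ring
        _ ≤ (pathLse x (n k) - θ) ^ 2 * (n k : ℝ)⁻¹ ^ 2 *
            ((∑ t ∈ Finset.Icc 2 (n k), x (t - 1) ^ 4) *
            ∑ t ∈ Finset.Icc 2 (n k), x (t - 1) ^ 2 * (x t - θ * x (t - 1)) ^ 2) := by gcongr
        _ = _ := by ring
    simp_rw [sum_pathScore_sq x θ]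
    simpa using (h22.sub (hcross.const_mul 2)).add hd
  · refine squeeze_zero (fun k => Finset.sum_nonneg fun i _ => by positivity)
      (fun k => sum_pathScore_four_le x θ (n k)) ?_
    simpa using (h44.const_mul 8).add ((hd.pow 2).const_mul 8)

end PathScore

/-! ### Moments and orthogonality in the autoregression. -/

section Moments

variable {μ : Measure Ω}

theorem integrable_pow_four {f : Ω → ℝ} (hf : MemLp f 4 μ) :
    Integrable (fun ω => f ω ^ 4) μ := by
  have hf' : MemLp f (4 : ℕ) μ := by exact_mod_cast hf
  refine (hf'.integrable_norm_pow (by norm_num)).congr (ae_of_all _ fun ω => ?_)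
  exact Even.pow_abs (by decide) _

theorem memLp_two_sq {f : Ω → ℝ} (hf : MemLp f 4 μ) : MemLp (fun ω => f ω ^ 2) 2 μ := by
  refine (memLp_two_iff_integrable_sq (hf.aestronglyMeasurable.pow 2)).2 ?_
  refine (integrable_pow_four hf).congr (ae_of_all _ fun ω => ?_)
  simp only [Pi.pow_apply]
  ring

theorem integral_sq_le_one_add [IsProbabilityMeasure μ] {f : Ω → ℝ} (hf : MemLp f 4 μ) {C : ℝ}
    (hC : ∫ ω, f ω ^ 4 ∂μ ≤ C) : ∫ ω, f ω ^ 2 ∂μ ≤ 1 + C := by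
  calc ∫ ω, f ω ^ 2 ∂μ ≤ ∫ ω, (1 + f ω ^ 4) ∂μ := by
        refine integral_mono ((memLp_two_sq hf).integrable one_le_two)
          ((integrable_const _).add (integrable_pow_four hf)) fun ω => ?_
        simp only
        nlinarith [sq_nonneg (f ω ^ 2 - 1)]
    _ = 1 + ∫ ω, f ω ^ 4 ∂μ := by
        rw [integral_add (integrable_const _) (integrable_pow_four hf)]
        simp
    _ ≤ 1 + C := by linarith

/-- Convexity of the fourth power, with weights `|θ|` and `1 - |θ|` at the points `± x` and `z / (1
- |θ|)`. The factor `|θ| < 1` makes the fourth moments contract. -/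
theorem add_pow_four_le {θ : ℝ} (hθ : |θ| < 1) (x z : ℝ) :
    (θ * x + z) ^ 4 ≤ |θ| * x ^ 4 + z ^ 4 / (1 - |θ|) ^ 3 := by
  have h1 : 0 < 1 - |θ| := by linarith
  obtain ⟨s, hs, hs4⟩ : ∃ s : ℝ, |θ| * s = θ ∧ s ^ 4 = 1 := by
    rcases abs_cases θ with ⟨h, _⟩ | ⟨h, _⟩
    · exact ⟨1, by rw [h, mul_one], one_pow 4⟩
    · exact ⟨-1, by rw [h]; ring, by norm_num⟩
  have hconv := (Even.convexOn_pow (𝕜 := ℝ) (n := 4) (by decide)).2 (Set.mem_univ (s * x))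
    (Set.mem_univ (z / (1 - |θ|))) (abs_nonneg θ) h1.le (by ring)
  simp only [smul_eq_mul] at hconv
  rw [← mul_assoc, hs, mul_div_cancel₀ _ h1.ne', mul_pow, hs4, one_mul] at hconv
  refine hconv.trans (le_of_eq ?_)
  field_simp

end Moments

namespace IsHeteroscedasticAR1

variable {μ : Measure Ω} {θ : ℝ} {τ : ℕ → ℝ} {X ε : ℕ → Ω → ℝ}

theorem memLp_eps (h : IsHeteroscedasticAR1 μ θ τ X ε) {t : ℕ} (ht : 1 ≤ t) :
    MemLp (ε t) 4 μ := (h.eps_identDistrib t ht).symm.memLp_snd h.eps_fourth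

theorem integral_eps_comp (h : IsHeteroscedasticAR1 μ θ τ X ε) {t : ℕ} (ht : 1 ≤ t) {φ : ℝ → ℝ}
    (hφ : Measurable φ) : ∫ ω, φ (ε t ω) ∂μ = ∫ ω, φ (ε 1 ω) ∂μ :=
  ((h.eps_identDistrib t ht).comp hφ).integral_eq

theorem integral_eps (h : IsHeteroscedasticAR1 μ θ τ X ε) {t : ℕ} (ht : 1 ≤ t) :
    ∫ ω, ε t ω ∂μ = 0 :=
  (h.integral_eps_comp ht measurable_id).trans h.eps_mean

theorem integral_eps_sq (h : IsHeteroscedasticAR1 μ θ τ X ε) {t : ℕ} (ht : 1 ≤ t) :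
    ∫ ω, ε t ω ^ 2 ∂μ = 1 := by
  rw [h.integral_eps_comp ht (φ := fun x => x ^ 2) (by fun_prop), ← h.eps_variance,
    variance_of_integral_eq_zero (h.measurable_eps 1 le_rfl).aemeasurable h.eps_mean]

theorem sub_eq (h : IsHeteroscedasticAR1 μ θ τ X ε) {t : ℕ} (ht : 1 ≤ t) (ω : Ω) :
    X t ω - θ * X (t - 1) ω = τ t * ε t ω := by
  rw [h.recursion t ht ω]
  ring

theorem memLp_X (h : IsHeteroscedasticAR1 μ θ τ X ε) (t : ℕ) : MemLp (X t) 4 μ := by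
  induction t with
  | zero => exact_mod_cast h.initial_moments 4
  | succ t ih =>
    have : X (t + 1) = fun ω => θ * X t ω + τ (t + 1) * ε (t + 1) ω :=
      funext fun ω => h.recursion (t + 1) (by omega) ω
    rw [this]
    exact (ih.const_mul θ).add ((h.memLp_eps (by omega)).const_mul _)

theorem memLp_two_X [IsProbabilityMeasure μ] (h : IsHeteroscedasticAR1 μ θ τ X ε) (t : ℕ) : MemLp (X t) 2 μ :=
  (h.memLp_X t).mono_exponent (by norm_num)

theorem exists_integral_pow_four_le (h : IsHeteroscedasticAR1 μ θ τ X ε) {B : ℝ}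
    (hB : ∀ t, 1 ≤ t → τ t ^ 2 ≤ B) : ∃ C, 0 ≤ C ∧ ∀ t, ∫ ω, X t ω ^ 4 ∂μ ≤ C := by
  have h1 : 0 < 1 - |θ| := by linarith [h.abs_theta_lt_one]
  set κ := ∫ ω, ε 1 ω ^ 4 ∂μ with hκ
  have hκ0 : 0 ≤ κ := integral_nonneg fun ω => by positivity
  -- The second entry is the fixed point of the recursive bound for the fourth moments, so the
  -- maximum with the initial moment is preserved at each step.
  set C := max (∫ ω, X 0 ω ^ 4 ∂μ) (B ^ 2 * κ / (1 - |θ|) ^ 4) with hC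
  refine ⟨C, (by positivity : 0 ≤ B ^ 2 * κ / (1 - |θ|) ^ 4).trans (le_max_right _ _),
    fun t => ?_⟩
  induction t with
  | zero => exact le_max_left _ _
  | succ t ih =>
    have ht : 1 ≤ t + 1 := by omega
    have hi1 := integrable_pow_four (h.memLp_X t)
    have hi2 := integrable_pow_four (h.memLp_eps ht)
    have hτ : τ (t + 1) ^ 4 ≤ B ^ 2 := by
      calc τ (t + 1) ^ 4 = (τ (t + 1) ^ 2) ^ 2 := by ring
        _ ≤ B ^ 2 := pow_le_pow_left₀ (sq_nonneg _) (hB _ ht) 2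
    calc ∫ ω, X (t + 1) ω ^ 4 ∂μ
        ≤ ∫ ω, (|θ| * X t ω ^ 4 + τ (t + 1) ^ 4 / (1 - |θ|) ^ 3 * ε (t + 1) ω ^ 4) ∂μ := by
          refine integral_mono (integrable_pow_four (h.memLp_X _))
            ((hi1.const_mul _).add (hi2.const_mul _)) fun ω => ?_
          simp only
          rw [h.recursion (t + 1) ht ω]
          refine (add_pow_four_le h.abs_theta_lt_one _ _).trans (le_of_eq ?_)
          simp only [Nat.add_sub_cancel]
          ring
      _ = |θ| * ∫ ω, X t ω ^ 4 ∂μ + τ (t + 1) ^ 4 / (1 - |θ|) ^ 3 * κ := by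
          rw [integral_add (hi1.const_mul _) (hi2.const_mul _), integral_const_mul,
            integral_const_mul, h.integral_eps_comp ht (φ := fun x => x ^ 4) (by fun_prop)]
      _ ≤ |θ| * C + B ^ 2 / (1 - |θ|) ^ 3 * κ := by gcongr
      _ = |θ| * C + (1 - |θ|) * (B ^ 2 * κ / (1 - |θ|) ^ 4) := by field_simp
      _ ≤ |θ| * C + (1 - |θ|) * C := by
          gcongr
          exact le_max_right _ _
      _ = C := by ring

theorem indep_X_eps (h : IsHeteroscedasticAR1 μ θ τ X ε) {t : ℕ} (ht : 1 ≤ t) :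
    IndepFun (X (t - 1)) (ε t) μ :=
  ((h.eps_indep_past t ht).symm.comp
    (measurable_pi_apply (⟨t - 1, by omega⟩ : Fin t)) measurable_id)

theorem integral_comp_mul_comp (h : IsHeteroscedasticAR1 μ θ τ X ε) {t : ℕ} (ht : 1 ≤ t)
    {g e : ℝ → ℝ} (hg : Measurable g) (he : Measurable e) :
    ∫ ω, g (X (t - 1) ω) * e (ε t ω) ∂μ = (∫ ω, g (X (t - 1) ω) ∂μ) * ∫ ω, e (ε t ω) ∂μ :=
  (h.indep_X_eps ht).integral_fun_comp_mul_comp (h.measurable_X _).aemeasurable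
    (h.measurable_eps t ht).aemeasurable hg.aestronglyMeasurable he.aestronglyMeasurable

theorem integrable_comp_mul_comp (h : IsHeteroscedasticAR1 μ θ τ X ε) {t : ℕ} (ht : 1 ≤ t)
    {g e : ℝ → ℝ} (hg : Measurable g) (he : Measurable e)
    (hgi : Integrable (fun ω => g (X (t - 1) ω)) μ) (hei : Integrable (fun ω => e (ε t ω)) μ) :
    Integrable (fun ω => g (X (t - 1) ω) * e (ε t ω)) μ :=
  ((h.indep_X_eps ht).comp hg he).integrable_mul hgi hei

theorem memLp_comp_mul_comp (h : IsHeteroscedasticAR1 μ θ τ X ε) {t : ℕ} (ht : 1 ≤ t)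
    {g e : ℝ → ℝ} (hg : Measurable g) (he : Measurable e)
    (hgL : MemLp (fun ω => g (X (t - 1) ω)) 2 μ) (heL : MemLp (fun ω => e (ε t ω)) 2 μ) :
    MemLp (fun ω => g (X (t - 1) ω) * e (ε t ω)) 2 μ := by
  refine (memLp_two_iff_integrable_sq
    (hgL.aestronglyMeasurable.mul heL.aestronglyMeasurable)).2 ?_
  refine (h.integrable_comp_mul_comp ht (g := fun x => g x ^ 2) (e := fun x => e x ^ 2)
    (hg.pow_const 2) (he.pow_const 2) hgL.integrable_sq heL.integrable_sq).congr
    (ae_of_all _ fun ω => ?_)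
  simp [mul_pow]

/-- Centered functions of the errors multiplied by functions of the past are orthogonal. -/
theorem integral_mul_eq_zero (h : IsHeteroscedasticAR1 μ θ τ X ε) {g e : ℕ → ℝ → ℝ}
    (hg : ∀ t, Measurable (g t)) (he : ∀ t, Measurable (e t))
    (he0 : ∀ t, 1 ≤ t → ∫ ω, e t (ε t ω) ∂μ = 0) {s t : ℕ} (hs : 1 ≤ s) (hst : s < t) :
    ∫ ω, (g s (X (s - 1) ω) * e s (ε s ω)) * (g t (X (t - 1) ω) * e t (ε t ω)) ∂μ = 0 := by
  have ht : 1 ≤ t := by omega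
  -- As `τ s ≠ 0`, the error `ε s` is recovered from `X s` and `X (s - 1)`; everything except `e t
  -- (ε t)` is then a function of the past of `t`.
  set φ : (Fin t → ℝ) → ℝ := fun v => (g s (v ⟨s - 1, by omega⟩) *
    e s ((v ⟨s, hst⟩ - θ * v ⟨s - 1, by omega⟩) / τ s)) * g t (v ⟨t - 1, by omega⟩) with hφ
  have hφm : Measurable φ := by
    have := hg s
    have := he s
    have := hg t
    fun_prop
  have hpast : Measurable fun ω (i : Fin t) => X i ω :=
    measurable_pi_lambda _ fun i => h.measurable_X i
  have key := (h.eps_indep_past t ht).symm.integral_fun_comp_mul_comp hpast.aemeasurable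
    (h.measurable_eps t ht).aemeasurable hφm.aestronglyMeasurable (he t).aestronglyMeasurable
  rw [he0 t ht, mul_zero] at key
  rw [← key]
  congr 1 with ω
  simp only [hφ]
  rw [h.sub_eq hs, mul_div_cancel_left₀ _ (h.tau_pos s hs).ne', mul_assoc, mul_assoc, mul_assoc]

/-- The second moment of a sum of orthogonal terms of the autoregression. -/
theorem integral_sum_sq_le (h : IsHeteroscedasticAR1 μ θ τ X ε) {g e : ℕ → ℝ → ℝ}
    (hg : ∀ t, Measurable (g t)) (he : ∀ t, Measurable (e t))
    (hgL : ∀ t, 1 ≤ t → MemLp (fun ω => g t (X (t - 1) ω)) 2 μ)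
    (heL : ∀ t, 1 ≤ t → MemLp (fun ω => e t (ε t ω)) 2 μ)
    (he0 : ∀ t, 1 ≤ t → ∫ ω, e t (ε t ω) ∂μ = 0) {G H : ℝ}
    (hG : ∀ t, 1 ≤ t → ∫ ω, g t (X (t - 1) ω) ^ 2 ∂μ ≤ G)
    (hH : ∀ t, 1 ≤ t → ∫ ω, e t (ε t ω) ^ 2 ∂μ ≤ H) (n : ℕ) :
    ∫ ω, (∑ t ∈ Finset.Icc 2 n, g t (X (t - 1) ω) * e t (ε t ω)) ^ 2 ∂μ ≤ n * (G * H) := by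
  have hG0 : 0 ≤ G := (integral_nonneg fun ω => sq_nonneg _).trans (hG 1 le_rfl)
  have hH0 : 0 ≤ H := (integral_nonneg fun ω => sq_nonneg _).trans (hH 1 le_rfl)
  have hL : ∀ t, 1 ≤ t → MemLp (fun ω => g t (X (t - 1) ω) * e t (ε t ω)) 2 μ := fun t ht =>
    h.memLp_comp_mul_comp ht (hg t) (he t) (hgL t ht) (heL t ht)
  have h1 : ∀ t ∈ Finset.Icc 2 n, 1 ≤ t := fun t ht => by
    have := (Finset.mem_Icc.1 ht).1
    omega
  have hint : ∀ s ∈ Finset.Icc 2 n, ∀ t ∈ Finset.Icc 2 n, Integrable (fun ω =>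
      (g s (X (s - 1) ω) * e s (ε s ω)) * (g t (X (t - 1) ω) * e t (ε t ω))) μ :=
    fun s hs t ht => (hL s (h1 s hs)).integrable_mul (hL t (h1 t ht))
  simp_rw [sq (∑ t ∈ Finset.Icc 2 n, _), Finset.sum_mul_sum]
  rw [integral_finsetSum _ fun s hs => integrable_finsetSum _ fun t ht => hint s hs t ht]
  calc _ ≤ ∑ s ∈ Finset.Icc 2 n, G * H := by
        refine Finset.sum_le_sum fun s hs => ?_
        rw [integral_finsetSum _ fun t ht => hint s hs t ht,
          Finset.sum_eq_single_of_mem s hs]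
        · simp_rw [← sq, mul_pow]
          rw [h.integral_comp_mul_comp (h1 s hs) (g := fun x => g s x ^ 2)
            (e := fun x => e s x ^ 2) ((hg s).pow_const 2) ((he s).pow_const 2)]
          exact mul_le_mul (hG s (h1 s hs)) (hH s (h1 s hs))
            (integral_nonneg fun ω => sq_nonneg _) hG0
        · intro t ht hts
          rcases lt_or_gt_of_ne hts with hlt | hlt
          · rw [← h.integral_mul_eq_zero hg he he0 (h1 t ht) hlt]
            congr 1 with ω
            ring
          · exact h.integral_mul_eq_zero hg he he0 (h1 s hs) hlt
    _ ≤ n * (G * H) := by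
        rw [Finset.sum_const, nsmul_eq_mul, Nat.card_Icc]
        gcongr
        omega

end IsHeteroscedasticAR1

/-! ### Sequences that vanish in `L¹`, and periodic averages. -/

section L1Null

theorem tendsto_const_div_sqrt_natCast (c : ℝ) :
    Tendsto (fun n : ℕ => c / √(n : ℝ)) atTop (𝓝 0) :=
  tendsto_const_nhds.div_atTop (Real.tendsto_sqrt_atTop.comp tendsto_natCast_atTop_atTop)

variable {μ : Measure Ω}

/-- A sequence of integrable functions which converges to zero in `L¹`. -/
structure L1Null (μ : Measure Ω) (f : ℕ → Ω → ℝ) : Prop where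
  integrable : ∀ n, Integrable (f n) μ
  tendsto : Tendsto (fun n => ∫ ω, |f n ω| ∂μ) atTop (𝓝 0)

theorem L1Null.of_integral_abs_le {f : ℕ → Ω → ℝ} (hf : ∀ n, Integrable (f n) μ) {c : ℕ → ℝ}
    (hc : Tendsto c atTop (𝓝 0)) (hle : ∀ n, ∫ ω, |f n ω| ∂μ ≤ c n) : L1Null μ f :=
  ⟨hf, squeeze_zero (fun _ => integral_nonneg fun _ => abs_nonneg _) hle hc⟩

theorem L1Null.add {f g : ℕ → Ω → ℝ} (hf : L1Null μ f) (hg : L1Null μ g) :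
    L1Null μ fun n ω => f n ω + g n ω := by
  refine .of_integral_abs_le (fun n => (hf.integrable n).add (hg.integrable n))
    (by simpa using hf.tendsto.add hg.tendsto) fun n => ?_
  rw [← integral_add (hf.integrable n).abs (hg.integrable n).abs]
  exact integral_mono ((hf.integrable n).add (hg.integrable n)).abs
    ((hf.integrable n).abs.add (hg.integrable n).abs) fun ω => abs_add_le _ _

theorem L1Null.abs {f : ℕ → Ω → ℝ} (hf : L1Null μ f) : L1Null μ fun n ω => |f n ω| :=
  ⟨fun n => (hf.integrable n).abs, by simpa using hf.tendsto⟩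

theorem L1Null.congr {f g : ℕ → Ω → ℝ} (hf : L1Null μ f) (h : ∀ n ω, f n ω = g n ω) :
    L1Null μ g := by
  have : f = g := funext fun n => funext fun ω => h n ω
  rwa [← this]

theorem L1Null.of_deterministic [IsProbabilityMeasure μ] {c : ℕ → ℝ}
    (hc : Tendsto c atTop (𝓝 0)) : L1Null μ fun n _ => c n :=
  .of_integral_abs_le (fun n => integrable_const _) (by simpa using hc.abs) fun n => by simp

/-- Means of sequences whose second moments grow at most linearly. -/
theorem l1Null_inv_mul [IsProbabilityMeasure μ] {S : ℕ → Ω → ℝ} (hS : ∀ n, MemLp (S n) 2 μ)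
    {C : ℝ} (hC : 0 ≤ C) (hle : ∀ n : ℕ, ∫ ω, S n ω ^ 2 ∂μ ≤ n * C) :
    L1Null μ fun n ω => (n : ℝ)⁻¹ * S n ω := by
  have hL : ∀ n : ℕ, MemLp (fun ω => (n : ℝ)⁻¹ * S n ω) 2 μ := fun n => (hS n).const_mul _
  refine .of_integral_abs_le (fun n => (hL n).integrable one_le_two)
    (tendsto_const_div_sqrt_natCast (√C)) fun n => (integral_abs_le_sqrt (hL n)).trans ?_
  rw [← Real.sqrt_div hC]
  refine Real.sqrt_le_sqrt ?_
  simp_rw [mul_pow]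
  rw [integral_const_mul]
  refine (mul_le_mul_of_nonneg_left (hle n) (by positivity)).trans (le_of_eq ?_)
  rcases Nat.eq_zero_or_pos n with rfl | hn
  · simp
  · field_simp

theorem L1Null.tendstoInMeasure {f : ℕ → Ω → ℝ} (hf : L1Null μ f) :
    TendstoInMeasure μ f atTop fun _ => 0 := by
  refine tendstoInMeasure_of_tendsto_eLpNorm (p := 1) one_ne_zero
    (fun n => (hf.integrable n).aestronglyMeasurable) aestronglyMeasurable_const ?_
  have h : ∀ n, eLpNorm (f n - fun _ => 0) 1 μ = ENNReal.ofReal (∫ ω, |f n ω| ∂μ) := by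
    intro n
    have h0 : (f n - fun _ => (0 : ℝ)) = f n := by ext ω; simp
    rw [h0, eLpNorm_one_eq_lintegral_enorm,
      ← ofReal_integral_norm_eq_lintegral_enorm (hf.integrable n)]
    rfl
  simp_rw [h]
  simpa using ENNReal.tendsto_ofReal hf.tendsto

end L1Null

/-- The range starts at an even index, so for even `n` there is one more `v` than `u`. -/
theorem sum_Icc_two_alternating (u v : ℝ) {n : ℕ} (hn : 1 ≤ n) :
    ∑ t ∈ Finset.Icc 2 n, alternating u v t =
      (n - 1) * ((u + v) / 2) + (if Even n then (v - u) / 2 else 0) := by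
  induction n, hn using Nat.le_induction with
  | base => simp
  | succ n hn ih =>
    rw [Finset.sum_Icc_succ_top (by omega), ih]
    rcases Nat.even_or_odd n with he | ho
    · have h1 : Odd (n + 1) := he.add_one
      rw [if_pos he, if_neg (Nat.not_even_iff_odd.2 h1), alternating, if_pos h1]
      push_cast
      ring
    · have h1 : Even (n + 1) := ho.add_one
      rw [if_neg (Nat.not_even_iff_odd.2 ho), if_pos h1, alternating,
        if_neg (Nat.not_odd_iff_even.2 h1)]
      push_cast
      ring

theorem tendsto_mean_alternating (u v : ℝ) :
    Tendsto (fun n : ℕ => (n : ℝ)⁻¹ * ∑ t ∈ Finset.Icc 2 n, alternating u v t) atTop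
      (𝓝 ((u + v) / 2)) := by
  rw [← tendsto_sub_nhds_zero_iff]
  refine squeeze_zero_norm' (a := fun n : ℕ => (|(u + v) / 2| + |(v - u) / 2|) / n) ?_
    (tendsto_const_div_atTop_nhds_zero_nat _)
  filter_upwards [eventually_ge_atTop 1] with n hn
  have hn' : (0 : ℝ) < n := by exact_mod_cast hn
  rw [sum_Icc_two_alternating u v hn]
  have : (n : ℝ)⁻¹ * ((n - 1) * ((u + v) / 2) + (if Even n then (v - u) / 2 else 0)) -
      (u + v) / 2 = (-((u + v) / 2) + (if Even n then (v - u) / 2 else 0)) / n := by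
    field_simp
    ring
  rw [this, norm_div, Real.norm_natCast, Real.norm_eq_abs]
  have hite : |if Even n then (v - u) / 2 else 0| ≤ |(v - u) / 2| := by
    split_ifs
    · exact le_rfl
    · simp
  gcongr
  refine (abs_add_le _ _).trans ?_
  rw [abs_neg]
  exact add_le_add le_rfl hite

/-! ### Negligible averages of the autoregression. -/

namespace IsHeteroscedasticAR1

variable {μ : Measure Ω} {θ : ℝ} {τ : ℕ → ℝ} {X ε : ℕ → Ω → ℝ}

theorem integral_eps_sq_sub_one_sq (h : IsHeteroscedasticAR1 μ θ τ X ε) {t : ℕ} (ht : 1 ≤ t) :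
    ∫ ω, (ε t ω ^ 2 - 1) ^ 2 ∂μ = ∫ ω, (ε 1 ω ^ 2 - 1) ^ 2 ∂μ :=
  h.integral_eps_comp ht (φ := fun x => (x ^ 2 - 1) ^ 2) (by fun_prop)

theorem integrable_sum_pow_four (h : IsHeteroscedasticAR1 μ θ τ X ε) (n : ℕ) :
    Integrable (fun ω => ∑ t ∈ Finset.Icc 2 n, X (t - 1) ω ^ 4) μ :=
  integrable_finsetSum _ fun _ _ => integrable_pow_four (h.memLp_X _)

variable {B : ℝ}

/-- The mean of the fourth powers vanishes after multiplication by a null sequence. -/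
theorem l1Null_mul_mean_pow_four (h : IsHeteroscedasticAR1 μ θ τ X ε)
    (hB : ∀ t, 1 ≤ t → τ t ^ 2 ≤ B) {c : ℕ → ℝ} (hc : Tendsto c atTop (𝓝 0)) :
    L1Null μ fun n ω => c n * ((n : ℝ)⁻¹ * ∑ t ∈ Finset.Icc 2 n, X (t - 1) ω ^ 4) := by
  obtain ⟨K, hK0, hK⟩ := h.exists_integral_pow_four_le hB
  refine .of_integral_abs_le (fun n => ((h.integrable_sum_pow_four n).const_mul _).const_mul _)
    (c := fun n => |c n| * K) (by simpa using hc.abs.mul_const K) fun n => ?_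
  have habs : ∀ ω, |c n * ((n : ℝ)⁻¹ * ∑ t ∈ Finset.Icc 2 n, X (t - 1) ω ^ 4)| =
      |c n| * ((n : ℝ)⁻¹ * ∑ t ∈ Finset.Icc 2 n, X (t - 1) ω ^ 4) := fun ω => by
    rw [abs_mul, abs_of_nonneg (a := (n : ℝ)⁻¹ * _)
      (mul_nonneg (by positivity) (Finset.sum_nonneg fun t _ => by positivity))]
  simp_rw [habs]
  rw [integral_const_mul, integral_const_mul, integral_finsetSum _ fun t _ =>
    integrable_pow_four (h.memLp_X _)]
  refine mul_le_mul_of_nonneg_left ?_ (abs_nonneg _)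
  calc (n : ℝ)⁻¹ * ∑ t ∈ Finset.Icc 2 n, ∫ ω, X (t - 1) ω ^ 4 ∂μ
      ≤ (n : ℝ)⁻¹ * ∑ t ∈ Finset.Icc 2 n, K := by
        gcongr with t _
        exact hK _
    _ ≤ (n : ℝ)⁻¹ * (n * K) := by
        rw [Finset.sum_const, nsmul_eq_mul, Nat.card_Icc]
        gcongr
        omega
    _ ≤ K := by
        rcases Nat.eq_zero_or_pos n with rfl | hn
        · simpa using hK0
        · have : (n : ℝ) ≠ 0 := by positivity
          rw [inv_mul_cancel_left₀ this]

/-- By independence of `X_{t-1}` and `ε_t` each term has bounded expectation with only fourth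
moments; there are fewer than `n` terms (for `n ≥ 1`) against the factor `n⁻²`. -/
theorem l1Null_sum_four_mul_four (h : IsHeteroscedasticAR1 μ θ τ X ε)
    (hB : ∀ t, 1 ≤ t → τ t ^ 2 ≤ B) :
    L1Null μ fun n ω => (n : ℝ)⁻¹ ^ 2 * ∑ t ∈ Finset.Icc 2 n,
      X (t - 1) ω ^ 4 * (X t ω - θ * X (t - 1) ω) ^ 4 := by
  obtain ⟨K, hK0, hK⟩ := h.exists_integral_pow_four_le hB
  have h1 : ∀ n : ℕ, ∀ t ∈ Finset.Icc 2 n, 1 ≤ t := fun n t ht => by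
    have := (Finset.mem_Icc.1 ht).1
    omega
  have hsum : ∀ (n : ℕ) ω, ∑ t ∈ Finset.Icc 2 n, X (t - 1) ω ^ 4 * (X t ω - θ * X (t - 1) ω) ^ 4 =
      ∑ t ∈ Finset.Icc 2 n, τ t ^ 4 * (X (t - 1) ω ^ 4 * ε t ω ^ 4) := fun n ω =>
    Finset.sum_congr rfl fun t ht => by rw [h.sub_eq (h1 n t ht)]; ring
  simp_rw [hsum]
  set κ := ∫ ω, ε 1 ω ^ 4 ∂μ with hκ
  have hκ0 : 0 ≤ κ := integral_nonneg fun ω => by positivity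
  have hint : ∀ t, 1 ≤ t → Integrable (fun ω => X (t - 1) ω ^ 4 * ε t ω ^ 4) μ := fun t ht =>
    h.integrable_comp_mul_comp ht (g := fun x => x ^ 4) (e := fun x => x ^ 4) (by fun_prop)
      (by fun_prop) (integrable_pow_four (h.memLp_X _)) (integrable_pow_four (h.memLp_eps ht))
  refine .of_integral_abs_le (fun n => (integrable_finsetSum _ fun t ht =>
    (hint t (h1 n t ht)).const_mul _).const_mul _)
    (tendsto_const_div_atTop_nhds_zero_nat (B ^ 2 * (K * κ))) fun n => ?_
  have habs : ∀ ω, |(n : ℝ)⁻¹ ^ 2 * ∑ t ∈ Finset.Icc 2 n,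
      τ t ^ 4 * (X (t - 1) ω ^ 4 * ε t ω ^ 4)| = (n : ℝ)⁻¹ ^ 2 * ∑ t ∈ Finset.Icc 2 n,
      τ t ^ 4 * (X (t - 1) ω ^ 4 * ε t ω ^ 4) := fun ω =>
    abs_of_nonneg (mul_nonneg (by positivity) (Finset.sum_nonneg fun t _ => by positivity))
  simp_rw [habs]
  rw [integral_const_mul, integral_finsetSum _ fun t ht => (hint t (h1 n t ht)).const_mul _]
  calc _ ≤ (n : ℝ)⁻¹ ^ 2 * ∑ t ∈ Finset.Icc 2 n, B ^ 2 * (K * κ) := by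
        gcongr with t ht
        rw [integral_const_mul, h.integral_comp_mul_comp (h1 n t ht) (g := fun x => x ^ 4)
          (e := fun x => x ^ 4) (by fun_prop) (by fun_prop),
          h.integral_eps_comp (h1 n t ht) (φ := fun x => x ^ 4) (by fun_prop)]
        have hτ : τ t ^ 4 ≤ B ^ 2 := by
          calc τ t ^ 4 = (τ t ^ 2) ^ 2 := by ring
            _ ≤ B ^ 2 := pow_le_pow_left₀ (sq_nonneg _) (hB _ (h1 n t ht)) 2
        have h2 := hK (t - 1)
        have h3 : 0 ≤ ∫ ω, X (t - 1) ω ^ 4 ∂μ := integral_nonneg fun ω => by positivity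
        gcongr
    _ ≤ (n : ℝ)⁻¹ ^ 2 * (n * (B ^ 2 * (K * κ))) := by
        rw [Finset.sum_const, nsmul_eq_mul, Nat.card_Icc]
        gcongr
        omega
    _ = B ^ 2 * (K * κ) / n := by
        rcases Nat.eq_zero_or_pos n with rfl | hn
        · simp
        · field_simp

variable [IsProbabilityMeasure μ]

theorem l1Null_mean (h : IsHeteroscedasticAR1 μ θ τ X ε) {g e : ℕ → ℝ → ℝ}
    (hg : ∀ t, Measurable (g t)) (he : ∀ t, Measurable (e t))
    (hgL : ∀ t, 1 ≤ t → MemLp (fun ω => g t (X (t - 1) ω)) 2 μ)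
    (heL : ∀ t, 1 ≤ t → MemLp (fun ω => e t (ε t ω)) 2 μ)
    (he0 : ∀ t, 1 ≤ t → ∫ ω, e t (ε t ω) ∂μ = 0) {G H : ℝ}
    (hG : ∀ t, 1 ≤ t → ∫ ω, g t (X (t - 1) ω) ^ 2 ∂μ ≤ G)
    (hH : ∀ t, 1 ≤ t → ∫ ω, e t (ε t ω) ^ 2 ∂μ ≤ H) :
    L1Null μ fun n ω => (n : ℝ)⁻¹ * ∑ t ∈ Finset.Icc 2 n, g t (X (t - 1) ω) * e t (ε t ω) := by
  have hG0 : 0 ≤ G := (integral_nonneg fun ω => sq_nonneg _).trans (hG 1 le_rfl)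
  have hH0 : 0 ≤ H := (integral_nonneg fun ω => sq_nonneg _).trans (hH 1 le_rfl)
  have hterm : ∀ n : ℕ, ∀ t ∈ Finset.Icc 2 n,
      MemLp (fun ω => g t (X (t - 1) ω) * e t (ε t ω)) 2 μ := fun n t ht => by
    have h1 : 1 ≤ t := by have := (Finset.mem_Icc.1 ht).1; omega
    exact h.memLp_comp_mul_comp h1 (hg t) (he t) (hgL t h1) (heL t h1)
  have hS : ∀ n : ℕ, MemLp (fun ω => ∑ t ∈ Finset.Icc 2 n, g t (X (t - 1) ω) * e t (ε t ω)) 2 μ :=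
    fun n => memLp_finsetSum _ (hterm n)
  have hbound := h.integral_sum_sq_le hg he hgL heL he0 hG hH
  exact l1Null_inv_mul hS (mul_nonneg hG0 hH0) hbound

theorem memLp_eps_sq_sub_one (h : IsHeteroscedasticAR1 μ θ τ X ε) {t : ℕ} (ht : 1 ≤ t) :
    MemLp (fun ω => ε t ω ^ 2 - 1) 2 μ :=
  (memLp_two_sq (h.memLp_eps ht)).sub (memLp_const 1)

theorem integral_eps_sq_sub_one (h : IsHeteroscedasticAR1 μ θ τ X ε) {t : ℕ} (ht : 1 ≤ t) :
    ∫ ω, (ε t ω ^ 2 - 1) ∂μ = 0 := by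
  rw [integral_sub ((memLp_two_sq (h.memLp_eps ht)).integrable one_le_two) (integrable_const _),
    h.integral_eps_sq ht]
  simp

/-- The cross terms `c_t X_{t-1} ε_t` average out. -/
theorem l1Null_mean_mul_eps (h : IsHeteroscedasticAR1 μ θ τ X ε) (hB : ∀ t, 1 ≤ t → τ t ^ 2 ≤ B)
    {c : ℕ → ℝ} {C : ℝ} (hc : ∀ t, c t ^ 2 ≤ C) :
    L1Null μ fun n ω => (n : ℝ)⁻¹ * ∑ t ∈ Finset.Icc 2 n, (c t * X (t - 1) ω) * ε t ω := by
  obtain ⟨K, hK0, hK⟩ := h.exists_integral_pow_four_le hB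
  refine h.l1Null_mean (g := fun t x => c t * x) (e := fun _ x => x) (G := C * (1 + K)) (H := 1)
    (fun t => by fun_prop) (fun t => measurable_id) (fun t _ => (h.memLp_two_X _).const_mul _)
    (fun t ht => (h.memLp_eps ht).mono_exponent (by norm_num)) (fun t ht => h.integral_eps ht)
    (fun t ht => ?_) (fun t ht => (h.integral_eps_sq ht).le)
  simp_rw [mul_pow]
  rw [integral_const_mul]
  exact mul_le_mul (hc t) (integral_sq_le_one_add (h.memLp_X _) (hK _))
    (integral_nonneg fun ω => sq_nonneg _) ((sq_nonneg _).trans (hc t))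

theorem l1Null_mean_eps_sq (h : IsHeteroscedasticAR1 μ θ τ X ε)
    {c : ℕ → ℝ} {C : ℝ} (hc : ∀ t, c t ^ 2 ≤ C) :
    L1Null μ fun n ω => (n : ℝ)⁻¹ * ∑ t ∈ Finset.Icc 2 n, c t * (ε t ω ^ 2 - 1) := by
  refine h.l1Null_mean (g := fun t _ => c t) (e := fun _ x => x ^ 2 - 1) (G := C)
    (fun t => measurable_const) (fun t => by fun_prop) (fun t _ => memLp_const _)
    (fun t ht => h.memLp_eps_sq_sub_one ht) (fun t ht => h.integral_eps_sq_sub_one ht)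
    (fun t ht => by simpa using hc t) (fun t ht => (h.integral_eps_sq_sub_one_sq ht).le)

theorem l1Null_mean_sq_mul_eps_sq (h : IsHeteroscedasticAR1 μ θ τ X ε)
    (hB : ∀ t, 1 ≤ t → τ t ^ 2 ≤ B) {c : ℕ → ℝ} {C : ℝ} (hc : ∀ t, c t ^ 2 ≤ C) :
    L1Null μ fun n ω => (n : ℝ)⁻¹ *
      ∑ t ∈ Finset.Icc 2 n, (c t * X (t - 1) ω ^ 2) * (ε t ω ^ 2 - 1) := by
  obtain ⟨K, hK0, hK⟩ := h.exists_integral_pow_four_le hB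
  refine h.l1Null_mean (g := fun t x => c t * x ^ 2) (e := fun _ x => x ^ 2 - 1) (G := C * K)
    (fun t => by fun_prop) (fun t => by fun_prop)
    (fun t _ => (memLp_two_sq (h.memLp_X _)).const_mul _)
    (fun t ht => h.memLp_eps_sq_sub_one ht) (fun t ht => h.integral_eps_sq_sub_one ht)
    (fun t ht => ?_) (fun t ht => (h.integral_eps_sq_sub_one_sq ht).le)
  have hsq : ∀ ω, (c t * X (t - 1) ω ^ 2) ^ 2 = c t ^ 2 * X (t - 1) ω ^ 4 := fun ω => by ring
  simp_rw [hsq]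
  rw [integral_const_mul]
  exact mul_le_mul (hc t) (hK _) (integral_nonneg fun ω => by positivity)
    ((sq_nonneg _).trans (hc t))

/-- The squared score is of the order `n⁻¹`. -/
theorem l1Null_sqrt_mul_mean_sq (h : IsHeteroscedasticAR1 μ θ τ X ε)
    (hB : ∀ t, 1 ≤ t → τ t ^ 2 ≤ B) :
    L1Null μ fun n ω => √(n : ℝ) * ((n : ℝ)⁻¹ * ∑ t ∈ Finset.Icc 2 n,
      X (t - 1) ω * (X t ω - θ * X (t - 1) ω)) ^ 2 := by
  obtain ⟨K, hK0, hK⟩ := h.exists_integral_pow_four_le hB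
  have hB0 : 0 ≤ B := (sq_nonneg _).trans (hB 1 le_rfl)
  have h1 : ∀ n : ℕ, ∀ t ∈ Finset.Icc 2 n, 1 ≤ t := fun n t ht => by
    have := (Finset.mem_Icc.1 ht).1
    omega
  have hsum : ∀ (n : ℕ) ω, ∑ t ∈ Finset.Icc 2 n, X (t - 1) ω * (X t ω - θ * X (t - 1) ω) =
      ∑ t ∈ Finset.Icc 2 n, (τ t * X (t - 1) ω) * ε t ω := fun n ω =>
    Finset.sum_congr rfl fun t ht => by rw [h.sub_eq (h1 n t ht)]; ring
  simp_rw [hsum]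
  have hεL : ∀ t, 1 ≤ t → MemLp (ε t) 2 μ := fun t ht =>
    (h.memLp_eps ht).mono_exponent (by norm_num)
  have hbound := h.integral_sum_sq_le (g := fun t x => τ t * x) (e := fun _ x => x)
    (G := B * (1 + K)) (H := 1) (fun t => by fun_prop) (fun t => measurable_id)
    (fun t _ => (h.memLp_two_X _).const_mul _) hεL (fun t ht => h.integral_eps ht)
    (fun t ht => by
      simp_rw [mul_pow]
      rw [integral_const_mul]
      exact mul_le_mul (hB t ht) (integral_sq_le_one_add (h.memLp_X _) (hK _))
        (integral_nonneg fun ω => sq_nonneg _) hB0) (fun t ht => (h.integral_eps_sq ht).le)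
  have hL : ∀ n : ℕ, MemLp (fun ω => ∑ t ∈ Finset.Icc 2 n, (τ t * X (t - 1) ω) * ε t ω) 2 μ :=
    fun n => memLp_finsetSum _ fun t ht =>
      h.memLp_comp_mul_comp (h1 n t ht) (g := fun x => τ t * x) (e := fun x => x) (by fun_prop)
        measurable_id ((h.memLp_two_X _).const_mul _) (hεL t (h1 n t ht))
  simp_rw [mul_pow]
  refine .of_integral_abs_le (fun n => (((hL n).integrable_sq).const_mul _).const_mul _)
    (tendsto_const_div_sqrt_natCast (B * (1 + K))) fun n => ?_
  simp_rw [← mul_assoc (√(n : ℝ))]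
  have habs : ∀ ω, |√(n : ℝ) * (n : ℝ)⁻¹ ^ 2 *
      (∑ t ∈ Finset.Icc 2 n, (τ t * X (t - 1) ω) * ε t ω) ^ 2| = √(n : ℝ) * (n : ℝ)⁻¹ ^ 2 *
      (∑ t ∈ Finset.Icc 2 n, (τ t * X (t - 1) ω) * ε t ω) ^ 2 := fun ω =>
    abs_of_nonneg (by positivity)
  simp_rw [habs]
  rw [integral_const_mul]
  refine (mul_le_mul_of_nonneg_left (hbound n) (by positivity)).trans (le_of_eq ?_)
  rcases Nat.eq_zero_or_pos n with rfl | hn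
  · simp
  · have hn' : (0 : ℝ) < n := by exact_mod_cast hn
    have hs : 0 < √(n : ℝ) := Real.sqrt_pos.2 hn'
    have hss : √(n : ℝ) * √(n : ℝ) = n := Real.mul_self_sqrt hn'.le
    rw [eq_div_iff hs.ne']
    field_simp
    linear_combination B * hss

end IsHeteroscedasticAR1

/-! ### Laws of large numbers and the limiting constants. -/

theorem alternating_sq_le (u v : ℝ) (t : ℕ) : alternating u v t ^ 2 ≤ u ^ 2 + v ^ 2 := by
  unfold alternating
  split_ifs <;> nlinarith [sq_nonneg u, sq_nonneg v]

/-- Shifting the index of `d (t - 1) x (t - 1)²` leaves two boundary terms. On the right, the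
combination `x_t² - θ² x_{t-1}²` loses its `x_{t-1}²` part when the recursion is inserted. -/
theorem sum_telescope (d x : ℕ → ℝ) (θ : ℝ) {n : ℕ} (hn : 1 ≤ n) :
    ∑ t ∈ Finset.Icc 2 n, (d (t - 1) - θ ^ 2 * d t) * x (t - 1) ^ 2 =
      ∑ t ∈ Finset.Icc 2 n, d t * (x t ^ 2 - θ ^ 2 * x (t - 1) ^ 2) +
      (d 1 * x 1 ^ 2 - d n * x n ^ 2) := by
  induction n, hn using Nat.le_induction with
  | base => simp
  | succ n hn ih =>
    rw [Finset.sum_Icc_succ_top (by omega), Finset.sum_Icc_succ_top (by omega), ih]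
    simp only [Nat.add_sub_cancel]
    ring

namespace IsHeteroscedasticAR1

variable {μ : Measure Ω} {θ σ₁ σ₂ : ℝ} {X ε : ℕ → Ω → ℝ}

/-- Law of large numbers for periodically weighted squares of the autoregression. -/
theorem l1Null_mean_weighted_sq [IsProbabilityMeasure μ]
    (h : IsHeteroscedasticAR1 μ θ (alternating σ₁ σ₂) X ε)
    (p q : ℝ) : L1Null μ fun n ω => (n : ℝ)⁻¹ * ∑ t ∈ Finset.Icc 2 n,
      (alternating p q (t - 1) - θ ^ 2 * alternating p q t) * X (t - 1) ω ^ 2 -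
      (p * σ₁ ^ 2 + q * σ₂ ^ 2) / 2 := by
  have hB : ∀ t, 1 ≤ t → alternating σ₁ σ₂ t ^ 2 ≤ σ₁ ^ 2 + σ₂ ^ 2 := fun t _ =>
    alternating_sq_le _ _ t
  obtain ⟨K, hK0, hK⟩ := h.exists_integral_pow_four_le hB
  set d := alternating p q with hd
  set τ := alternating σ₁ σ₂ with hτ
  have hdτ : ∀ t, d t * τ t ^ 2 = alternating (p * σ₁ ^ 2) (q * σ₂ ^ 2) t := fun t => by
    simp only [hd, hτ, alternating]
    split_ifs <;> rfl
  have n1 : L1Null μ fun n _ => (n : ℝ)⁻¹ * ∑ t ∈ Finset.Icc 2 n, d t * τ t ^ 2 -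
      (p * σ₁ ^ 2 + q * σ₂ ^ 2) / 2 := by
    refine .of_deterministic ?_
    simp_rw [hdτ]
    exact tendsto_sub_nhds_zero_iff.2 (tendsto_mean_alternating _ _)
  have n2 := h.l1Null_mean_mul_eps hB (c := fun t => 2 * θ * (d t * τ t))
    (C := (2 * θ) ^ 2 * ((p ^ 2 + q ^ 2) * (σ₁ ^ 2 + σ₂ ^ 2))) fun t => by
      rw [mul_pow (2 * θ), mul_pow (d t)]
      have h1 := alternating_sq_le p q t
      have h2 := alternating_sq_le σ₁ σ₂ t
      gcongr
  have n3 := h.l1Null_mean_eps_sq (c := fun t => d t * τ t ^ 2)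
    (C := (p * σ₁ ^ 2) ^ 2 + (q * σ₂ ^ 2) ^ 2) fun t => by
      rw [hdτ]
      exact alternating_sq_le _ _ t
  have hX2 : ∀ t, Integrable (fun ω => X t ω ^ 2) μ := fun t => (h.memLp_two_X t).integrable_sq
  -- The boundary terms of the summation by parts are bounded in `L¹`, hence negligible after
  -- division by `n`.
  have n4 : L1Null μ fun n ω => (n : ℝ)⁻¹ * (d 1 * X 1 ω ^ 2 - d n * X n ω ^ 2) := by
    refine .of_integral_abs_le (fun n => (((hX2 1).const_mul _).sub ((hX2 n).const_mul _)).const_mul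
      _) (tendsto_const_div_atTop_nhds_zero_nat (2 * ((|p| + |q|) * (1 + K)))) fun n => ?_
    have hdb : ∀ t, |d t| ≤ |p| + |q| := fun t => by
      simp only [hd, alternating]
      split_ifs
      · linarith [abs_nonneg q]
      · linarith [abs_nonneg p]
    have hXK : ∀ t, ∫ ω, X t ω ^ 2 ∂μ ≤ 1 + K := fun t =>
      integral_sq_le_one_add (h.memLp_X t) (hK t)
    calc ∫ ω, |(n : ℝ)⁻¹ * (d 1 * X 1 ω ^ 2 - d n * X n ω ^ 2)| ∂μ
        ≤ ∫ ω, (n : ℝ)⁻¹ * ((|p| + |q|) * X 1 ω ^ 2 + (|p| + |q|) * X n ω ^ 2) ∂μ := by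
          refine integral_mono ((((hX2 1).const_mul _).sub ((hX2 n).const_mul _)).const_mul _).abs
            ((((hX2 1).const_mul _).add ((hX2 n).const_mul _)).const_mul _) fun ω => ?_
          simp only
          rw [abs_mul, abs_of_nonneg (by positivity : 0 ≤ (n : ℝ)⁻¹)]
          gcongr
          refine (abs_sub _ _).trans ?_
          rw [abs_mul, abs_mul, abs_of_nonneg (sq_nonneg (X 1 ω)),
            abs_of_nonneg (sq_nonneg (X n ω))]
          gcongr
          · exact hdb 1
          · exact hdb n
      _ = (n : ℝ)⁻¹ * ((|p| + |q|) * ∫ ω, X 1 ω ^ 2 ∂μ + (|p| + |q|) * ∫ ω, X n ω ^ 2 ∂μ) := by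
          rw [integral_const_mul, integral_add ((hX2 1).const_mul _) ((hX2 n).const_mul _),
            integral_const_mul, integral_const_mul]
      _ ≤ (n : ℝ)⁻¹ * ((|p| + |q|) * (1 + K) + (|p| + |q|) * (1 + K)) := by
          gcongr
          · exact hXK 1
          · exact hXK n
      _ = 2 * ((|p| + |q|) * (1 + K)) / n := by ring
  refine (((n1.add n2).add n3).add n4).congr fun n ω => ?_
  rcases Nat.eq_zero_or_pos n with rfl | hn
  · simp
  · rw [sum_telescope d (fun t => X t ω) θ hn]
    -- Squaring the recursion gives `X_t² - θ² X_{t-1}² = τ_t² + 2 θ τ_t X_{t-1} ε_t + τ_t² (ε_t² -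
    -- 1)`; the three parts are handled by `n1`, `n2` and `n3`.
    have : ∑ t ∈ Finset.Icc 2 n, d t * (X t ω ^ 2 - θ ^ 2 * X (t - 1) ω ^ 2) =
        ∑ t ∈ Finset.Icc 2 n, d t * τ t ^ 2 +
        ∑ t ∈ Finset.Icc 2 n, 2 * θ * (d t * τ t) * X (t - 1) ω * ε t ω +
        ∑ t ∈ Finset.Icc 2 n, d t * τ t ^ 2 * (ε t ω ^ 2 - 1) := by
      rw [← Finset.sum_add_distrib, ← Finset.sum_add_distrib]
      refine Finset.sum_congr rfl fun t ht => ?_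
      have ht1 : 1 ≤ t := by
        have := (Finset.mem_Icc.1 ht).1
        omega
      rw [h.recursion t ht1]
      ring
    rw [this]
    ring

/-- The limit of the mean of the squares. -/
def sqMean (θ σ₁ σ₂ : ℝ) : ℝ := (σ₁ ^ 2 + σ₂ ^ 2) / (2 * (1 - θ ^ 2))

/-- The limit of the mean of the squared products of errors and preceding observations. -/
def scoreVar (θ σ₁ σ₂ : ℝ) : ℝ :=
  (σ₁ ^ 2 * σ₂ ^ 2 + θ ^ 2 * (σ₁ ^ 4 + σ₂ ^ 4) / 2) / (1 - θ ^ 4)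

theorem one_sub_sq_pos (h : IsHeteroscedasticAR1 μ θ (alternating σ₁ σ₂) X ε) :
    0 < 1 - θ ^ 2 := by
  have := (sq_lt_one_iff_abs_lt_one θ).2 h.abs_theta_lt_one
  linarith

theorem one_sub_pow_four_pos (h : IsHeteroscedasticAR1 μ θ (alternating σ₁ σ₂) X ε) :
    0 < 1 - θ ^ 4 := by
  have h1 := h.one_sub_sq_pos
  have : 1 - θ ^ 4 = (1 - θ ^ 2) * (1 + θ ^ 2) := by ring
  rw [this]
  positivity

theorem sd_pos (h : IsHeteroscedasticAR1 μ θ (alternating σ₁ σ₂) X ε) : 0 < σ₁ ∧ 0 < σ₂ :=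
  ⟨by simpa [alternating] using h.tau_pos 1 le_rfl,
    by
      have := h.tau_pos 2 one_le_two
      rwa [alternating, if_neg (by decide)] at this⟩

theorem sqMean_pos (h : IsHeteroscedasticAR1 μ θ (alternating σ₁ σ₂) X ε) :
    0 < sqMean θ σ₁ σ₂ := by
  have := h.one_sub_sq_pos
  have := h.sd_pos.1
  unfold sqMean
  positivity

theorem scoreVar_pos (h : IsHeteroscedasticAR1 μ θ (alternating σ₁ σ₂) X ε) :
    0 < scoreVar θ σ₁ σ₂ := by
  have := h.one_sub_pow_four_pos
  have := h.sd_pos.1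
  have := h.sd_pos.2
  unfold scoreVar
  positivity

theorem scoreVar_div_eq (h : IsHeteroscedasticAR1 μ θ (alternating σ₁ σ₂) X ε) :
    scoreVar θ σ₁ σ₂ / sqMean θ σ₁ σ₂ ^ 2 = limitVar θ σ₁ σ₂ := by
  have h2 := h.one_sub_sq_pos
  have h1 := h.sd_pos.1
  have h4 : 1 - θ ^ 4 = (1 - θ ^ 2) * (1 + θ ^ 2) := by ring
  unfold scoreVar sqMean limitVar
  rw [h4]
  field_simp
  ring

/-- The constant weight `(1 - θ²)⁻¹` solves `d - θ² d = 1`. -/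
theorem l1Null_mean_sq [IsProbabilityMeasure μ]
    (h : IsHeteroscedasticAR1 μ θ (alternating σ₁ σ₂) X ε) :
    L1Null μ fun n ω => (n : ℝ)⁻¹ * ∑ t ∈ Finset.Icc 2 n, X (t - 1) ω ^ 2 -
      sqMean θ σ₁ σ₂ := by
  have h2 := h.one_sub_sq_pos
  refine (h.l1Null_mean_weighted_sq (1 - θ ^ 2)⁻¹ (1 - θ ^ 2)⁻¹).congr fun n ω => ?_
  congr 1
  · congr 1
    refine Finset.sum_congr rfl fun t _ => ?_
    simp only [alternating, ite_self]
    field_simp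
  · unfold sqMean
    field_simp

theorem l1Null_mean_sq_mul_sq [IsProbabilityMeasure μ]
    (h : IsHeteroscedasticAR1 μ θ (alternating σ₁ σ₂) X ε) :
    L1Null μ fun n ω => (n : ℝ)⁻¹ * ∑ t ∈ Finset.Icc 2 n,
      X (t - 1) ω ^ 2 * (X t ω - θ * X (t - 1) ω) ^ 2 - scoreVar θ σ₁ σ₂ := by
  have h4 := h.one_sub_pow_four_pos
  have hB : ∀ t, 1 ≤ t → alternating σ₁ σ₂ t ^ 2 ≤ σ₁ ^ 2 + σ₂ ^ 2 := fun t _ =>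
    alternating_sq_le _ _ t
  -- These are the odd and even values of the two-periodic solution of `d (t - 1) - θ² d t = τ_t²`.
  -- The remaining part, with `ε_t² - 1` in place of `ε_t²`, is `n2`.
  have n1 := h.l1Null_mean_weighted_sq ((σ₂ ^ 2 + θ ^ 2 * σ₁ ^ 2) / (1 - θ ^ 4))
    ((σ₁ ^ 2 + θ ^ 2 * σ₂ ^ 2) / (1 - θ ^ 4))
  have n2 := h.l1Null_mean_sq_mul_eps_sq hB (c := fun t => alternating σ₁ σ₂ t ^ 2)
    (C := (σ₁ ^ 2 + σ₂ ^ 2) ^ 2) fun t =>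
      pow_le_pow_left₀ (sq_nonneg _) (alternating_sq_le _ _ t) 2
  refine (n1.add n2).congr fun n ω => ?_
  have hlim : ((σ₂ ^ 2 + θ ^ 2 * σ₁ ^ 2) / (1 - θ ^ 4) * σ₁ ^ 2 +
      (σ₁ ^ 2 + θ ^ 2 * σ₂ ^ 2) / (1 - θ ^ 4) * σ₂ ^ 2) / 2 = scoreVar θ σ₁ σ₂ := by
    unfold scoreVar
    field_simp
    ring
  rw [hlim, sub_add_eq_add_sub, ← mul_add, ← Finset.sum_add_distrib]
  congr 2
  refine Finset.sum_congr rfl fun t ht => ?_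
  have ht2 := (Finset.mem_Icc.1 ht).1
  rw [h.sub_eq (by omega)]
  have hd : alternating ((σ₂ ^ 2 + θ ^ 2 * σ₁ ^ 2) / (1 - θ ^ 4))
      ((σ₁ ^ 2 + θ ^ 2 * σ₂ ^ 2) / (1 - θ ^ 4)) (t - 1) -
      θ ^ 2 * alternating ((σ₂ ^ 2 + θ ^ 2 * σ₁ ^ 2) / (1 - θ ^ 4))
      ((σ₁ ^ 2 + θ ^ 2 * σ₂ ^ 2) / (1 - θ ^ 4)) t = alternating σ₁ σ₂ t ^ 2 := by
    obtain ⟨s, rfl⟩ : ∃ s, t = s + 1 := ⟨t - 1, by omega⟩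
    rw [Nat.add_sub_cancel]
    unfold alternating
    rcases Nat.even_or_odd s with he | ho
    · rw [if_neg (Nat.not_odd_iff_even.2 he), if_pos he.add_one, if_pos he.add_one]
      field_simp
      ring
    · rw [if_pos ho, if_neg (Nat.not_odd_iff_even.2 ho.add_one),
        if_neg (Nat.not_odd_iff_even.2 ho.add_one)]
      field_simp
      ring
  rw [hd]
  ring

end IsHeteroscedasticAR1

/-! ### Conditioning on the data by freezing the path. -/

section Conditioning

variable {μ : Measure Ω} [IsProbabilityMeasure μ] {α β : Type*} [MeasurableSpace α]
  [MeasurableSpace β]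

/-- The conditional probability of an event which depends on two independent variables, given
one of them. -/
theorem condExp_indicator_ae_eq_of_indepFun {U : Ω → α} {V : Ω → β} (hU : Measurable U)
    (hV : Measurable V) (hUV : IndepFun U V μ) {s : Set (α × β)} (hs : MeasurableSet s) :
    μ⟦{ω | (U ω, V ω) ∈ s} | MeasurableSpace.comap V inferInstance⟧ =ᵐ[μ]
      fun ω => μ.real {ω' | (U ω', V ω) ∈ s} := by
  have hm : MeasurableSpace.comap V inferInstance ≤ (inferInstance : MeasurableSpace Ω) :=
    hV.comap_le
  have hmapU : IsProbabilityMeasure (μ.map U) := Measure.isProbabilityMeasure_map hU.aemeasurable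
  have hmapV : IsProbabilityMeasure (μ.map V) := Measure.isProbabilityMeasure_map hV.aemeasurable
  set k : β → ENNReal := fun v => μ.map U ((fun u => (u, v)) ⁻¹' s) with hk
  have hkm : Measurable k := measurable_measure_prodMk_right hs
  have hkV : ∀ ω, μ.real {ω' | (U ω', V ω) ∈ s} = (k (V ω)).toReal := fun ω => by
    simp only [hk]
    rw [Measure.map_apply hU (measurable_prodMk_right hs)]
    rfl
  have hev : MeasurableSet {ω | (U ω, V ω) ∈ s} := (hU.prodMk hV) hs
  simp_rw [hkV]
  have hgm : StronglyMeasurable[MeasurableSpace.comap V inferInstance]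
      fun ω => (k (V ω)).toReal :=
    (hkm.ennreal_toReal.comp (comap_measurable V)).stronglyMeasurable
  have hgi : Integrable (fun ω => (k (V ω)).toReal) μ :=
    (integrable_const (1 : ℝ)).mono' (hgm.mono hm).aestronglyMeasurable
      (ae_of_all _ fun ω => by
        rw [Real.norm_eq_abs, abs_of_nonneg ENNReal.toReal_nonneg]
        exact ENNReal.toReal_le_of_le_ofReal zero_le_one (by simpa using prob_le_one))
  symm
  refine ae_eq_condExp_of_forall_setIntegral_eq hm ((integrable_const 1).indicator hev)
    (fun _ _ _ => hgi.integrableOn) ?_ hgm.aestronglyMeasurable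
  -- Sets of the σ-algebra are preimages `V ⁻¹' B`; on them the claim is Tonelli's theorem for the
  -- product law of `(U, V)`.
  rintro _ ⟨B, hB, rfl⟩ -
  rw [integral_indicator_const _ hev, smul_eq_mul, mul_one, Measure.real,
    Measure.restrict_apply hev]
  have hL : ∫ ω in V ⁻¹' B, (k (V ω)).toReal ∂μ = (∫⁻ ω in V ⁻¹' B, k (V ω) ∂μ).toReal := by
    exact integral_toReal (f := fun ω => k (V ω)) (hkm.comp hV).aemeasurable
      (ae_of_all _ fun ω => prob_le_one.trans_lt ENNReal.one_lt_top)
  rw [hL]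
  congr 1
  have hpair := (indepFun_iff_map_prod_eq_prod_map_map hU.aemeasurable hV.aemeasurable).1 hUV
  have hsB : MeasurableSet (s ∩ Prod.snd ⁻¹' B) := hs.inter (measurable_snd hB)
  have e1 : μ ({ω | (U ω, V ω) ∈ s} ∩ V ⁻¹' B) =
      (μ.map fun ω => (U ω, V ω)) (s ∩ Prod.snd ⁻¹' B) := by
    rw [Measure.map_apply (hU.prodMk hV) hsB]
    rfl
  rw [e1, hpair, Measure.prod_apply_symm hsB, lintegral_map
    (measurable_measure_prodMk_right hsB) hV, ← lintegral_indicator (hV hB)]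
  congr 1 with ω
  by_cases hω : V ω ∈ B
  · rw [Set.indicator_of_mem (show ω ∈ V ⁻¹' B from hω)]
    simp only [hk]
    congr 1
    ext u
    simp [hω]
  · rw [Set.indicator_of_notMem (show ω ∉ V ⁻¹' B from hω)]
    have : (fun u => (u, V ω)) ⁻¹' (s ∩ Prod.snd ⁻¹' B) = ∅ := by
      ext u
      simp [hω]
    rw [this, measure_empty]

/-- Extension by zero of a vector indexed by `1 ≤ t ≤ n`. -/
def extendZero (n : ℕ) (v : Finset.Icc 1 n → ℝ) (t : ℕ) : ℝ :=
  if h : t ∈ Finset.Icc 1 n then v ⟨t, h⟩ else 0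

theorem measurable_extendZero (n t : ℕ) : Measurable fun v => extendZero n v t := by
  unfold extendZero
  split_ifs
  · fun_prop
  · exact measurable_const

/-- The estimator depends only on the coordinates `1, …, n`, so the root can be transported to the
product of two finite coordinate spaces. -/
theorem wbLse_congr {Ω Ω' : Type*} {w : ℕ → ℕ → Ω → ℝ} {w' : ℕ → ℕ → Ω' → ℝ} {X : ℕ → Ω → ℝ}
    {X' : ℕ → Ω' → ℝ} {n : ℕ} {ω : Ω} {ω' : Ω'}
    (hw : ∀ t ∈ Finset.Icc 1 n, w n t ω = w' n t ω')
    (hX : ∀ t ∈ Finset.Icc 1 n, X t ω = X' t ω') : wbLse w X n ω = wbLse w' X' n ω' := by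
  have h1 : ∀ t ∈ Finset.Icc 2 n, t ∈ Finset.Icc 1 n ∧ t - 1 ∈ Finset.Icc 1 n := fun t ht => by
    simp only [Finset.mem_Icc] at *
    omega
  unfold wbLse
  congr 1 <;> refine Finset.sum_congr rfl fun t ht => ?_
  · rw [hw t (h1 t ht).1, hX t (h1 t ht).1, hX _ (h1 t ht).2]
  · rw [hw t (h1 t ht).1, hX _ (h1 t ht).2]

theorem lse_congr {Ω Ω' : Type*} {X : ℕ → Ω → ℝ} {X' : ℕ → Ω' → ℝ} {n : ℕ} {ω : Ω} {ω' : Ω'}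
    (hX : ∀ t ∈ Finset.Icc 1 n, X t ω = X' t ω') : lse X n ω = lse X' n ω' := by
  have h1 : ∀ t ∈ Finset.Icc 2 n, t ∈ Finset.Icc 1 n ∧ t - 1 ∈ Finset.Icc 1 n := fun t ht => by
    simp only [Finset.mem_Icc] at *
    omega
  unfold lse
  congr 1 <;> refine Finset.sum_congr rfl fun t ht => ?_
  · rw [hX t (h1 t ht).1, hX _ (h1 t ht).2]
  · rw [hX _ (h1 t ht).2]

theorem dataSigma_eq_comap {Ω : Type*} (X : ℕ → Ω → ℝ) (n : ℕ) : dataSigma X n =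
    MeasurableSpace.comap (fun ω (i : Finset.Icc 1 n) => X i ω) inferInstance := by
  rw [dataSigma, iSup_subtype']
  simp only [MeasurableSpace.pi, MeasurableSpace.comap_iSup, MeasurableSpace.comap_comp]
  rfl

/-- The bootstrap distribution function is obtained by integrating out the weights. -/
theorem bootstrapCDF_ae_eq {w : ℕ → ℕ → Ω → ℝ} {X : ℕ → Ω → ℝ} {n : ℕ}
    (hw : ∀ t ∈ Finset.Icc 1 n, Measurable (w n t)) (hX : ∀ t, Measurable (X t))
    (hindep : IndepFun (fun ω (i : Finset.Icc 1 n) => w n i ω) (fun ω (t : ℕ) => X t ω) μ)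
    (x : ℝ) : bootstrapCDF μ w X x n =ᵐ[μ] fun ω => μ.real {ω' | √(n : ℝ) * (weightSD μ w n)⁻¹ *
      (wbLse w (fun t _ => X t ω) n ω' - lse (fun t _ => X t ω) n ω') ≤ x} := by
  set U : Ω → Finset.Icc 1 n → ℝ := fun ω i => w n i ω with hUdef
  set V : Ω → Finset.Icc 1 n → ℝ := fun ω i => X i ω with hVdef
  have hU : Measurable U := measurable_pi_lambda _ fun i => hw i i.2
  have hV : Measurable V := measurable_pi_lambda _ fun i => hX i
  have hUV : IndepFun U V μ :=
    hindep.comp (ψ := fun (y : ℕ → ℝ) (i : Finset.Icc 1 n) => y i) measurable_id (by fun_prop)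
  set s : Set ((Finset.Icc 1 n → ℝ) × (Finset.Icc 1 n → ℝ)) := {z | √(n : ℝ) *
    (weightSD μ w n)⁻¹ * (wbLse (fun _ t z => extendZero n z.1 t) (fun t z => extendZero n z.2 t)
      n z - lse (fun t z => extendZero n z.2 t) n z) ≤ x} with hs
  have hsm : MeasurableSet s := by
    have h1 : ∀ t, Measurable fun z : (Finset.Icc 1 n → ℝ) × (Finset.Icc 1 n → ℝ) =>
      extendZero n z.1 t := fun t => (measurable_extendZero n t).comp measurable_fst
    have h2 : ∀ t, Measurable fun z : (Finset.Icc 1 n → ℝ) × (Finset.Icc 1 n → ℝ) =>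
      extendZero n z.2 t := fun t => (measurable_extendZero n t).comp measurable_snd
    refine measurableSet_le ?_ measurable_const
    unfold wbLse lse
    fun_prop
  have hUe : ∀ ω, ∀ t ∈ Finset.Icc 1 n, w n t ω = extendZero n (U ω) t := fun ω t ht => by
    rw [extendZero, dif_pos ht]
  have hVe : ∀ ω, ∀ t ∈ Finset.Icc 1 n, X t ω = extendZero n (V ω) t := fun ω t ht => by
    rw [extendZero, dif_pos ht]
  have key := condExp_indicator_ae_eq_of_indepFun hU hV hUV hsm
  have e1 : {ω | √(n : ℝ) * (weightSD μ w n)⁻¹ * (wbLse w X n ω - lse X n ω) ≤ x} =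
      {ω | (U ω, V ω) ∈ s} := by
    ext ω
    change _ ≤ x ↔ _ ≤ x
    rw [wbLse_congr (w' := fun _ t (z : (Finset.Icc 1 n → ℝ) × (Finset.Icc 1 n → ℝ)) =>
        extendZero n z.1 t) (X' := fun t z => extendZero n z.2 t) (ω' := (U ω, V ω))
        (hUe ω) (hVe ω),
      lse_congr (X' := fun t (z : (Finset.Icc 1 n → ℝ) × (Finset.Icc 1 n → ℝ)) =>
        extendZero n z.2 t) (ω' := (U ω, V ω)) (hVe ω)]
  have e2 : ∀ ω, {ω' | √(n : ℝ) * (weightSD μ w n)⁻¹ *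
      (wbLse w (fun t _ => X t ω) n ω' - lse (fun t _ => X t ω) n ω') ≤ x} =
      {ω' | (U ω', V ω) ∈ s} := by
    intro ω
    ext ω'
    change _ ≤ x ↔ _ ≤ x
    rw [wbLse_congr (X := fun t _ => X t ω) (w' := fun _ t (z : (Finset.Icc 1 n → ℝ) × (Finset.Icc 1 n → ℝ)) =>
        extendZero n z.1 t) (X' := fun t z => extendZero n z.2 t) (ω' := (U ω', V ω))
        (hUe ω') (hVe ω),
      lse_congr (ω := ω') (X := fun t (_ : Ω) => X t ω) (X' := fun t (z : (Finset.Icc 1 n → ℝ) × (Finset.Icc 1 n → ℝ)) =>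
        extendZero n z.2 t) (ω' := (U ω', V ω)) (hVe ω)]
  simp_rw [e2]
  unfold bootstrapCDF
  rw [e1, dataSigma_eq_comap]
  exact key

end Conditioning

theorem tendsto_zero_of_add_abs {ι : Type*} {l : Filter ι} {u v : ι → ℝ} (hu : ∀ i, 0 ≤ u i)
    (h : Tendsto (fun i => u i + |v i|) l (𝓝 0)) : Tendsto u l (𝓝 0) ∧ Tendsto v l (𝓝 0) :=
  ⟨squeeze_zero hu (fun _ => le_add_of_nonneg_right (abs_nonneg _)) h,
    squeeze_zero_norm (fun i => le_add_of_nonneg_left (hu i)) h⟩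

end WeightedBootstrapAR

end

/-! ### The limit theorem. -/

theorem theorem6 {Ω : Type*} [MeasurableSpace Ω] (μ : Measure Ω) [IsProbabilityMeasure μ]
    (θ σ₁ σ₂ : ℝ) (X ε : ℕ → Ω → ℝ) (w : ℕ → ℕ → Ω → ℝ)
    (hX : WeightedBootstrapAR.IsHeteroscedasticAR1 μ θ
      (WeightedBootstrapAR.alternating σ₁ σ₂) X ε)
    (hw : WeightedBootstrapAR.WeightConditions μ w)
    (hindep : ∀ n : ℕ, IndepFun (fun ω (i : Finset.Icc 1 n) => w n i ω)
      (fun ω (t : ℕ) => X t ω) μ)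
    (x : ℝ) :
    TendstoInMeasure μ
      (fun (n : ℕ) ω => WeightedBootstrapAR.bootstrapCDF μ w X x n ω -
        (gaussianReal 0 (WeightedBootstrapAR.limitVar θ σ₁ σ₂).toNNReal).real (Set.Iic x))
      atTop (fun _ => 0) := by
  have hB : ∀ t, 1 ≤ t → WeightedBootstrapAR.alternating σ₁ σ₂ t ^ 2 ≤ σ₁ ^ 2 + σ₂ ^ 2 :=
    fun t _ => WeightedBootstrapAR.alternating_sq_le _ _ t
  have r1 := hX.l1Null_mean_sq
  have r2 := hX.l1Null_mean_sq_mul_sq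
  have r3 := hX.l1Null_sqrt_mul_mean_sq hB
  have r4 := hX.l1Null_sum_four_mul_four hB
  have r5 := hX.l1Null_mul_mean_pow_four hB
    (WeightedBootstrapAR.tendsto_const_div_sqrt_natCast 1)
  have r6 := hX.l1Null_mul_mean_pow_four hB hw.A2_upper.tendsto_div_nhds_zero
  -- The six null sequences are merged into one sum of absolute values, so that a single subsequence
  -- serves them all.
  have hD := (((((r1.abs.add r2.abs).add r3.abs).add r4.abs).add r5.abs).add
    r6.abs).tendstoInMeasure
  -- Convergence in probability is equivalent to almost sure convergence along a further subsequence
  -- of every subsequence.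
  refine (exists_seq_tendstoInMeasure_atTop_iff fun n => (stronglyMeasurable_condExp.mono
    (iSup₂_le fun t _ => (hX.measurable_X t).comap_le)).aestronglyMeasurable.sub
    aestronglyMeasurable_const).2 fun ns hns => ?_
  obtain ⟨ns', hns', hae⟩ := (hD.comp hns.tendsto_atTop).exists_seq_tendsto_ae
  refine ⟨ns', hns', ?_⟩
  have hcdf := ae_all_iff.2 fun n => WeightedBootstrapAR.bootstrapCDF_ae_eq (hw.array.measurable n)
    hX.measurable_X (hindep n) x
  -- From here `ω` is fixed: it supplies a deterministic path, and only the weights remain random.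
  filter_upwards [hae, hcdf] with ω hω hc
  have hn : Tendsto (fun i => ns (ns' i)) atTop atTop :=
    hns.tendsto_atTop.comp hns'.tendsto_atTop
  obtain ⟨t5, t6⟩ := WeightedBootstrapAR.tendsto_zero_of_add_abs (fun i => by positivity) hω
  obtain ⟨t4, t5⟩ := WeightedBootstrapAR.tendsto_zero_of_add_abs (fun i => by positivity) t5
  obtain ⟨t3, t4⟩ := WeightedBootstrapAR.tendsto_zero_of_add_abs (fun i => by positivity) t4
  obtain ⟨t2, t3⟩ := WeightedBootstrapAR.tendsto_zero_of_add_abs (fun i => by positivity) t3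
  obtain ⟨t1, t2⟩ := WeightedBootstrapAR.tendsto_zero_of_add_abs (fun i => abs_nonneg _) t2
  have h2 := tendsto_sub_nhds_zero_iff.1 ((tendsto_zero_iff_abs_tendsto_zero _).2 t1)
  have hs := WeightedBootstrapAR.tendsto_sum_pathScore (x := fun t => X t ω) hn hX.sqMean_pos h2
    (tendsto_sub_nhds_zero_iff.1 t2) t3 t4 (by simpa only [one_div] using t5)
  have hroot := hw.tendsto_measureReal_root_le (x := fun t => X t ω) hn hX.sqMean_pos
    hX.scoreVar_pos h2 t6 hs.1 hs.2 x
  rw [hX.scoreVar_div_eq] at hroot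
  refine (tendsto_sub_nhds_zero_iff.2 hroot).congr fun i => ?_
  rw [hc]
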